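/- **Setting.** Let $n\ge 1$, let $\mathbb B_n$ be the open unit ball of $\mathbb C^n$, let $1<p<\infty$ and $\alpha>-1$. Let $dv_\alpha(z)=c_\alpha(1-|z|^2)^\alpha\,dv(z)$, where $v$ is Lebesgue measure on $\mathbb B_n$ normalized to total mass $1$ and $c_\alpha=\frac{\Gamma(n+\alpha+1)}{n!\,\Gamma(\alpha+1)}$. Let $L^p_\alpha=L^p(\mathbb B_n,v_\alpha)$, let $A^p_\alpha$ be its subspace of holomorphic functions, with the norm of $L^p_\alpha$, and write $z\overline w=\sum_i z_i\overline{w_i}$. For $a\in L^\infty$ let $M_af=af$ and let $T_a=P_\alpha M_a$ on $A^p_\alpha$, where $P_\alpha g(z)=\int_{\mathbb B_n}\frac{g(w)}{(1-z\overline w)^{n+1+\alpha}}\,dv_\alpha(w)$. The Toeplitz algebra $\mathcal T_{p,\alpha}$ is the closed subalgebra, in operator norm, of the bounded operators on $A^p_\alpha$ generated by $\{T_a:a\in L^\infty\}$. A finite positive Borel measure $\mu$ on $\mathbb B_n$ is a Carleson measure for $A^p_\alpha$ with constant $C$ if $\left(\int|f|^p\,d\mu\right)^{1/p}\le C\|f\|_{A^p_\alpha}$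 for all $f\in A^p_\alpha$. For such $\mu$ let $T_\mu f(z)=\int_{\mathbb B_n}\frac{f(w)}{(1-z\overline w)^{n+1+\alpha}}\,d\mu(w)$ for $f\in A^p_\alpha$; for a Borel set $G$, $\mu 1_G$ denotes the restriction of $\mu$ to $G$. Let $\varphi_z$ be the involutive automorphism of $\mathbb B_n$ with $\varphi_z(0)=z$, and let $\beta(z,w)=\frac12\log\frac{1+|\varphi_z(w)|}{1-|\varphi_z(w)|}$ be the hyperbolic metric. **Theorem 3.1.** For every $n\ge1$ there is a positive integer $N=N(n)$ with the following property. Let $1<p<\infty$, $\alpha>-1$, $S\in\mathcal T_{p,\alpha}$, $\varepsilon>0$ and $C\ge 0$. Then there is a finite number $d=d(n,\alpha,p,S,\varepsilon,C)$ such that for every Carleson measure $\mu$ for $A^p_\alpha$ with constant $C$ the operator $T_\mu$ is bounded on $A^p_\alpha$ and there are Borel sets $F_j\subset G_j\subset\mathbb B_n$ $(j=1,2,\dots)$, possibly empty, such that 1. $\mathbb B_n=\bigcup_j F_j$; 2. $F_j\cap F_k=\emptyset$ if $j\ne k$; 3. each point of $\mathbb B_n$ lies in no more than $N(n)$ of the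 sets $G_j$; 4. $\operatorname{diam}_\beta G_j\le d$ for all $j$; all the operators $T_{\mu 1_{G_j}}$ are bounded on $A^p_\alpha$, the series $\sum_j M_{1_{F_j}}ST_{\mu 1_{G_j}}f$ converges unconditionally in $L^p_\alpha$ for every $f\in A^p_\alpha$ and defines a bounded operator from $A^p_\alpha$ to $L^p_\alpha$, and $$\Big\|ST_\mu-\sum_{j=1}^\infty M_{1_{F_j}}ST_{\mu 1_{G_j}}\Big\|_{\mathcal L(A^p_\alpha,L^p_\alpha)}<\varepsilon .$$ -/

import Mathlib

open MeasureTheory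
open scoped ENNReal NNReal

namespace BergmanBall

noncomputable section

/-- The Hilbert space `ℂⁿ`. -/
abbrev Cn (n : ℕ) : Type := EuclideanSpace ℂ (Fin n)

/-- The open unit ball of `ℂⁿ`. -/
def unitBall (n : ℕ) : Set (Cn n) := Metric.ball 0 1

/-- Lebesgue measure on the unit ball, normalized to total mass one. -/
def normVolume (n : ℕ) : Measure (Cn n) :=
  (volume (unitBall n))⁻¹ • volume.restrict (unitBall n)

/-- The constant `c_α = Γ(n+α+1) / (n! Γ(α+1))`. -/
def cAlpha (n : ℕ) (α : ℝ) : ℝ :=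
  Real.Gamma (n + α + 1) / (n.factorial * Real.Gamma (α + 1))

/-- The measure `dv_α = c_α (1-|z|²)^α dv`. -/
def vAlpha (n : ℕ) (α : ℝ) : Measure (Cn n) :=
  (normVolume n).withDensity fun z => ENNReal.ofReal (cAlpha n α * (1 - ‖z‖ ^ 2) ^ α)

/-- The Lebesgue space `L^p_α`. -/
abbrev LpAlpha (n : ℕ) (α : ℝ) (p : ℝ≥0∞) : Type := Lp ℂ p (vAlpha n α)

/-- The classes in `L^p_α` of functions that are holomorphic on the ball. -/
def bergmanSubmodule (n : ℕ) (α : ℝ) (p : ℝ≥0∞) : Submodule ℂ (LpAlpha n α p) where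
  carrier := {f | ∃ g : Cn n → ℂ, DifferentiableOn ℂ g (unitBall n) ∧ f =ᵐ[vAlpha n α] g}
  zero_mem' := ⟨0, differentiableOn_const 0, Lp.coeFn_zero _ _ _⟩
  add_mem' := by
    rintro f₁ f₂ ⟨g₁, h₁, e₁⟩ ⟨g₂, h₂, e₂⟩
    exact ⟨g₁ + g₂, h₁.add h₂, (Lp.coeFn_add f₁ f₂).trans (e₁.add e₂)⟩
  smul_mem' := by
    rintro c f ⟨g, h, e⟩
    exact ⟨c • g, h.const_smul c, (Lp.coeFn_smul c f).trans (e.const_smul c)⟩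

/-- The weighted Bergman space `A^p_α`: the classes in `L^p_α` of functions that are holomorphic
on the ball, with the norm of `L^p_α`. -/
def Bergman (n : ℕ) (α : ℝ) (p : ℝ≥0∞) [Fact (1 ≤ p)] : Type := bergmanSubmodule n α p

instance (n : ℕ) (α : ℝ) (p : ℝ≥0∞) [Fact (1 ≤ p)] : NormedAddCommGroup (Bergman n α p) :=
  inferInstanceAs (NormedAddCommGroup (bergmanSubmodule n α p))

instance (n : ℕ) (α : ℝ) (p : ℝ≥0∞) [Fact (1 ≤ p)] : NormedSpace ℂ (Bergman n α p) :=
  inferInstanceAs (NormedSpace ℂ (bergmanSubmodule n α p))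

/-- The inclusion of `A^p_α` into `L^p_α`. -/
def incl (n : ℕ) (α : ℝ) (p : ℝ≥0∞) [Fact (1 ≤ p)] : Bergman n α p →L[ℂ] LpAlpha n α p :=
  (bergmanSubmodule n α p).subtypeL

/-- Bounded operators on `A^p_α`. -/
abbrev BergmanOp (n : ℕ) (α : ℝ) (p : ℝ≥0∞) [Fact (1 ≤ p)] : Type :=
  Bergman n α p →L[ℂ] Bergman n α p

/-- The integral `z ↦ ∫ f(w) / (1 - z w̄)^{n+1+α} dμ(w)`, where `z w̄ = ∑ zᵢ w̄ᵢ`. -/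
def kernelInt (n : ℕ) (α : ℝ) (μ : Measure (Cn n)) (f : Cn n → ℂ) (z : Cn n) : ℂ :=
  ∫ w, f w / (1 - inner ℂ w z) ^ ((n + 1 + α : ℝ) : ℂ) ∂μ

/-- The multiplication operator `M_a` on `L^p_α`, for `a ∈ L^∞`. -/
def mulOp (n : ℕ) (α : ℝ) (p : ℝ≥0∞) [Fact (1 ≤ p)] (a : LpAlpha n α ∞) :
    LpAlpha n α p →L[ℂ] LpAlpha n α p :=
  (ContinuousLinearMap.mul ℂ ℂ).holderL (vAlpha n α) ∞ p p a

/-- The class in `L^∞` of the indicator function `1_F` of a Borel set. -/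
def indicatorLinf (n : ℕ) (α : ℝ) (F : Set (Cn n)) (hF : MeasurableSet F) : LpAlpha n α ∞ :=
  MemLp.toLp (F.indicator fun _ => (1 : ℂ)) ((memLp_top_const (1 : ℂ)).indicator hF)

/-- `T` is the Toeplitz operator `T_a = P_α M_a` on `A^p_α`. -/
def IsToeplitz (n : ℕ) (α : ℝ) (p : ℝ≥0∞) [Fact (1 ≤ p)] (a : LpAlpha n α ∞)
    (T : BergmanOp n α p) : Prop :=
  ∀ f : Bergman n α p,
    incl n α p (T f) =ᵐ[vAlpha n α] kernelInt n α (vAlpha n α) (mulOp n α p a (incl n α p f))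

/-- The Toeplitz algebra: the closed subalgebra (in operator norm) of the bounded operators on
`A^p_α` that is generated by the Toeplitz operators with bounded symbols. -/
def toeplitzAlgebra (n : ℕ) (α : ℝ) (p : ℝ≥0∞) [Fact (1 ≤ p)] : Set (BergmanOp n α p) :=
  closure (Algebra.adjoin ℂ {T : BergmanOp n α p | ∃ a : LpAlpha n α ∞, IsToeplitz n α p a T} :
    Set (BergmanOp n α p))

/-- `μ` is a (positive, finite, Borel) measure on the unit ball, and it is a Carleson measure for
`A^p_α` with constant `C`: `‖f‖_{L^p(μ)} ≤ C ‖f‖_{L^p_α}` for all `f ∈ A^p_α`. -/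
structure IsCarlesonWith (n : ℕ) (α : ℝ) (p : ℝ≥0∞) (C : ℝ≥0) (μ : Measure (Cn n)) : Prop where
  finite : IsFiniteMeasure μ
  supported : μ (unitBall n)ᶜ = 0
  embedding : ∀ f : Cn n → ℂ, DifferentiableOn ℂ f (unitBall n) → MemLp f p (vAlpha n α) →
    eLpNorm f p μ ≤ C * eLpNorm f p (vAlpha n α)

/-- `T` is the operator `T_μ` on `A^p_α`. The measure `μ` may be singular, so elements of `A^p_α`
enter through their holomorphic representatives. -/
def IsToeplitzMeasure (n : ℕ) (α : ℝ) (p : ℝ≥0∞) [Fact (1 ≤ p)] (μ : Measure (Cn n))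
    (T : BergmanOp n α p) : Prop :=
  ∀ (f : Bergman n α p) (g : Cn n → ℂ), DifferentiableOn ℂ g (unitBall n) →
    incl n α p f =ᵐ[vAlpha n α] g → incl n α p (T f) =ᵐ[vAlpha n α] kernelInt n α μ g

/-- The orthogonal projection of `w` onto the line spanned by `z` (it is `0` if `z = 0`). -/
def lineProj {n : ℕ} (z w : Cn n) : Cn n := (inner ℂ z w / (‖z‖ : ℂ) ^ 2) • z

/-- The involutive automorphism `φ_z` of the ball that exchanges `0` and `z`:
`φ_z(w) = (z - P_z w - √(1-|z|²) (w - P_z w)) / (1 - w z̄)`. -/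
def mobius {n : ℕ} (z w : Cn n) : Cn n :=
  (1 - inner ℂ z w)⁻¹ •
    (z - lineProj z w - ((Real.sqrt (1 - ‖z‖ ^ 2) : ℝ) : ℂ) • (w - lineProj z w))

/-- The pseudohyperbolic metric `ρ(z,w) = |φ_z(w)|`. -/
def pseudoDist {n : ℕ} (z w : Cn n) : ℝ := ‖mobius z w‖

/-- The hyperbolic metric `β = ½ log ((1+ρ)/(1-ρ))`. -/
def hypDist {n : ℕ} (z w : Cn n) : ℝ :=
  (1 / 2) * Real.log ((1 + pseudoDist z w) / (1 - pseudoDist z w))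

end

end BergmanBall

/-! The proof measures off-diagonal decay by powers of `coshSq z w` = cosh² β(z,w). This quantity is
submultiplicative up to a constant: coshSq(z,w) ≤ 256 coshSq(z,u) coshSq(u,w) (`coshSq_mul`). For a
small η > 0, the modulus of the Bergman kernel multiplied by coshSq^η is still the kernel of a
bounded operator from L^p(μ) to L^p_α, uniformly over the Carleson measures μ with a given constant
(`exists_lintegral_wKernel_le`). This follows from Schur's test with powers of 1-|w|² and the
Forelli–Rudin estimates.

A Toeplitz operator with bounded symbol is therefore dominated by a positive kernel that stays
bounded on L^p_α after multiplication by the weight coshSq^η. Submultiplicativity preserves this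
property under composition, so every operator in the algebra generated by the Toeplitz operators,
before closure, has it (`isDominated_of_mem_adjoin`). Let S' be such an operator. If z lies in F_j
and w outside G_j, where coshSq(z,w) ≥ M, then 1 ≤ (256/M)^η coshSq(z,u)^η coshSq(u,w)^η for every
intermediate point u. On F_j, the difference between S' T_μ f and S' T_{μ1_{G_j}} f is thus at most
(256/M)^η times an expression that does not depend on j and has L^p norm bounded by a multiple of
‖f‖. As the F_j are disjoint, the localization error for S' is O(M^(-η)) (`norm_sub_glue_le`).

For general S, choose S' close to S. The contribution of S - S' to S T_μ is controlled by the norm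
of T_μ, and its contribution to the series by the overlap of the G_j: the p-th powers of the norms
of T_{μ1_{G_j}} f are bounded by the integrals of |f|^p over G_j with respect to μ, and these add up
to at most N times the full integral (`tsum_enorm_comp_rpow_le`). Here it matters that N does not
depend on M: S' is chosen after N, and M after S'.

Such coverings are built in `exists_cover`. The ball is cut into shells on which 1-|z|² varies by a
factor 4M, so that a neighbourhood {coshSq < M} reaches only adjacent shells. Each shell is cut
along a net for the quasi-metric |1 - z w̄| at a scale much larger than 1-|z|². At that scale the
number of cells near a point is bounded in terms of n only, by an anisotropic rescaling and
compactness (`exists_packing_bound`). -/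

namespace BergmanBall

/-! ### The quasi-metric |1 - z w̄| and the hyperbolic metric. -/

noncomputable section

variable {n : ℕ}

/-- The quantity `|1 - z w̄|`, a quasi-metric on the closed ball up to the diagonal. -/
def gap (z w : Cn n) : ℝ := ‖1 - inner ℂ w z‖

/-- The quantity `|1 - z w̄|² / ((1-|z|²)(1-|w|²))`, which is `cosh² β(z,w)` on the ball. -/
def coshSq (z w : Cn n) : ℝ := gap z w ^ 2 / ((1 - ‖z‖ ^ 2) * (1 - ‖w‖ ^ 2))

theorem mem_unitBall {z : Cn n} : z ∈ unitBall n ↔ ‖z‖ < 1 := by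
  simp [unitBall]

theorem one_sub_sq_pos {z : Cn n} (hz : ‖z‖ < 1) : 0 < 1 - ‖z‖ ^ 2 := by
  nlinarith [norm_nonneg z]

theorem gap_nonneg (z w : Cn n) : 0 ≤ gap z w := norm_nonneg _

theorem gap_comm (z w : Cn n) : gap z w = gap w z := by
  rw [gap, gap, ← RCLike.norm_conj, map_sub, map_one, inner_conj_symm]

theorem gap_self {z : Cn n} (hz : ‖z‖ < 1) : gap z z = 1 - ‖z‖ ^ 2 := by
  rw [gap, inner_self_eq_norm_sq_to_K]
  have : (1 - (‖z‖ : ℂ) ^ 2) = ((1 - ‖z‖ ^ 2 : ℝ) : ℂ) := by push_cast; rfl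
  erw [this, Complex.norm_real]
  exact abs_of_pos (one_sub_sq_pos hz)

theorem one_sub_mul_le_gap (z w : Cn n) : 1 - ‖z‖ * ‖w‖ ≤ gap z w := by
  have h1 : ‖(1 : ℂ)‖ - ‖(inner ℂ w z : ℂ)‖ ≤ gap z w := norm_sub_norm_le _ _
  have h2 := norm_inner_le_norm (𝕜 := ℂ) w z
  rw [norm_one] at h1
  linarith [mul_comm ‖z‖ ‖w‖]

theorem gap_le_two {z w : Cn n} (hz : ‖z‖ ≤ 1) (hw : ‖w‖ ≤ 1) : gap z w ≤ 2 := by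
  have h1 : gap z w ≤ ‖(1 : ℂ)‖ + ‖(inner ℂ w z : ℂ)‖ := norm_sub_le _ _
  have h2 := norm_inner_le_norm (𝕜 := ℂ) w z
  rw [norm_one] at h1
  nlinarith [norm_nonneg z, norm_nonneg w]

theorem one_sub_norm_le_gap {z w : Cn n} (hw : ‖w‖ ≤ 1) : 1 - ‖z‖ ≤ gap z w := by
  have := one_sub_mul_le_gap z w
  nlinarith [norm_nonneg z, norm_nonneg w]

theorem gap_pos {z w : Cn n} (hz : ‖z‖ < 1) (hw : ‖w‖ ≤ 1) : 0 < gap z w := by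
  linarith [one_sub_norm_le_gap (z := z) hw]

theorem one_sub_sq_le_gap {z w : Cn n} (hz : ‖z‖ ≤ 1) (hw : ‖w‖ ≤ 1) :
    1 - ‖z‖ ^ 2 ≤ 2 * gap z w := by
  have := one_sub_norm_le_gap (z := z) hw
  nlinarith [norm_nonneg z]

theorem norm_sub_sq_le_gap {z w : Cn n} (hz : ‖z‖ ≤ 1) (hw : ‖w‖ ≤ 1) :
    ‖z - w‖ ^ 2 ≤ 2 * gap z w := by
  have h1 := norm_sub_sq (𝕜 := ℂ) w z
  have h2 : (1 - (inner ℂ w z : ℂ)).re ≤ gap z w := Complex.re_le_norm _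
  have h3 : RCLike.re (inner ℂ w z : ℂ) = (inner ℂ w z : ℂ).re := rfl
  rw [Complex.sub_re, Complex.one_re] at h2
  rw [norm_sub_rev, h1, h3]
  nlinarith [norm_nonneg z, norm_nonneg w]

/-- Inserting u produces, besides the two gaps, the cross term ⟨u - w, z - u⟩ and 1-|u|².
Cauchy–Schwarz with `norm_sub_sq_le_gap` controls the first, and 1-|u|² ≤ 2 |1 - u w̄| the second.
-/
theorem gap_triangle {z u w : Cn n} (hz : ‖z‖ ≤ 1) (hu : ‖u‖ ≤ 1) (hw : ‖w‖ ≤ 1) :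
    gap z w ≤ 4 * (gap z u + gap u w) := by
  have e : 1 - (inner ℂ w z : ℂ) = (1 - inner ℂ u z) + inner ℂ (u - w) (z - u)
      + (inner ℂ u u - 1) + (1 - inner ℂ w u) := by
    simp only [inner_sub_left, inner_sub_right]; ring
  have h1 : ‖(inner ℂ u u - 1 : ℂ)‖ ≤ 2 * gap u w := by
    rw [inner_self_eq_norm_sq_to_K, norm_sub_rev]
    have : (1 - (‖u‖ : ℂ) ^ 2) = ((1 - ‖u‖ ^ 2 : ℝ) : ℂ) := by push_cast; rfl
    erw [this, Complex.norm_real]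
    rw [Real.norm_eq_abs, abs_of_nonneg (by nlinarith [norm_nonneg u])]
    exact one_sub_sq_le_gap hu hw
  have h2 : ‖(inner ℂ (u - w) (z - u) : ℂ)‖ ≤ gap z u + gap u w := by
    refine (norm_inner_le_norm _ _).trans ?_
    have a := norm_sub_sq_le_gap hz hu
    have b := norm_sub_sq_le_gap hu hw
    nlinarith [sq_nonneg (‖u - w‖ - ‖z - u‖)]
  calc gap z w = ‖(1 - inner ℂ u z) + inner ℂ (u - w) (z - u)
      + (inner ℂ u u - 1) + (1 - inner ℂ w u)‖ := by rw [gap, e]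
    _ ≤ ‖(1 - inner ℂ u z : ℂ)‖ + ‖(inner ℂ (u - w) (z - u) : ℂ)‖ + ‖(inner ℂ u u - 1 : ℂ)‖
        + ‖(1 - inner ℂ w u : ℂ)‖ := norm_add₄_le
    _ ≤ gap z u + (gap z u + gap u w) + 2 * gap u w + gap u w := by
        gcongr
        · exact le_rfl
        · exact le_rfl
    _ ≤ _ := by linarith [gap_nonneg z u]

theorem coshSq_comm (z w : Cn n) : coshSq z w = coshSq w z := by
  rw [coshSq, coshSq, gap_comm, mul_comm]

theorem coshSq_self {z : Cn n} (hz : ‖z‖ < 1) : coshSq z z = 1 := by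
  rw [coshSq, gap_self hz, sq]
  exact div_self (mul_pos (one_sub_sq_pos hz) (one_sub_sq_pos hz)).ne'

theorem coshSq_pos {z w : Cn n} (hz : ‖z‖ < 1) (hw : ‖w‖ < 1) : 0 < coshSq z w :=
  div_pos (pow_pos (gap_pos hz hw.le) 2) (mul_pos (one_sub_sq_pos hz) (one_sub_sq_pos hw))

/-- The quasi-triangle inequality multiplied by 1-|u|², which is at most twice either gap, turns the
sum of gaps into their product with constant 16; squaring gives 256. This multiplicative triangle
inequality is what lets weights pass through compositions of kernels. -/
theorem coshSq_mul {z u w : Cn n} (hz : ‖z‖ < 1) (hu : ‖u‖ < 1) (hw : ‖w‖ < 1) :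
    coshSq z w ≤ 256 * (coshSq z u * coshSq u w) := by
  have key : gap z w * (1 - ‖u‖ ^ 2) ≤ 16 * (gap z u * gap u w) := by
    have h1 := gap_triangle hz.le hu.le hw.le
    have h2 := one_sub_sq_le_gap hu.le hz.le
    have h3 := one_sub_sq_le_gap hu.le hw.le
    rw [gap_comm u z] at h2
    have h4 := one_sub_sq_pos hu
    have a := gap_nonneg z u
    have b := gap_nonneg u w
    calc gap z w * (1 - ‖u‖ ^ 2) ≤ 4 * (gap z u + gap u w) * (1 - ‖u‖ ^ 2) := by gcongr
      _ = 4 * (gap z u * (1 - ‖u‖ ^ 2) + gap u w * (1 - ‖u‖ ^ 2)) := by ring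
      _ ≤ 4 * (gap z u * (2 * gap u w) + gap u w * (2 * gap z u)) := by gcongr
      _ = _ := by ring
  have pz := one_sub_sq_pos hz
  have pu := one_sub_sq_pos hu
  have pw := one_sub_sq_pos hw
  have key2 : (gap z w * (1 - ‖u‖ ^ 2)) ^ 2 ≤ (16 * (gap z u * gap u w)) ^ 2 :=
    pow_le_pow_left₀ (mul_nonneg (gap_nonneg _ _) pu.le) key 2
  have e : 256 * (coshSq z u * coshSq u w)
      = (16 * (gap z u * gap u w)) ^ 2 / (1 - ‖u‖ ^ 2) ^ 2 / ((1 - ‖z‖ ^ 2) * (1 - ‖w‖ ^ 2)) := by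
    unfold coshSq; field_simp; ring
  rw [e, coshSq]
  gcongr
  rw [le_div_iff₀ (by positivity)]
  linarith [mul_pow (gap z w) (1 - ‖u‖ ^ 2) 2]

/-- Pythagoras for the components along z and orthogonal to z. It yields the classical identity 1 -
|φ_z(w)|² = (1-|z|²)(1-|w|²)/|1 - z w̄|². -/
theorem norm_sq_mobius_numerator {z : Cn n} (hz : ‖z‖ < 1) (w : Cn n) :
    ‖z - lineProj z w - ((Real.sqrt (1 - ‖z‖ ^ 2) : ℝ) : ℂ) • (w - lineProj z w)‖ ^ 2
      = gap z w ^ 2 - (1 - ‖z‖ ^ 2) * (1 - ‖w‖ ^ 2) := by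
  have hg : gap z w ^ 2 = 1 - 2 * (inner ℂ z w : ℂ).re + ‖(inner ℂ z w : ℂ)‖ ^ 2 := by
    rw [gap_comm, gap, ← Complex.normSq_eq_norm_sq, ← Complex.normSq_eq_norm_sq,
      Complex.normSq_apply, Complex.normSq_apply]
    simp; ring
  have hs : 0 ≤ 1 - ‖z‖ ^ 2 := (one_sub_sq_pos hz).le
  rcases eq_or_ne z 0 with rfl | hz0
  · simp [lineProj, hg]
  have hz1 : (‖z‖ : ℂ) ≠ 0 := by simpa using hz0
  have hz2 : ‖z‖ ≠ 0 := by simpa using hz0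
  set c : ℂ := inner ℂ z w / (‖z‖ : ℂ) ^ 2 with hc
  have hin : (inner ℂ z w : ℂ) = c * (‖z‖ : ℂ) ^ 2 := by rw [hc]; field_simp
  have horth : (inner ℂ z (w - lineProj z w) : ℂ) = 0 := by
    rw [lineProj, ← hc, inner_sub_right, inner_smul_right, inner_self_eq_norm_sq_to_K, hin]
    simp
  have hzz : z - lineProj z w = (1 - c) • z := by rw [lineProj, ← hc, sub_smul, one_smul]
  have hw2 : ‖w - lineProj z w‖ ^ 2 = ‖w‖ ^ 2 - ‖c‖ ^ 2 * ‖z‖ ^ 2 := by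
    have e : w = lineProj z w + (w - lineProj z w) := by abel
    have o : (inner ℂ (lineProj z w) (w - lineProj z w) : ℂ) = 0 := by
      have := inner_smul_left (𝕜 := ℂ) z (w - lineProj z w) c
      rwa [horth, mul_zero] at this
    have := norm_add_sq_eq_norm_sq_add_norm_sq_of_inner_eq_zero _ _ o
    rw [← e] at this
    have l : ‖lineProj z w‖ = ‖c‖ * ‖z‖ := by rw [lineProj, ← hc, norm_smul]
    rw [l] at this
    nlinarith
  have o2 : (inner ℂ (z - lineProj z w)
      (-(((Real.sqrt (1 - ‖z‖ ^ 2) : ℝ) : ℂ) • (w - lineProj z w))) : ℂ) = 0 := by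
    conv_lhs => rw [hzz, inner_smul_left, inner_neg_right, inner_smul_right, horth]
    simp
  have := norm_add_sq_eq_norm_sq_add_norm_sq_of_inner_eq_zero _ _ o2
  rw [← sub_eq_add_neg] at this
  rw [sq, this, norm_neg, norm_smul, hzz, norm_smul, hg, hin]
  have n1 : ‖(1 - c : ℂ)‖ ^ 2 = 1 - 2 * c.re + ‖c‖ ^ 2 := by
    rw [← Complex.normSq_eq_norm_sq, ← Complex.normSq_eq_norm_sq,
      Complex.normSq_apply, Complex.normSq_apply]
    simp; ring
  have n2 : (c * (‖z‖ : ℂ) ^ 2).re = c.re * ‖z‖ ^ 2 := by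
    have : ((‖z‖ : ℂ) ^ 2) = ((‖z‖ ^ 2 : ℝ) : ℂ) := by push_cast; rfl
    rw [this, Complex.re_mul_ofReal]
  have n3 : ‖c * (‖z‖ : ℂ) ^ 2‖ ^ 2 = ‖c‖ ^ 2 * (‖z‖ ^ 2) ^ 2 := by
    rw [norm_mul, norm_pow, Complex.norm_real, norm_norm, mul_pow]
  have n4 : ‖((Real.sqrt (1 - ‖z‖ ^ 2) : ℝ) : ℂ)‖ ^ 2 = 1 - ‖z‖ ^ 2 := by
    rw [Complex.norm_real, Real.norm_eq_abs, sq_abs, Real.sq_sqrt hs]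
  rw [n2, n3]
  calc _ = ‖(1 - c : ℂ)‖ ^ 2 * ‖z‖ ^ 2
      + ‖((Real.sqrt (1 - ‖z‖ ^ 2) : ℝ) : ℂ)‖ ^ 2 * ‖w - lineProj z w‖ ^ 2 := by ring
    _ = _ := by rw [n1, n4, hw2]; ring

theorem one_sub_pseudoDist_sq {z w : Cn n} (hz : ‖z‖ < 1) (hw : ‖w‖ < 1) :
    1 - pseudoDist z w ^ 2 = (coshSq z w)⁻¹ := by
  have hg := gap_pos hz hw.le
  have : ‖(1 - inner ℂ z w : ℂ)‖ = gap z w := by rw [gap_comm, gap]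
  rw [pseudoDist, mobius, norm_smul, mul_pow, norm_sq_mobius_numerator hz, norm_inv, this, coshSq]
  field_simp
  ring

/-- With ρ = |φ_z(w)|, (1+ρ)/(1-ρ) = (1+ρ)²/(1-ρ²) ≤ 4/(1-ρ²). Only this direction is needed, to
convert bounds on `coshSq` into bounds on the diameter. -/
theorem hypDist_le {z w : Cn n} (hz : ‖z‖ < 1) (hw : ‖w‖ < 1) :
    hypDist z w ≤ 1 / 2 * Real.log (4 * coshSq z w) := by
  have hc := coshSq_pos hz hw
  have h := one_sub_pseudoDist_sq hz hw
  have h0 : 0 ≤ pseudoDist z w := norm_nonneg _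
  have h1 : pseudoDist z w < 1 := by
    have : 0 < (coshSq z w)⁻¹ := inv_pos.2 hc
    nlinarith
  rw [hypDist]
  refine mul_le_mul_of_nonneg_left
    (Real.log_le_log (div_pos (by linarith) (by linarith)) ?_) (by norm_num)
  rw [div_le_iff₀ (by linarith)]
  have h2 : (1 - pseudoDist z w) * (1 + pseudoDist z w) * coshSq z w = 1 := by
    rw [show (1 - pseudoDist z w) * (1 + pseudoDist z w) = 1 - pseudoDist z w ^ 2 by ring, h]
    exact inv_mul_cancel₀ hc.ne'
  have h3 : (1 + pseudoDist z w) ^ 2 * (coshSq z w * (1 - pseudoDist z w))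
      = (1 + pseudoDist z w) * ((1 - pseudoDist z w) * (1 + pseudoDist z w) * coshSq z w) := by ring
  rw [h2, mul_one] at h3
  rw [← h3, mul_assoc]
  refine mul_le_mul_of_nonneg_right ?_ (mul_nonneg hc.le (by linarith))
  nlinarith

end

end BergmanBall

/-! ### Packing in nonisotropic balls. -/

namespace BergmanBall

noncomputable section

variable {n : ℕ}

theorem exists_card_le_of_separated {X : Type*} [PseudoMetricSpace X] {K : Set X}
    (hK : IsCompact K) {r : ℝ} (hr : 0 < r) :
    ∃ N : ℕ, ∀ {ι : Type} (s : Finset ι) (f : ι → X), (∀ i ∈ s, f i ∈ K) →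
      (∀ i ∈ s, ∀ j ∈ s, i ≠ j → r ≤ dist (f i) (f j)) → s.card ≤ N := by
  obtain ⟨t, -, ht, hc⟩ := hK.finite_cover_balls (half_pos hr)
  refine ⟨ht.toFinset.card, fun {ι} s f hf hs => ?_⟩
  have h : ∀ i, ∃ x, i ∈ s → x ∈ t ∧ f i ∈ Metric.ball x (r / 2) := fun i => by
    by_cases hi : i ∈ s
    · obtain ⟨x, hx, h⟩ := Set.mem_iUnion₂.1 (hc (hf i hi))
      exact ⟨x, fun _ => ⟨hx, h⟩⟩
    · exact ⟨f i, fun h => absurd h hi⟩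
  choose g hg using h
  refine Finset.card_le_card_of_injOn g (fun i hi => by simpa using (hg i hi).1) ?_
  intro i hi j hj hij
  by_contra hne
  have h1 := (hg i hi).2
  have h2 := (hg j hj).2
  rw [← hij] at h2
  have := hs i hi j hj hne
  have h3 := dist_triangle_right (f i) (f j) (g i)
  rw [Metric.mem_ball] at h1 h2
  linarith

theorem exists_unit_vector (hn : 1 ≤ n) (z : Cn n) :
    ∃ e : Cn n, ‖e‖ = 1 ∧ z = (‖z‖ : ℂ) • e := by
  rcases eq_or_ne z 0 with rfl | hz
  · exact ⟨EuclideanSpace.single ⟨0, hn⟩ 1, by simp, by simp⟩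
  · have : (‖z‖ : ℂ) ≠ 0 := by simpa using hz
    refine ⟨(‖z‖ : ℂ)⁻¹ • z, ?_, ?_⟩
    · rw [norm_smul, norm_inv, Complex.norm_real, norm_norm, inv_mul_cancel₀ (by simpa using hz)]
    · rw [smul_smul, mul_inv_cancel₀ this, one_smul]

theorem norm_sq_sub_proj {e : Cn n} (he : ‖e‖ = 1) (z : Cn n) :
    ‖z - (inner ℂ e z : ℂ) • e‖ ^ 2 = ‖z‖ ^ 2 - ‖(inner ℂ e z : ℂ)‖ ^ 2 := by
  have o : (inner ℂ ((inner ℂ e z : ℂ) • e) (z - (inner ℂ e z : ℂ) • e) : ℂ) = 0 := by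
    rw [inner_smul_left, inner_sub_right, inner_smul_right, inner_self_eq_norm_sq_to_K, he]
    simp
  have := norm_add_sq_eq_norm_sq_add_norm_sq_of_inner_eq_zero _ _ o
  rw [add_sub_cancel, norm_smul, he] at this
  nlinarith

/-- Moving z radially to the unit vector e changes the inner product by at most 1-|z|, which the gap
already dominates. Coordinates can therefore be taken relative to e even when z is far inside the
ball. -/
theorem norm_one_sub_inner_unit_le {e z u : Cn n} (he : ‖e‖ = 1) (hz : z = (‖z‖ : ℂ) • e)
    (hz1 : ‖z‖ ≤ 1) (hu : ‖u‖ ≤ 1) : ‖(1 - inner ℂ e u : ℂ)‖ ≤ 2 * gap u z := by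
  have h1 : (inner ℂ z u : ℂ) = ‖z‖ * inner ℂ e u := by
    conv_lhs => rw [hz, inner_smul_left]
    simp
  have h2 : (1 - inner ℂ e u : ℂ) = (1 - inner ℂ z u) + (-((1 - ‖z‖ : ℝ) : ℂ)) * inner ℂ e u := by
    rw [h1]; push_cast; ring
  have h3 : ‖(inner ℂ e u : ℂ)‖ ≤ 1 := (norm_inner_le_norm _ _).trans (by rw [he]; linarith)
  have h4 := one_sub_norm_le_gap (z := z) hu
  rw [gap_comm] at h4
  calc _ ≤ ‖(1 - inner ℂ z u : ℂ)‖ + ‖(-((1 - ‖z‖ : ℝ) : ℂ)) * inner ℂ e u‖ := by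
        rw [h2]; exact norm_add_le _ _
    _ ≤ gap u z + (1 - ‖z‖) * 1 := by
        rw [norm_mul, norm_neg, Complex.norm_real, Real.norm_of_nonneg (by linarith)]
        gcongr
        · exact le_rfl
    _ ≤ _ := by linarith

theorem norm_sq_sub_proj_le {e u : Cn n} (he : ‖e‖ = 1) (hu : ‖u‖ ≤ 1) :
    ‖u - (inner ℂ e u : ℂ) • e‖ ^ 2 ≤ 2 * ‖(1 - inner ℂ e u : ℂ)‖ := by
  rw [norm_sq_sub_proj he]
  have h3 : ‖(inner ℂ e u : ℂ)‖ ≤ 1 := (norm_inner_le_norm _ _).trans (by rw [he]; linarith)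
  have h4 : ‖(1 : ℂ)‖ - ‖(inner ℂ e u : ℂ)‖ ≤ ‖(1 - inner ℂ e u : ℂ)‖ := norm_sub_norm_le _ _
  rw [norm_one] at h4
  nlinarith [norm_nonneg u, norm_nonneg (inner ℂ e u : ℂ)]

/-- A gap estimate in terms of the coordinates along and orthogonal to a unit vector. -/
theorem gap_le_of_coords {e z w : Cn n} (he : ‖e‖ = 1) (hw : ‖w‖ ≤ 1) :
    gap z w ≤ (1 - ‖w‖ ^ 2) + ‖(inner ℂ e w - inner ℂ e z : ℂ)‖
      + ‖w - (inner ℂ e w : ℂ) • e‖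
        * ‖(w - (inner ℂ e w : ℂ) • e) - (z - (inner ℂ e z : ℂ) • e)‖ := by
  set a : ℂ := inner ℂ e w
  set b : ℂ := inner ℂ e z
  have haa : (inner ℂ w e : ℂ) = starRingEnd ℂ a := (inner_conj_symm _ _).symm
  have hee : (inner ℂ e e : ℂ) = 1 := by rw [inner_self_eq_norm_sq_to_K, he]; simp
  have e1 : (1 - inner ℂ w z : ℂ) = ((1 - ‖w‖ ^ 2 : ℝ) : ℂ) + starRingEnd ℂ a * (a - b)
      + inner ℂ (w - a • e) ((w - a • e) - (z - b • e)) := by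
    have : (inner ℂ w w : ℂ) = (‖w‖ : ℂ) ^ 2 := inner_self_eq_norm_sq_to_K w
    simp only [inner_sub_left, inner_sub_right, inner_smul_left, inner_smul_right, haa, hee, this]
    push_cast
    ring
  have h3 : ‖a‖ ≤ 1 := (norm_inner_le_norm _ _).trans (by rw [he]; linarith)
  have h5 : 0 ≤ 1 - ‖w‖ ^ 2 := by nlinarith [norm_nonneg w]
  rw [gap, e1]
  refine norm_add₃_le.trans ?_
  rw [Complex.norm_real, Real.norm_of_nonneg h5, norm_mul, RCLike.norm_conj]
  gcongr
  · exact mul_le_of_le_one_left (norm_nonneg _) h3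
  · exact norm_inner_le_norm _ _

/-- The number of `τ`-separated points, close to the boundary on the scale `τ`, in a
nonisotropic ball of radius `Cτ` is bounded independently of `τ`. -/
theorem exists_packing_bound (hn : 1 ≤ n) {C : ℝ} (hC : 0 < C) :
    ∃ N : ℕ, ∀ τ : ℝ, 0 < τ → ∀ z₀ : Cn n, ‖z₀‖ < 1 → ∀ {ι : Type} (s : Finset ι) (x : ι → Cn n),
      (∀ i ∈ s, ‖x i‖ < 1 ∧ 1 - ‖x i‖ ^ 2 ≤ τ / 4 ∧ gap (x i) z₀ ≤ C * τ) →
      (∀ i ∈ s, ∀ j ∈ s, i ≠ j → τ ≤ gap (x i) (x j)) → s.card ≤ N := by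
  -- Q √τ bounds the component orthogonal to e in a nonisotropic ball of radius Cτ. The separation r
  -- is chosen so that two points closer than r after rescaling would have gap below τ/4 + τ/4 +
  -- τ/4.
  set Q : ℝ := Real.sqrt (4 * C) with hQ
  have hQ0 : 0 < Q := Real.sqrt_pos.2 (by linarith)
  set r : ℝ := min (1 / 4) (1 / (4 * Q)) with hr
  have hr0 : 0 < r := lt_min (by norm_num) (by positivity)
  obtain ⟨N, hN⟩ := exists_card_le_of_separated
    (isCompact_closedBall (0 : ℂ × Cn n) (max (2 * C) Q)) hr0
  refine ⟨N, fun τ hτ z₀ hz₀ ι s x hx hsep => ?_⟩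
  obtain ⟨e, he, hez⟩ := exists_unit_vector hn z₀
  have hsτ : 0 < Real.sqrt τ := Real.sqrt_pos.2 hτ
  have hsq : Real.sqrt τ * Real.sqrt τ = τ := Real.mul_self_sqrt hτ.le
  -- Nonisotropic rescaling: the direction e is divided by τ and the orthogonal directions by √τ.
  -- The image lies in a compact set that does not depend on τ.
  set f : ι → ℂ × Cn n := fun i => ((τ : ℂ)⁻¹ * (1 - inner ℂ e (x i)),
    ((Real.sqrt τ : ℝ) : ℂ)⁻¹ • (x i - (inner ℂ e (x i) : ℂ) • e)) with hf
  have b1 : ∀ i ∈ s, ‖(1 - inner ℂ e (x i) : ℂ)‖ ≤ 2 * C * τ := fun i hi => by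
    have := norm_one_sub_inner_unit_le he hez hz₀.le (hx i hi).1.le
    linarith [(hx i hi).2.2]
  have b2 : ∀ i ∈ s, ‖x i - (inner ℂ e (x i) : ℂ) • e‖ ≤ Q * Real.sqrt τ := fun i hi => by
    rw [hQ, ← Real.sqrt_mul (by linarith)]
    apply Real.le_sqrt_of_sq_le
    linarith [norm_sq_sub_proj_le he (hx i hi).1.le, b1 i hi]
  refine hN s f (fun i hi => ?_) fun i hi j hj hij => ?_
  · rw [mem_closedBall_zero_iff, hf, Prod.norm_def]
    refine max_le_max ?_ ?_
    · rw [norm_mul, norm_inv, Complex.norm_real, Real.norm_of_nonneg hτ.le, inv_mul_le_iff₀ hτ]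
      linarith [b1 i hi]
    · rw [norm_smul, norm_inv, Complex.norm_real, Real.norm_of_nonneg hsτ.le, inv_mul_le_iff₀ hsτ]
      linarith [b2 i hi]
  · by_contra! hlt
    rw [dist_eq_norm, Prod.norm_def, max_lt_iff] at hlt
    obtain ⟨h1, h2⟩ := hlt
    have h1' : ‖(inner ℂ e (x j) - inner ℂ e (x i) : ℂ)‖ < τ / 4 := by
      have e1 : (f i - f j).1 = (τ : ℂ)⁻¹ * (inner ℂ e (x j) - inner ℂ e (x i)) := by
        rw [hf]; simp only [Prod.fst_sub]; ring
      rw [e1, norm_mul, norm_inv, Complex.norm_real, Real.norm_of_nonneg hτ.le,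
        inv_mul_lt_iff₀ hτ] at h1
      have : r ≤ 1 / 4 := min_le_left _ _
      nlinarith
    have h2' : ‖(x j - (inner ℂ e (x j) : ℂ) • e) - (x i - (inner ℂ e (x i) : ℂ) • e)‖
        ≤ Real.sqrt τ * (1 / (4 * Q)) := by
      have e1 : (f i - f j).2 = ((Real.sqrt τ : ℝ) : ℂ)⁻¹ •
          ((x i - (inner ℂ e (x i) : ℂ) • e) - (x j - (inner ℂ e (x j) : ℂ) • e)) := by
        rw [hf]; simp only [Prod.snd_sub, smul_sub]
      rw [e1, norm_smul, norm_inv, Complex.norm_real, Real.norm_of_nonneg hsτ.le,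
        inv_mul_lt_iff₀ hsτ, norm_sub_rev] at h2
      exact h2.le.trans (mul_le_mul_of_nonneg_left (min_le_right _ _) hsτ.le)
    have h3 := gap_le_of_coords (z := x i) he (hx j hj).1.le
    have h4 : ‖x j - (inner ℂ e (x j) : ℂ) • e‖
        * ‖(x j - (inner ℂ e (x j) : ℂ) • e) - (x i - (inner ℂ e (x i) : ℂ) • e)‖ ≤ τ / 4 := by
      calc _ ≤ (Q * Real.sqrt τ) * (Real.sqrt τ * (1 / (4 * Q))) :=
            mul_le_mul (b2 j hj) h2' (norm_nonneg _) (by positivity)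
        _ = (Real.sqrt τ * Real.sqrt τ) / 4 := by field_simp
        _ = τ / 4 := by rw [hsq]
    linarith [hsep i hi j hj hij, (hx j hj).2.1]

end

end BergmanBall

/-! ### Coverings of large scale with bounded multiplicity. -/

namespace BergmanBall

noncomputable section

variable {n : ℕ}

theorem continuous_gap : Continuous fun x : Cn n × Cn n => gap x.1 x.2 := by
  unfold gap; fun_prop

/-- A finite maximal `τ`-separated set in a set of points close to the boundary on the
scale `τ`. -/
theorem exists_separated_net (hn : 1 ≤ n) {τ : ℝ} (hτ : 0 < τ) {L : Set (Cn n)}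
    (hL : ∀ z ∈ L, ‖z‖ < 1 ∧ 1 - ‖z‖ ^ 2 ≤ τ / 4) :
    ∃ (m : ℕ) (x : ℕ → Cn n), (∀ i < m, x i ∈ L) ∧
      (∀ i < m, ∀ j < m, i ≠ j → τ ≤ gap (x i) (x j)) ∧ ∀ z ∈ L, ∃ i < m, gap z (x i) < τ := by
  classical
  -- With C = 2/τ and centre 0 the nonisotropic ball is the whole ball. The resulting bound depends
  -- on τ, but here only finiteness of separated sets is needed.
  obtain ⟨N, hN⟩ := exists_packing_bound hn (C := 2 / τ) (by positivity)
  let P : Finset (Cn n) → Prop := fun s =>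
    (∀ z ∈ s, z ∈ L) ∧ ∀ z ∈ s, ∀ w ∈ s, z ≠ w → τ ≤ gap z w
  have hP : ∀ s, P s → s.card ≤ N := fun s hs =>
    hN τ hτ 0 (by simp) s id (fun i hi => ⟨(hL i (hs.1 i hi)).1, (hL i (hs.1 i hi)).2, by
      rw [div_mul_cancel₀ _ hτ.ne']
      exact gap_le_two (hL i (hs.1 i hi)).1.le (by simp)⟩) hs.2
  have hmax := Nat.sSup_mem (s := {c | ∃ s, P s ∧ s.card = c})
    ⟨0, ∅, ⟨by simp, by simp⟩, rfl⟩ ⟨N, by rintro c ⟨s, hs, rfl⟩; exact hP s hs⟩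
  obtain ⟨s, hs, hcard⟩ := hmax
  have hle : ∀ t, P t → t.card ≤ s.card := fun t ht => by
    rw [hcard]
    exact le_csSup ⟨N, by rintro c ⟨s, hs, rfl⟩; exact hP s hs⟩ ⟨t, ht, rfl⟩
  have hnet : ∀ z ∈ L, ∃ w ∈ s, gap z w < τ := by
    intro z hz
    by_contra! hcon
    have hzs : z ∉ s := fun h => by
      have := hcon z h
      rw [gap_self (hL z hz).1] at this
      linarith [(hL z hz).2]
    have := hle (insert z s) ⟨fun w hw => ?_, fun u hu w hw huw => ?_⟩
    · rw [Finset.card_insert_of_notMem hzs] at this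
      omega
    · rcases Finset.mem_insert.1 hw with rfl | hw
      · exact hz
      · exact hs.1 w hw
    · rcases Finset.mem_insert.1 hu with hu' | hu' <;>
        rcases Finset.mem_insert.1 hw with hw' | hw'
      · exact absurd (hu'.trans hw'.symm) huw
      · rw [hu']; exact hcon w hw'
      · rw [hw', gap_comm]; exact hcon u hu'
      · exact hs.2 u hu' w hw' huw
  -- The net is indexed by ℕ; the value 0 beyond its cardinality is never used.
  refine ⟨s.card, fun i => if h : i < s.card then s.equivFin.symm ⟨i, h⟩ else 0, ?_, ?_, ?_⟩
  · intro i hi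
    simp only [dif_pos hi]
    exact hs.1 _ (Subtype.property _)
  · intro i hi j hj hij
    simp only [dif_pos hi, dif_pos hj]
    refine hs.2 _ (Subtype.property _) _ (Subtype.property _) fun h => hij ?_
    simpa using s.equivFin.symm.injective (Subtype.ext h)
  · intro z hz
    obtain ⟨w, hw, hzw⟩ := hnet z hz
    refine ⟨s.equivFin ⟨w, hw⟩, (s.equivFin ⟨w, hw⟩).2, ?_⟩
    simpa using hzw

/-- The spherical shell `q^(k+1) < 1-|z|² ≤ q^k`. -/
def shell (n : ℕ) (q : ℝ) (k : ℕ) : Set (Cn n) :=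
  {z | q ^ (k + 1) < 1 - ‖z‖ ^ 2 ∧ 1 - ‖z‖ ^ 2 ≤ q ^ k}

theorem measurableSet_shell (q : ℝ) (k : ℕ) : MeasurableSet (shell n q k) :=
  (measurableSet_lt (f := fun _ : Cn n => q ^ (k + 1)) (g := fun z => 1 - ‖z‖ ^ 2)
    (by fun_prop) (by fun_prop)).inter
    (measurableSet_le (f := fun z : Cn n => 1 - ‖z‖ ^ 2) (g := fun _ => q ^ k)
      (by fun_prop) (by fun_prop))

theorem norm_lt_one_of_mem_shell {q : ℝ} (hq : 0 < q) {k : ℕ} {z : Cn n} (hz : z ∈ shell n q k) :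
    ‖z‖ < 1 := by
  have : 0 < 1 - ‖z‖ ^ 2 := (pow_pos hq _).trans hz.1
  nlinarith [norm_nonneg z]

theorem exists_mem_shell {q : ℝ} (hq : 0 < q) (hq1 : q < 1) {z : Cn n} (hz : ‖z‖ < 1) :
    ∃ k, z ∈ shell n q k :=
  exists_nat_pow_near_of_lt_one (one_sub_sq_pos hz) (by nlinarith [norm_nonneg z]) hq hq1

theorem shell_index_unique {q : ℝ} (hq : 0 < q) (hq1 : q < 1) {k l : ℕ} {z : Cn n}
    (hk : z ∈ shell n q k) (hl : z ∈ shell n q l) : k = l := by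
  have h1 := (pow_lt_pow_iff_right_of_lt_one₀ hq hq1).1 (hk.1.trans_le hl.2)
  have h2 := (pow_lt_pow_iff_right_of_lt_one₀ hq hq1).1 (hl.1.trans_le hk.2)
  omega

/-- (1-|z|²)² ≤ 4 |1 - z w̄|² < 4M (1-|z|²)(1-|w|²), then divide. Points at bounded hyperbolic
distance have comparable distance to the boundary. -/
theorem one_sub_sq_le_of_coshSq_lt {M : ℝ} {z w : Cn n} (hz : ‖z‖ < 1) (hw : ‖w‖ < 1)
    (h : coshSq z w < M) : 1 - ‖z‖ ^ 2 ≤ 4 * M * (1 - ‖w‖ ^ 2) := by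
  have pz := one_sub_sq_pos hz
  have pw := one_sub_sq_pos hw
  rw [coshSq, div_lt_iff₀ (mul_pos pz pw)] at h
  have h1 := one_sub_sq_le_gap hz.le hw.le
  have h2 : (1 - ‖z‖ ^ 2) * (1 - ‖z‖ ^ 2) ≤ (1 - ‖z‖ ^ 2) * (4 * M * (1 - ‖w‖ ^ 2)) := by
    have := pow_le_pow_left₀ pz.le h1 2
    nlinarith
  exact le_of_mul_le_mul_left h2 pz

/-- The ball has coverings of bounded hyperbolic diameter, on an arbitrarily large scale, whose
multiplicity is bounded in terms of the dimension only. -/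
theorem exists_cover (hn : 1 ≤ n) :
    ∃ N : ℕ, ∀ M : ℝ, 1 < M → ∃ (D : ℝ) (F G : ℕ → Set (Cn n)),
      (∀ j, MeasurableSet (F j)) ∧ (∀ j, MeasurableSet (G j)) ∧ (∀ j, F j ⊆ G j) ∧
      (∀ j, G j ⊆ unitBall n) ∧ (⋃ j, F j) = unitBall n ∧ (∀ j k, j ≠ k → F j ∩ F k = ∅) ∧
      (∀ z ∈ unitBall n, {j | z ∈ G j}.encard ≤ N) ∧
      (∀ j, ∀ z ∈ G j, ∀ w ∈ G j, coshSq z w ≤ D) ∧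
      (∀ j, ∀ z ∈ F j, ∀ w ∈ unitBall n, w ∉ G j → M ≤ coshSq z w) := by
  classical
  obtain ⟨N₀, hN₀⟩ := exists_packing_bound hn (C := 8) (by norm_num)
  refine ⟨3 * N₀, fun M hM => ?_⟩
  -- A is the factor by which 1-|z|² can change when coshSq < M. With shell ratio q = 1/A, such a
  -- change moves the shell index by at most one.
  set A : ℝ := 4 * M with hA
  have hA4 : 4 < A := by linarith
  set q : ℝ := A⁻¹ with hq
  have hq0 : 0 < q := inv_pos.2 (by linarith)
  have hq1 : q < 1 := inv_lt_one_of_one_lt₀ (by linarith)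
  have hAq : A * q = 1 := mul_inv_cancel₀ (by linarith)
  -- The factor A² makes τ_k at least 4 q^k, as the packing bound requires. It also makes τ_k at
  -- least A q^k, which bounds the gap between a point of shell k and any point within coshSq < M of
  -- it.
  set τ : ℕ → ℝ := fun k => A ^ 2 * q ^ k with hτ
  have hqk : ∀ k, 0 < q ^ k := fun k => pow_pos hq0 k
  have hτ0 : ∀ k, 0 < τ k := fun k => mul_pos (by positivity) (hqk k)
  have hqτ : ∀ k, q ^ k ≤ τ k / 4 := fun k => by
    have : 4 * q ^ k ≤ A ^ 2 * q ^ k := by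
      have := hqk k
      have : 4 ≤ A ^ 2 := by nlinarith
      gcongr
    change q ^ k ≤ A ^ 2 * q ^ k / 4
    linarith
  have hball : ∀ {k} {z : Cn n}, z ∈ shell n q k → ‖z‖ < 1 := fun h =>
    norm_lt_one_of_mem_shell hq0 h
  choose m x hxL hxsep hxnet using fun k => exists_separated_net hn (hτ0 k) (L := shell n q k)
    (fun z hz => ⟨hball hz, hz.2.trans (hqτ k)⟩)
  let U : ℕ → ℕ → Set (Cn n) := fun k i => {z | z ∈ shell n q k ∧ i < m k ∧ gap z (x k i) < τ k}
  have hU : ∀ k i, MeasurableSet (U k i) := fun k i => by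
    refine (measurableSet_shell q k).inter ((MeasurableSet.const _).inter ?_)
    exact measurableSet_lt
      (continuous_gap.comp (continuous_id.prodMk continuous_const)).measurable measurable_const
  let F' : ℕ → ℕ → Set (Cn n) := fun k => disjointed (U k)
  have hF'U : ∀ k i, F' k i ⊆ U k i := fun k i => disjointed_subset (U k) i
  have hF'm : ∀ k i, MeasurableSet (F' k i) := fun k i => MeasurableSet.disjointed (hU k) i
  -- G' is the coshSq < M neighbourhood of F', so separation from the complement holds by
  -- construction and only multiplicity and diameter need proof.
  let G' : ℕ → ℕ → Set (Cn n) := fun k i => {z | ‖z‖ < 1 ∧ ∃ w ∈ F' k i, coshSq z w < M}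
  have hG'm : ∀ k i, MeasurableSet (G' k i) := fun k i => by
    have e : G' k i = ⋃ w ∈ F' k i, {z : Cn n | ‖z‖ < 1} ∩
        {z | gap z w ^ 2 < M * ((1 - ‖z‖ ^ 2) * (1 - ‖w‖ ^ 2))} := by
      ext z
      simp only [G', Set.mem_ofPred_eq, Set.mem_iUnion, Set.mem_inter_iff, exists_prop]
      constructor
      · rintro ⟨hz, w, hw, h⟩
        have hw1 := hball (hF'U k i hw).1
        rw [coshSq, div_lt_iff₀ (mul_pos (one_sub_sq_pos hz) (one_sub_sq_pos hw1))] at h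
        exact ⟨w, hw, hz, h⟩
      · rintro ⟨w, hw, hz, h⟩
        have hw1 := hball (hF'U k i hw).1
        refine ⟨hz, w, hw, ?_⟩
        rwa [coshSq, div_lt_iff₀ (mul_pos (one_sub_sq_pos hz) (one_sub_sq_pos hw1))]
    rw [e]
    -- The union is uncountable; it is measurable because each member is open.
    refine (isOpen_biUnion fun w _ => ?_).measurableSet
    refine (isOpen_lt continuous_norm continuous_const).inter (isOpen_lt ?_ (by fun_prop))
    exact (continuous_gap.comp (continuous_id.prodMk continuous_const)).pow 2
  have hFG : ∀ k i, F' k i ⊆ G' k i := fun k i z hz => by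
    have hz1 := hball (hF'U k i hz).1
    exact ⟨hz1, z, hz, by rw [coshSq_self hz1]; exact hM⟩
  have hcount : ∀ (z : Cn n) (k : ℕ), {i | z ∈ G' k i}.encard ≤ N₀ := by
    intro z k
    by_contra! hlt
    obtain ⟨t, hts, htc⟩ := Set.exists_subset_encard_eq (Order.add_one_le_of_lt hlt)
    have htf : t.Finite := Set.finite_of_encard_eq_coe (by rw [htc]; rfl)
    have hz : t.Nonempty := Set.nonempty_of_encard_ne_zero (by rw [htc]; simp)
    obtain ⟨i₀, hi₀⟩ := hz
    have hz1 : ‖z‖ < 1 := (hts hi₀).1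
    -- If z lies in G' k i through w, then z to w costs at most τ_k and w to the net point less than
    -- τ_k. The quasi-triangle constant 4 gives radius 8τ_k, a ratio independent of M.
    have hkey : ∀ i ∈ htf.toFinset, i < m k ∧ gap (x k i) z ≤ 8 * τ k := by
      intro i hi
      obtain ⟨-, w, hw, hzw⟩ := hts (htf.mem_toFinset.1 hi)
      have hwU := hF'U k i hw
      have hw1 := hball hwU.1
      have hx1 := hball (hxL k i hwU.2.1)
      refine ⟨hwU.2.1, ?_⟩
      have h1 := one_sub_sq_le_of_coshSq_lt hz1 hw1 hzw
      have pz := one_sub_sq_pos hz1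
      have pw := one_sub_sq_pos hw1
      rw [coshSq, div_lt_iff₀ (mul_pos pz pw)] at hzw
      have h2 : gap z w ^ 2 ≤ (A * (1 - ‖w‖ ^ 2)) ^ 2 := by
        have : M * ((1 - ‖z‖ ^ 2) * (1 - ‖w‖ ^ 2)) ≤ A * (A * (1 - ‖w‖ ^ 2) * (1 - ‖w‖ ^ 2)) := by
          have : (1 - ‖z‖ ^ 2) * (1 - ‖w‖ ^ 2) ≤ A * (1 - ‖w‖ ^ 2) * (1 - ‖w‖ ^ 2) := by gcongr
          have h0 : 0 < (1 - ‖z‖ ^ 2) * (1 - ‖w‖ ^ 2) := mul_pos pz pw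
          nlinarith
        nlinarith
      have h3 : gap z w ≤ A * (1 - ‖w‖ ^ 2) := le_of_sq_le_sq h2 (by positivity)
      have h4 : gap z w ≤ τ k := by
        have : A * (1 - ‖w‖ ^ 2) ≤ A * q ^ k :=
          mul_le_mul_of_nonneg_left hwU.1.2 (by linarith)
        have h5 : A * q ^ k ≤ A ^ 2 * q ^ k := by
          have := hqk k
          have : A ≤ A ^ 2 := by nlinarith
          gcongr
        exact h3.trans (this.trans h5)
      have h5 := gap_triangle hz1.le hw1.le hx1.le
      rw [gap_comm]
      linarith [hwU.2.2]
    have := hN₀ (τ k) (hτ0 k) z hz1 htf.toFinset (x k) (fun i hi =>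
      ⟨hball (hxL k i (hkey i hi).1), (hxL k i (hkey i hi).1).2.trans (hqτ k), (hkey i hi).2⟩)
      (fun i hi j hj hij => hxsep k i (hkey i hi).1 j (hkey j hj).1 hij)
    have h6 : (htf.toFinset.card : ℕ∞) = N₀ + 1 := by
      rw [← htc, htf.encard_eq_coe_toFinset_card]
    have h7 : htf.toFinset.card = N₀ + 1 := by exact_mod_cast h6
    omega
  -- Two points of G' are joined through their companions in F', which uses `coshSq_mul` twice. The
  -- factor 64 A⁶ is (8τ_k)² divided by q^(2(k+1)), the bound for coshSq inside one cell.
  refine ⟨256 ^ 2 * (M * M * (64 * A ^ 6)), fun j => F' j.unpair.1 j.unpair.2,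
    fun j => G' j.unpair.1 j.unpair.2, fun j => hF'm _ _, fun j => hG'm _ _, fun j => hFG _ _,
    fun j z hz => mem_unitBall.2 hz.1, ?_, ?_, ?_, ?_, ?_⟩
  · ext z
    rw [Set.mem_iUnion, mem_unitBall]
    constructor
    · rintro ⟨j, hj⟩
      exact hball (hF'U _ _ hj).1
    · intro hz
      obtain ⟨k, hk⟩ := exists_mem_shell hq0 hq1 hz
      obtain ⟨i, hi, hzi⟩ := hxnet k z hk
      have : z ∈ ⋃ i, F' k i := by
        rw [iUnion_disjointed]
        exact Set.mem_iUnion.2 ⟨i, hk, hi, hzi⟩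
      obtain ⟨i', hi'⟩ := Set.mem_iUnion.1 this
      exact ⟨Nat.pair k i', by simpa using hi'⟩
  · intro j l hjl
    rw [← Set.disjoint_iff_inter_eq_empty]
    by_cases hk : j.unpair.1 = l.unpair.1
    · have hi : j.unpair.2 ≠ l.unpair.2 := fun hi => hjl (by
        rw [← Nat.pair_unpair j, ← Nat.pair_unpair l, hk, hi])
      simp only [hk]
      exact disjoint_disjointed _ hi
    · rw [Set.disjoint_left]
      intro z hz hz'
      exact hk (shell_index_unique hq0 hq1 (hF'U _ _ hz).1 (hF'U _ _ hz').1)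
  · intro z hz
    obtain ⟨l, hl⟩ := exists_mem_shell hq0 hq1 (mem_unitBall.1 hz)
    -- A point of shell l can lie only in sets coming from shells l-1, l, l+1. For l = 0 the
    -- truncated subtraction just shortens the interval.
    have hsub : {j : ℕ | z ∈ G' j.unpair.1 j.unpair.2} ⊆
        ⋃ k ∈ Finset.Icc (l - 1) (l + 1), Nat.pair k '' {i | z ∈ G' k i} := by
      intro j hj
      have hj' := hj
      obtain ⟨hz1, w, hw, hzw⟩ := hj'
      have hwU := hF'U _ _ hw
      have hw1 := hball hwU.1
      have h1 := one_sub_sq_le_of_coshSq_lt hz1 hw1 hzw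
      rw [coshSq_comm] at hzw
      have h2 := one_sub_sq_le_of_coshSq_lt hw1 hz1 hzw
      have h3 : ∀ {a b : ℕ} {s t : ℝ}, q ^ (a + 1) < s → t ≤ q ^ b → s ≤ 4 * M * t →
          b ≤ a + 1 := by
        intro a b s t hs ht hst
        have h4 : q * q ^ (a + 1) < q ^ b := by
          calc q * q ^ (a + 1) < q * s := by gcongr
            _ ≤ q * (A * t) := by gcongr
            _ = t := by rw [← mul_assoc, mul_comm q, hAq, one_mul]
            _ ≤ q ^ b := ht
        rw [← pow_succ'] at h4
        have := (pow_lt_pow_iff_right_of_lt_one₀ hq0 hq1).1 h4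
        omega
      have h5 := h3 hl.1 hwU.1.2 h1
      have h6 := h3 hwU.1.1 hl.2 h2
      refine Set.mem_iUnion₂.2 ⟨j.unpair.1, Finset.mem_Icc.2 ⟨by omega, h5⟩, j.unpair.2, hj, ?_⟩
      exact Nat.pair_unpair j
    refine (Set.encard_le_encard hsub).trans ?_
    have hbi : ∀ t : Finset ℕ, (⋃ k ∈ t, Nat.pair k '' {i | z ∈ G' k i}).encard
        ≤ (t.card * N₀ : ℕ) := by
      intro t
      induction t using Finset.induction_on with
      | empty => simp
      | insert a t ha ih =>
        rw [Finset.set_biUnion_insert, Finset.card_insert_of_notMem ha]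
        refine (Set.encard_union_le _ _).trans ?_
        have := (Set.encard_image_le (Nat.pair a) {i | z ∈ G' a i}).trans (hcount z a)
        refine (add_le_add this ih).trans (le_of_eq ?_)
        push_cast; ring
    refine (hbi _).trans ?_
    have : (Finset.Icc (l - 1) (l + 1)).card ≤ 3 := by rw [Nat.card_Icc]; omega
    exact_mod_cast Nat.mul_le_mul_right _ this
  · rintro j z ⟨hz, z', hz', hzz'⟩ w ⟨hw, w', hw', hww'⟩
    have hzU := hF'U _ _ hz'
    have hwU := hF'U _ _ hw'
    set k := j.unpair.1
    set i := j.unpair.2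
    have hz'1 := hball hzU.1
    have hw'1 := hball hwU.1
    have hx1 := hball (hxL k i hzU.2.1)
    have h1 : gap z' w' ≤ 8 * τ k := by
      have := gap_triangle hz'1.le hx1.le hw'1.le
      rw [gap_comm (x k i) w'] at this
      linarith [hzU.2.2, hwU.2.2]
    have h2 : coshSq z' w' ≤ 64 * A ^ 6 := by
      rw [coshSq, div_le_iff₀ (mul_pos (one_sub_sq_pos hz'1) (one_sub_sq_pos hw'1))]
      have e : A * q ^ (k + 1) = q ^ k := by rw [pow_succ', ← mul_assoc, hAq, one_mul]
      calc gap z' w' ^ 2 ≤ (8 * τ k) ^ 2 := pow_le_pow_left₀ (gap_nonneg _ _) h1 2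
        _ = 64 * A ^ 6 * (q ^ (k + 1) * q ^ (k + 1)) := by rw [hτ]; simp only [← e]; ring
        _ ≤ _ := by
          have := hqk (k + 1)
          have h3 := hzU.1.1
          have h4 := hwU.1.1
          have h5 := one_sub_sq_pos hz'1
          gcongr
    rw [coshSq_comm] at hww'
    calc coshSq z w ≤ 256 * (coshSq z z' * coshSq z' w) := coshSq_mul hz hz'1 hw
      _ ≤ 256 * (coshSq z z' * (256 * (coshSq z' w' * coshSq w' w))) := by
          have := coshSq_pos hz hz'1
          gcongr
          exact coshSq_mul hz'1 hw'1 hw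
      _ ≤ 256 * (M * (256 * (64 * A ^ 6 * M))) := by
          have := coshSq_pos hz hz'1
          have := coshSq_pos hz'1 hw'1
          have := coshSq_pos hw'1 hw
          gcongr
      _ = _ := by ring
  · intro j z hz w hw hwG
    by_contra! hlt
    rw [coshSq_comm] at hlt
    exact hwG ⟨mem_unitBall.1 hw, z, hz, hlt⟩

end

end BergmanBall

/-! ### Volumes of nonisotropic balls. -/

namespace BergmanBall

noncomputable section

variable {n : ℕ}

/-- The linear map that multiplies by `t` in the direction of the unit vector `e` and by `√t`
in the orthogonal directions. -/
def anisoScale (e : Cn n) (t : ℝ) : Cn n →ₗ[ℂ] Cn n :=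
  ((Real.sqrt t : ℝ) : ℂ) • LinearMap.transvection
    ((((Real.sqrt t - 1 : ℝ) : ℂ)) • (innerSL ℂ e : Cn n →L[ℂ] ℂ).toLinearMap) e

theorem anisoScale_apply (e : Cn n) {t : ℝ} (ht : 0 ≤ t) (x : Cn n) :
    anisoScale e t x = ((Real.sqrt t : ℝ) : ℂ) • (x - (inner ℂ e x : ℂ) • e)
      + ((t : ℂ) * inner ℂ e x) • e := by
  have hsq : ((Real.sqrt t : ℝ) : ℂ) * ((Real.sqrt t : ℝ) : ℂ) = t := by
    rw [← Complex.ofReal_mul, Real.mul_self_sqrt ht]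
  rw [anisoScale, LinearMap.smul_apply, LinearMap.transvection.apply]
  simp only [LinearMap.smul_apply, ContinuousLinearMap.coe_coe, innerSL_apply_apply, smul_eq_mul]
  rw [← hsq]
  push_cast
  module

/-- The complex determinant is √t^n from the scalar times √t from the transvection. The real
Jacobian is its squared modulus, t^(n+1). -/
theorem volume_anisoScale_image {e : Cn n} (he : ‖e‖ = 1) {t : ℝ} (ht : 0 < t) (s : Set (Cn n)) :
    volume (anisoScale e t '' s) = ENNReal.ofReal (t ^ (n + 1)) * volume s := by
  have hdet : LinearMap.det (anisoScale e t) = ((Real.sqrt t ^ (n + 1) : ℝ) : ℂ) := by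
    rw [anisoScale, LinearMap.det_smul, LinearMap.transvection.det]
    simp only [LinearMap.smul_apply, ContinuousLinearMap.coe_coe, innerSL_apply_apply, smul_eq_mul]
    rw [inner_self_eq_norm_sq_to_K, he, finrank_euclideanSpace, Fintype.card_fin]
    push_cast
    simp [pow_succ]
  have h := Measure.addHaar_image_linearMap (volume : Measure (Cn n))
    ((anisoScale e t).restrictScalars ℝ) s
  rw [LinearMap.det_restrictScalars, hdet, Algebra.norm_complex_apply, Complex.normSq_ofReal,
    ← pow_add, ← two_mul, mul_comm 2, pow_mul', Real.sq_sqrt ht.le, abs_of_pos (by positivity)] at h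
  exact h

/-- A nonisotropic ball has extent O(t) along e = w/|w| (any unit vector if w = 0) and O(√t) across,
so it lies in a translate by e of the scaled ball of radius 4. -/
theorem volume_gap_lt_le (hn : 1 ≤ n) : ∃ C : ℝ≥0, ∀ w : Cn n, ‖w‖ ≤ 1 → ∀ t : ℝ, 0 < t →
    volume {u : Cn n | ‖u‖ ≤ 1 ∧ gap u w < t} ≤ C * ENNReal.ofReal (t ^ (n + 1)) := by
  have hfin : volume (Metric.closedBall (0 : Cn n) 4) < ∞ := measure_closedBall_lt_top
  refine ⟨(volume (Metric.closedBall (0 : Cn n) 4)).toNNReal, fun w hw t ht => ?_⟩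
  obtain ⟨e, he, hwe⟩ := exists_unit_vector hn w
  have hst : 0 < Real.sqrt t := Real.sqrt_pos.2 ht
  have hss : ((Real.sqrt t : ℝ) : ℂ) ≠ 0 := by exact_mod_cast hst.ne'
  have htc : (t : ℂ) ≠ 0 := by exact_mod_cast ht.ne'
  have hee : (inner ℂ e e : ℂ) = 1 := by rw [inner_self_eq_norm_sq_to_K, he]; simp
  have hsub : {u : Cn n | ‖u‖ ≤ 1 ∧ gap u w < t} ⊆
      (fun x => e + x) '' (anisoScale e t '' Metric.closedBall 0 4) := by
    rintro u ⟨hu, hut⟩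
    set a : ℂ := inner ℂ e u with ha
    have h1 : ‖(1 - a : ℂ)‖ ≤ 2 * t := (norm_one_sub_inner_unit_le he hwe hw hu).trans (by linarith)
    have h2 : ‖u - a • e‖ ≤ 2 * Real.sqrt t := by
      have h3 := norm_sq_sub_proj_le he hu
      rw [← ha] at h3
      refine le_of_sq_le_sq ?_ (by positivity)
      rw [mul_pow, Real.sq_sqrt ht.le]
      linarith
    refine ⟨u - e, ⟨((t : ℂ)⁻¹ * (a - 1)) • e + ((Real.sqrt t : ℝ) : ℂ)⁻¹ • (u - a • e), ?_, ?_⟩, ?_⟩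
    · rw [mem_closedBall_zero_iff]
      refine (norm_add_le _ _).trans ?_
      rw [norm_smul, norm_smul, he, norm_mul, norm_inv, norm_inv, Complex.norm_real,
        Complex.norm_real, Real.norm_of_nonneg ht.le, Real.norm_of_nonneg hst.le, norm_sub_rev]
      have h4 : t⁻¹ * ‖(1 - a : ℂ)‖ ≤ 2 := by rw [inv_mul_le_iff₀ ht]; linarith
      have h5 : (Real.sqrt t)⁻¹ * ‖u - a • e‖ ≤ 2 := by rw [inv_mul_le_iff₀ hst]; linarith
      linarith
    · have hin : (inner ℂ e (((t : ℂ)⁻¹ * (a - 1)) • e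
          + ((Real.sqrt t : ℝ) : ℂ)⁻¹ • (u - a • e)) : ℂ) = (t : ℂ)⁻¹ * (a - 1) := by
        rw [inner_add_right, inner_smul_right, inner_smul_right, inner_sub_right,
          inner_smul_right, hee, ← ha]
        ring
      rw [anisoScale_apply e ht.le, hin, add_sub_cancel_left, smul_smul, mul_inv_cancel₀ hss,
        ← mul_assoc, mul_inv_cancel₀ htc]
      module
    · simp
  refine (measure_mono hsub).trans ?_
  rw [Set.image_add_left, measure_preimage_add, volume_anisoScale_image he ht,
    ENNReal.coe_toNNReal hfin.ne, mul_comm]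

/-- With δ = 1-|w|, the scaled half-ball centred at w stays inside the unit ball: the radial part is
at most 1 - δ/2 and the square of the orthogonal part is below δ/4. The gap there is at most 2δ +
δ/2. -/
theorem le_volume_gap_lt (hn : 1 ≤ n) : ∃ c : ℝ≥0, 0 < c ∧ ∀ w : Cn n, ‖w‖ < 1 →
    c * ENNReal.ofReal ((1 - ‖w‖) ^ (n + 1)) ≤
      volume {u : Cn n | ‖u‖ < 1 ∧ gap u w < 3 * (1 - ‖w‖)} := by
  have hfin : volume (Metric.ball (0 : Cn n) (1 / 2)) < ∞ := measure_ball_lt_top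
  have hpos : 0 < volume (Metric.ball (0 : Cn n) (1 / 2)) := Metric.measure_ball_pos _ _ (by norm_num)
  refine ⟨(volume (Metric.ball (0 : Cn n) (1 / 2))).toNNReal, ENNReal.toNNReal_pos hpos.ne' hfin.ne,
    fun w hw => ?_⟩
  obtain ⟨e, he, hwe⟩ := exists_unit_vector hn w
  set δ : ℝ := 1 - ‖w‖ with hδ
  have hδ0 : 0 < δ := by linarith
  have hδ1 : δ ≤ 1 := by linarith [norm_nonneg w]
  have hee : (inner ℂ e e : ℂ) = 1 := by rw [inner_self_eq_norm_sq_to_K, he]; simp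
  rw [ENNReal.coe_toNNReal hfin.ne, mul_comm, ← volume_anisoScale_image he hδ0,
    ← measure_preimage_add volume (-w), ← Set.image_add_left]
  refine measure_mono ?_
  rintro _ ⟨_, ⟨x, hx, rfl⟩, rfl⟩
  rw [mem_ball_zero_iff] at hx
  set b : ℂ := inner ℂ e x with hb
  set v : Cn n := x - b • e with hv
  have hev : (inner ℂ e v : ℂ) = 0 := by
    rw [hv, inner_sub_right, inner_smul_right, hee, ← hb]; ring
  have hbv : ‖v‖ ^ 2 = ‖x‖ ^ 2 - ‖b‖ ^ 2 := norm_sq_sub_proj he x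
  have hb1 : ‖b‖ < 1 / 2 := by
    have : ‖b‖ ≤ ‖e‖ * ‖x‖ := norm_inner_le_norm _ _
    rw [he] at this
    linarith
  have hv1 : ‖v‖ ^ 2 < 1 / 4 := by nlinarith [norm_nonneg x, sq_nonneg ‖b‖]
  have hu : w + anisoScale e δ x = ((‖w‖ : ℂ) + δ * b) • e + ((Real.sqrt δ : ℝ) : ℂ) • v := by
    rw [anisoScale_apply e hδ0.le, ← hb, ← hv]
    conv_lhs => rw [hwe]
    module
  have hnb : ‖((‖w‖ : ℂ) + δ * b)‖ ≤ ‖w‖ + δ * (1 / 2) := by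
    refine (norm_add_le _ _).trans ?_
    rw [norm_mul, Complex.norm_real, Complex.norm_real, norm_norm, Real.norm_of_nonneg hδ0.le]
    gcongr
  refine ⟨?_, ?_⟩
  · change ‖w + anisoScale e δ x‖ < 1
    have ho : (inner ℂ (((‖w‖ : ℂ) + δ * b) • e) (((Real.sqrt δ : ℝ) : ℂ) • v) : ℂ) = 0 := by
      rw [inner_smul_left, inner_smul_right, hev]; simp
    have := norm_add_sq_eq_norm_sq_add_norm_sq_of_inner_eq_zero _ _ ho
    rw [← hu, norm_smul, norm_smul, he, Complex.norm_real, Real.norm_of_nonneg (Real.sqrt_nonneg δ)]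
      at this
    have h2 : Real.sqrt δ * ‖v‖ * (Real.sqrt δ * ‖v‖) = δ * ‖v‖ ^ 2 := by
      have := Real.mul_self_sqrt hδ0.le
      calc _ = (Real.sqrt δ * Real.sqrt δ) * ‖v‖ ^ 2 := by ring
        _ = _ := by rw [this]
    rw [h2] at this
    have h3 : ‖((‖w‖ : ℂ) + δ * b)‖ ^ 2 ≤ (1 - δ / 2) ^ 2 :=
      pow_le_pow_left₀ (norm_nonneg _) (by linarith) 2
    nlinarith [norm_nonneg (w + anisoScale e δ x)]
  · change gap (w + anisoScale e δ x) w < 3 * δ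
    have hin : (inner ℂ w (w + anisoScale e δ x) : ℂ) = ‖w‖ * (‖w‖ + δ * b) := by
      have hwy : ∀ y : Cn n, (inner ℂ w y : ℂ) = ‖w‖ * inner ℂ e y := fun y => by
        have := inner_smul_left (𝕜 := ℂ) e y (‖w‖ : ℂ)
        rw [← hwe] at this
        simpa using this
      rw [hu, hwy, inner_add_right, inner_smul_right, inner_smul_right, hee, hev]
      simp
    have e1 : (1 - ‖w‖ * (‖w‖ + δ * b) : ℂ)
        = ((1 - ‖w‖ ^ 2 : ℝ) : ℂ) - (‖w‖ : ℂ) * (δ : ℂ) * b := by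
      push_cast; ring
    rw [gap, hin, e1]
    refine (norm_sub_le _ _).trans_lt ?_
    rw [norm_mul, norm_mul, Complex.norm_real, Complex.norm_real, Complex.norm_real, norm_norm,
      Real.norm_of_nonneg hδ0.le, Real.norm_of_nonneg (one_sub_sq_pos hw).le]
    have h5 : ‖w‖ * δ * ‖b‖ ≤ 1 * δ * (1 / 2) := by gcongr
    nlinarith [norm_nonneg w]

end

end BergmanBall

/-! ### Forelli–Rudin estimates. -/

namespace BergmanBall

noncomputable section

variable {n : ℕ}

theorem lintegral_Ioo_rpow {a : ℝ} (ha : -1 < a) {T : ℝ} (hT : 0 ≤ T) :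
    ∫⁻ x in Set.Ioo 0 T, ENNReal.ofReal (x ^ a) = ENNReal.ofReal (T ^ (a + 1) / (a + 1)) := by
  rw [restrict_Ioo_eq_restrict_Ioc, ← ofReal_integral_eq_lintegral_ofReal]
  · rw [← intervalIntegral.integral_of_le hT, integral_rpow (Or.inl ha),
      Real.zero_rpow (by linarith), sub_zero]
  · exact (intervalIntegrable_iff_integrableOn_Ioc_of_le hT).1
      (intervalIntegral.intervalIntegrable_rpow' ha)
  · filter_upwards [ae_restrict_mem measurableSet_Ioc] with x hx
    exact Real.rpow_nonneg hx.1.le _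

theorem lintegral_Ioo_sub_rpow {a : ℝ} (ha : -1 < a) {T : ℝ} (hT : 0 ≤ T) (r : ℝ) :
    ∫⁻ s in Set.Ioo r (r + T), ENNReal.ofReal ((s - r) ^ a)
      = ENNReal.ofReal (T ^ (a + 1) / (a + 1)) := by
  rw [← lintegral_Ioo_rpow ha hT, ← lintegral_indicator measurableSet_Ioo,
    ← lintegral_indicator measurableSet_Ioo,
    ← lintegral_sub_right_eq_self ((Set.Ioo 0 T).indicator fun x => ENNReal.ofReal (x ^ a)) r]
  congr 1
  ext s
  have : s ∈ Set.Ioo r (r + T) ↔ s - r ∈ Set.Ioo 0 T := by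
    simp only [Set.mem_Ioo]
    constructor <;> rintro ⟨h1, h2⟩ <;> constructor <;> linarith
  by_cases h : s ∈ Set.Ioo r (r + T)
  · rw [Set.indicator_of_mem h, Set.indicator_of_mem (this.1 h)]
  · rw [Set.indicator_of_notMem h, Set.indicator_of_notMem (fun h' => h (this.2 h'))]

theorem lintegral_comp_inv_smul (g : Cn n → ℝ≥0∞) (hg : Measurable g) {s : ℝ} (hs : 0 < s) :
    ∫⁻ v, g (s⁻¹ • v) = ENNReal.ofReal (s ^ Module.finrank ℝ (Cn n)) * ∫⁻ u, g u := by
  have h := Measure.map_addHaar_smul (volume : Measure (Cn n)) (inv_ne_zero hs.ne')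
  rw [← lintegral_map hg (measurable_const_smul s⁻¹), h, lintegral_smul_measure, inv_pow, inv_inv,
    abs_of_pos (by positivity), smul_eq_mul]

theorem measurable_gap {X : Type*} [MeasurableSpace X] {f g : X → Cn n} (hf : Measurable f)
    (hg : Measurable g) : Measurable fun x => gap (f x) (g x) :=
  (measurable_const.sub (hg.inner hf)).norm

theorem measurableSet_gap_lt (w : Cn n) (t : ℝ) :
    MeasurableSet {u : Cn n | ‖u‖ < 1 ∧ gap u w < t} :=
  (measurableSet_lt measurable_norm measurable_const).inter
    (measurableSet_lt (measurable_gap measurable_id measurable_const) measurable_const)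

theorem measurableSet_gap_lt' (w : Cn n) (t : ℝ) :
    MeasurableSet {u : Cn n | ‖u‖ ≤ 1 ∧ gap u w < t} :=
  (measurableSet_le measurable_norm measurable_const).inter
    (measurableSet_lt (measurable_gap measurable_id measurable_const) measurable_const)

theorem gap_smul_le {u w : Cn n} (hu : ‖u‖ ≤ 1) (hw : ‖w‖ ≤ 1) {s : ℝ} (hs1 : s ≤ 1) :
    gap (s • u) w ≤ gap u w + (1 - s) := by
  have e : (1 - inner ℂ w (s • u) : ℂ) = (1 - inner ℂ w u) + ((1 - s : ℝ) : ℂ) * inner ℂ w u := by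
    rw [← Complex.coe_smul, inner_smul_right]; push_cast; ring
  rw [gap, e]
  refine (norm_add_le _ _).trans ?_
  rw [norm_mul, Complex.norm_real, Real.norm_of_nonneg (by linarith)]
  have : ‖(inner ℂ w u : ℂ)‖ ≤ 1 := (norm_inner_le_norm _ _).trans (by
    nlinarith [norm_nonneg u, norm_nonneg w])
  have h2 : (1 - s) * ‖(inner ℂ w u : ℂ)‖ ≤ (1 - s) * 1 :=
    mul_le_mul_of_nonneg_left this (by linarith)
  rw [gap]
  linarith

/-- The singular case of the estimate of the weighted volume of nonisotropic balls, by averaging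
over dilations. -/
theorem lintegral_gap_lt_rpow_le_of_neg {C : ℝ≥0} (hC : ∀ w : Cn n, ‖w‖ ≤ 1 → ∀ t : ℝ, 0 < t →
      volume {u : Cn n | ‖u‖ ≤ 1 ∧ gap u w < t} ≤ C * ENNReal.ofReal (t ^ (n + 1)))
    {a : ℝ} (ha : -1 < a) (ha0 : a < 0) : ∃ C' : ℝ≥0, ∀ w : Cn n, ‖w‖ < 1 → ∀ t : ℝ,
    0 < t → t ≤ 4 → ∫⁻ u in {u : Cn n | ‖u‖ < 1 ∧ gap u w < t}, ENNReal.ofReal ((1 - ‖u‖) ^ a)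
      ≤ C' * ENNReal.ofReal (t ^ (n + 1 + a)) := by
  set d := Module.finrank ℝ (Cn n) with hd
  have ha1 : 0 < a + 1 := by linarith
  set K : ℝ := 2 ^ d * (4 ^ (a + 1) / (a + 1)) * 8 ^ (-a) * 2 ^ (n + 1) with hK
  have hK0 : 0 ≤ K := by positivity
  refine ⟨K.toNNReal * C, fun w hw t ht ht4 => ?_⟩
  -- τ is the width of the interval of dilations. It is comparable to t because t ≤ 4, and dilations
  -- s ≥ 1 - τ ≥ 1/2 distort volume by a bounded factor only.
  set τ : ℝ := min t (1 / 2) with hτ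
  have hτ0 : 0 < τ := lt_min ht (by norm_num)
  have hτt : τ ≤ t := min_le_left _ _
  have hτ2 : τ ≤ 1 / 2 := min_le_right _ _
  have hτ8 : t / 8 ≤ τ := le_min (by linarith) (by linarith)
  set E := {u : Cn n | ‖u‖ < 1 ∧ gap u w < t} with hE
  set E2 := {u : Cn n | ‖u‖ ≤ 1 ∧ gap u w < 2 * t} with hE2
  have hEm : MeasurableSet E := measurableSet_gap_lt w t
  have hE2m : MeasurableSet E2 := measurableSet_gap_lt' w (2 * t)
  set g : Cn n → ℝ≥0∞ := E.indicator fun u => ENNReal.ofReal ((1 - ‖u‖) ^ a) with hg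
  have hgm : Measurable g := by
    refine Measurable.indicator ?_ hEm
    exact (Measurable.pow_const (by fun_prop) a).ennreal_ofReal
  set I : ℝ≥0∞ := ∫⁻ u, g u with hI
  have hIe : ∫⁻ u in E, ENNReal.ofReal ((1 - ‖u‖) ^ a) = I := by
    rw [hI, hg, lintegral_indicator hEm]
  rw [hIe]
  let h : ℝ → Cn n → ℝ≥0∞ := fun s v =>
    {x : ℝ × Cn n | x.2 ∈ E2 ∧ x.1 ∈ Set.Ioo ‖x.2‖ (‖x.2‖ + 4 * τ)}.indicator
      (fun x => ENNReal.ofReal ((x.1 - ‖x.2‖) ^ a)) (s, v)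
  have hm : Measurable (Function.uncurry h) := by
    refine Measurable.indicator ?_ ?_
    · exact (Measurable.pow_const (by fun_prop) a).ennreal_ofReal
    · refine (measurable_snd hE2m).inter ?_
      exact (measurableSet_lt (f := fun x : ℝ × Cn n => ‖x.2‖) (g := fun x => x.1)
        (by fun_prop) (by fun_prop)).inter
        (measurableSet_lt (f := fun x : ℝ × Cn n => x.1) (g := fun x => ‖x.2‖ + 4 * τ)
        (by fun_prop) (by fun_prop))
  -- After the dilation v = s u one has s - |v| = s(1-|u|) ≤ 1-|u|, and a < 0 reverses this under
  -- the power. Integrating first in s then meets only the one-dimensional integral of (s-|v|)^a,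
  -- finite for a > -1, so no polar coordinates are needed.
  have step1 : ∀ s ∈ Set.Ioo (1 - τ) 1, I ≤ ENNReal.ofReal (2 ^ d) * ∫⁻ v, h s v := by
    intro s hs
    have hs0 : 1 / 2 < s := by linarith [hs.1]
    have h1 : ENNReal.ofReal (s ^ d) * I ≤ ∫⁻ v, h s v := by
      rw [hI, ← lintegral_comp_inv_smul g hgm (by linarith : 0 < s)]
      refine lintegral_mono fun v => ?_
      by_cases hv : s⁻¹ • v ∈ E
      · have hvu : v = s • (s⁻¹ • v) := by rw [smul_smul, mul_inv_cancel₀ (by linarith), one_smul]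
        set u := s⁻¹ • v with hu
        have hnv : ‖v‖ = s * ‖u‖ := by
          rw [hvu, norm_smul, Real.norm_of_nonneg (by linarith)]
        have hvs : ‖v‖ < s := by rw [hnv]; nlinarith [hv.1]
        have hvE : v ∈ E2 := by
          refine ⟨by linarith [hs.2], ?_⟩
          rw [hvu]
          have := gap_smul_le hv.1.le hw.le hs.2.le
          linarith [hv.2, hs.1]
        have hup : s < ‖v‖ + 4 * τ := by
          have h1 := one_sub_norm_le_gap (z := v) hw.le
          have h2 := hvE.2
          rcases le_total t (1 / 2) with h | h
          · have : τ = t := min_eq_left h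
            linarith [hs.2]
          · have : τ = 1 / 2 := min_eq_right h
            linarith [hs.2, norm_nonneg v]
        have e1 : h s v = ENNReal.ofReal ((s - ‖v‖) ^ a) :=
          Set.indicator_of_mem (s := {x : ℝ × Cn n | x.2 ∈ E2 ∧ x.1 ∈ Set.Ioo ‖x.2‖ (‖x.2‖ + 4 * τ)})
            (a := (s, v)) ⟨hvE, hvs, hup⟩ _
        rw [e1, hg, Set.indicator_of_mem hv]
        refine ENNReal.ofReal_le_ofReal (Real.rpow_le_rpow_of_nonpos (by linarith) ?_ ha0.le)
        have : s * (1 - ‖u‖) ≤ 1 * (1 - ‖u‖) :=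
          mul_le_mul_of_nonneg_right hs.2.le (by linarith [hv.1])
        rw [hnv]; linarith
      · rw [hg, Set.indicator_of_notMem hv]; exact zero_le
    have h2 : (1 : ℝ≥0∞) ≤ ENNReal.ofReal (2 ^ d) * ENNReal.ofReal (s ^ d) := by
      rw [← ENNReal.ofReal_mul (by positivity), ← mul_pow]
      exact ENNReal.one_le_ofReal.2 (one_le_pow₀ (by linarith))
    calc I = 1 * I := (one_mul _).symm
      _ ≤ ENNReal.ofReal (2 ^ d) * ENNReal.ofReal (s ^ d) * I := by gcongr
      _ ≤ _ := by rw [mul_assoc]; gcongr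
  have step2 : ENNReal.ofReal τ * I ≤ ∫⁻ s in Set.Ioo (1 - τ) 1,
      ENNReal.ofReal (2 ^ d) * ∫⁻ v, h s v := by
    calc ENNReal.ofReal τ * I = ∫⁻ _ in Set.Ioo (1 - τ) 1, I := by
          rw [setLIntegral_const, Real.volume_Ioo, mul_comm]; congr 2; ring
      _ ≤ _ := setLIntegral_mono' measurableSet_Ioo step1
  have step3 : ∫⁻ s in Set.Ioo (1 - τ) 1, ENNReal.ofReal (2 ^ d) * ∫⁻ v, h s v
      ≤ ENNReal.ofReal (2 ^ d) * (ENNReal.ofReal ((4 * τ) ^ (a + 1) / (a + 1)) * volume E2) := by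
    calc _ ≤ ∫⁻ s, ENNReal.ofReal (2 ^ d) * ∫⁻ v, h s v := setLIntegral_le_lintegral _ _
      _ = ENNReal.ofReal (2 ^ d) * ∫⁻ s, ∫⁻ v, h s v :=
          lintegral_const_mul _ hm.lintegral_prod_right'
      _ = ENNReal.ofReal (2 ^ d) * ∫⁻ v, ∫⁻ s, h s v := by
          rw [lintegral_lintegral_swap hm.aemeasurable]
      _ ≤ ENNReal.ofReal (2 ^ d) * ∫⁻ v, E2.indicator
            (fun _ => ENNReal.ofReal ((4 * τ) ^ (a + 1) / (a + 1))) v := by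
          gcongr with v
          by_cases hv : v ∈ E2
          · rw [Set.indicator_of_mem hv, ← lintegral_Ioo_sub_rpow ha (by linarith) ‖v‖,
              ← lintegral_indicator measurableSet_Ioo]
            refine lintegral_mono fun s => ?_
            simp only [h, Set.indicator, Set.mem_ofPred_eq, hv, true_and]
            exact le_rfl
          · rw [Set.indicator_of_notMem hv]
            refine le_of_eq ?_
            rw [lintegral_eq_zero_of_ae_eq_zero]
            refine Filter.Eventually.of_forall fun s => ?_
            exact Set.indicator_of_notMem (fun hx => hv hx.1) _
      _ = _ := by rw [lintegral_indicator_const hE2m]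
  have step4 := hC w hw.le (2 * t) (by linarith)
  have hτne : ENNReal.ofReal τ ≠ 0 := by simpa using hτ0
  have hfin : ENNReal.ofReal τ * I ≤ ENNReal.ofReal τ *
      ((K.toNNReal * C : ℝ≥0) * ENNReal.ofReal (t ^ (n + 1 + a))) := by
    refine (step2.trans step3).trans ?_
    calc ENNReal.ofReal (2 ^ d) * (ENNReal.ofReal ((4 * τ) ^ (a + 1) / (a + 1)) * volume E2)
        ≤ ENNReal.ofReal (2 ^ d) * (ENNReal.ofReal ((4 * τ) ^ (a + 1) / (a + 1)) *
          (C * ENNReal.ofReal ((2 * t) ^ (n + 1)))) := by gcongr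
      _ = C * ENNReal.ofReal (2 ^ d * ((4 * τ) ^ (a + 1) / (a + 1)) * (2 * t) ^ (n + 1)) := by
          rw [ENNReal.ofReal_mul (by positivity), ENNReal.ofReal_mul (by positivity)]
          ring
      _ ≤ C * ENNReal.ofReal (τ * (K * t ^ (n + 1 + a))) := by
          gcongr C * ENNReal.ofReal ?_
          have e1 : (4 * τ) ^ (a + 1) = 4 ^ (a + 1) * (τ ^ a * τ) := by
            rw [Real.mul_rpow (by norm_num) hτ0.le, Real.rpow_add_one hτ0.ne']
          have e2 : τ ^ a ≤ 8 ^ (-a) * t ^ a := by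
            calc τ ^ a ≤ (t / 8) ^ a := Real.rpow_le_rpow_of_nonpos (by linarith) hτ8 ha0.le
              _ = 8 ^ (-a) * t ^ a := by
                rw [Real.div_rpow ht.le (by norm_num), Real.rpow_neg (by norm_num)]
                field_simp
          have e3 : t ^ ((n : ℝ) + 1 + a) = t ^ (n + 1) * t ^ a := by
            rw [Real.rpow_add ht]
            norm_cast
          rw [e1, e3, hK, mul_pow]
          calc 2 ^ d * (4 ^ (a + 1) * (τ ^ a * τ) / (a + 1)) * (2 ^ (n + 1) * t ^ (n + 1))
              = τ * (2 ^ d * (4 ^ (a + 1) / (a + 1)) * τ ^ a * 2 ^ (n + 1) * t ^ (n + 1)) := by ring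
            _ ≤ τ * (2 ^ d * (4 ^ (a + 1) / (a + 1)) * (8 ^ (-a) * t ^ a)
                  * 2 ^ (n + 1) * t ^ (n + 1)) := by gcongr
            _ = _ := by ring
      _ = _ := by
          rw [ENNReal.ofReal_mul hτ0.le, ENNReal.ofReal_mul hK0]
          push_cast
          rw [ENNReal.ofReal]
          simp only [ENNReal.ofReal]
          ring
  exact (ENNReal.mul_le_mul_iff_right hτne ENNReal.ofReal_ne_top).1 hfin

/-- For a ≥ 0 the weight is at most (2t)^a on the set and the volume bound suffices; for a < 0
dilation averaging is used. Radii above 4 add nothing, since the gap never exceeds 2. -/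
theorem lintegral_gap_lt_rpow_le (hn : 1 ≤ n) {a : ℝ} (ha : -1 < a) :
    ∃ C : ℝ≥0, ∀ w : Cn n, ‖w‖ < 1 → ∀ t : ℝ, 0 < t →
    ∫⁻ u in {u : Cn n | ‖u‖ < 1 ∧ gap u w < t}, ENNReal.ofReal ((1 - ‖u‖ ^ 2) ^ a)
      ≤ C * ENNReal.ofReal (t ^ (n + 1 + a)) := by
  obtain ⟨C, hC⟩ := volume_gap_lt_le hn
  rcases lt_or_ge a 0 with ha0 | ha0
  · obtain ⟨C', hC'⟩ := lintegral_gap_lt_rpow_le_of_neg hC ha ha0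
    have main : ∀ w : Cn n, ‖w‖ < 1 → ∀ t : ℝ, 0 < t → t ≤ 4 →
        ∫⁻ u in {u : Cn n | ‖u‖ < 1 ∧ gap u w < t}, ENNReal.ofReal ((1 - ‖u‖ ^ 2) ^ a)
          ≤ C' * ENNReal.ofReal (t ^ (n + 1 + a)) := fun w hw t ht ht4 => by
      refine le_trans ?_ (hC' w hw t ht ht4)
      refine setLIntegral_mono' (measurableSet_gap_lt w t) fun u hu => ?_
      refine ENNReal.ofReal_le_ofReal (Real.rpow_le_rpow_of_nonpos ?_ ?_ ha0.le)
      · linarith [hu.1]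
      · nlinarith [hu.1, norm_nonneg u]
    refine ⟨C', fun w hw t ht => ?_⟩
    rcases le_total t 4 with h | h
    · exact main w hw t ht h
    · refine (lintegral_mono_set ?_).trans ((main w hw 4 (by norm_num) le_rfl).trans ?_)
      · exact fun u hu => ⟨hu.1, by linarith [gap_le_two hu.1.le hw.le]⟩
      · gcongr
        linarith
  · refine ⟨C * (2 ^ a : ℝ).toNNReal, fun w hw t ht => ?_⟩
    calc ∫⁻ u in {u : Cn n | ‖u‖ < 1 ∧ gap u w < t}, ENNReal.ofReal ((1 - ‖u‖ ^ 2) ^ a)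
        ≤ ∫⁻ _ in {u : Cn n | ‖u‖ < 1 ∧ gap u w < t}, ENNReal.ofReal ((2 * t) ^ a) := by
          refine setLIntegral_mono' (measurableSet_gap_lt w t) fun u hu => ?_
          refine ENNReal.ofReal_le_ofReal (Real.rpow_le_rpow (one_sub_sq_pos hu.1).le ?_ ha0)
          linarith [one_sub_sq_le_gap hu.1.le hw.le, hu.2]
      _ = ENNReal.ofReal ((2 * t) ^ a) * volume {u : Cn n | ‖u‖ < 1 ∧ gap u w < t} :=
          setLIntegral_const _ _
      _ ≤ ENNReal.ofReal ((2 * t) ^ a) * (C * ENNReal.ofReal (t ^ (n + 1))) := by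
          gcongr
          refine (measure_mono ?_).trans (hC w hw.le t ht)
          exact fun u hu => ⟨hu.1.le, hu.2⟩
      _ = _ := by
          have e3 : t ^ ((n : ℝ) + 1 + a) = t ^ (n + 1) * t ^ a := by
            rw [Real.rpow_add ht]
            norm_cast
          rw [e3, Real.mul_rpow (by norm_num) ht.le, ENNReal.ofReal_mul (by positivity),
            ENNReal.ofReal_mul (by positivity)]
          push_cast
          simp only [ENNReal.ofReal]
          ring

/-- The upper Forelli–Rudin estimate. -/
theorem lintegral_rpow_gap_le (hn : 1 ≤ n) {a b : ℝ} (ha : -1 < a) (hb : 0 < b) :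
    ∃ C : ℝ≥0, ∀ w : Cn n, ‖w‖ < 1 →
    ∫⁻ u in unitBall n, ENNReal.ofReal ((1 - ‖u‖ ^ 2) ^ a * gap u w ^ (-(n + 1 + a + b)))
      ≤ C * ENNReal.ofReal ((1 - ‖w‖ ^ 2) ^ (-b)) := by
  obtain ⟨C, hC⟩ := lintegral_gap_lt_rpow_le hn ha
  set l : ℝ := n + 1 + a + b with hl
  have hl0 : 0 < l := by have : (0 : ℝ) ≤ n := n.cast_nonneg; linarith
  set r : ℝ := 2 ^ (-b) with hr
  have hr0 : 0 < r := by positivity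
  have hr1 : r < 1 := Real.rpow_lt_one_of_one_lt_of_neg (by norm_num) (by linarith)
  set K : ℝ := 2 ^ (n + 1 + a) * (1 - r)⁻¹ * 2 ^ b with hK
  have h1r : 0 < 1 - r := by linarith
  refine ⟨C * K.toNNReal, fun w hw => ?_⟩
  set δ : ℝ := 1 - ‖w‖ with hδ
  have hδ0 : 0 < δ := by linarith
  have hball : MeasurableSet (unitBall n) := Metric.isOpen_ball.measurableSet
  -- Dyadic decomposition in the gap, which is at least δ. The piece at level k contributes δ^(-b)
  -- 2^(-bk) up to a constant, a geometric series because b > 0.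
  let S : ℕ → Set (Cn n) := fun k => {u | ‖u‖ < 1 ∧ gap u w < 2 ^ (k + 1) * δ}
  have hSm : ∀ k, MeasurableSet (S k) := fun k => measurableSet_gap_lt w _
  have hmw : Measurable fun u : Cn n => ENNReal.ofReal ((1 - ‖u‖ ^ 2) ^ a) :=
    (Measurable.pow_const (by fun_prop) a).ennreal_ofReal
  have hpt : ∀ u ∈ unitBall n,
      ENNReal.ofReal ((1 - ‖u‖ ^ 2) ^ a * gap u w ^ (-l)) ≤
      ∑' k : ℕ, ENNReal.ofReal ((2 ^ k * δ) ^ (-l)) *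
        (S k).indicator (fun u => ENNReal.ofReal ((1 - ‖u‖ ^ 2) ^ a)) u := by
    intro u hu
    have hu1 := mem_unitBall.1 hu
    have hg : δ ≤ gap u w := by rw [gap_comm]; exact one_sub_norm_le_gap hu1.le
    obtain ⟨k, hk1, hk2⟩ := exists_nat_pow_near (x := gap u w / δ) (y := 2)
      ((one_le_div hδ0).2 hg) (by norm_num)
    rw [le_div_iff₀ hδ0] at hk1
    rw [div_lt_iff₀ hδ0] at hk2
    refine le_trans ?_ (ENNReal.le_tsum k)
    rw [Set.indicator_of_mem (show u ∈ S k from ⟨hu1, hk2⟩),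
      ENNReal.ofReal_mul (Real.rpow_nonneg (one_sub_sq_pos hu1).le _), mul_comm]
    gcongr ?_ * _
    exact ENNReal.ofReal_le_ofReal
      (Real.rpow_le_rpow_of_nonpos (by positivity) hk1 (by linarith))
  have hterm : ∀ k : ℕ, (2 ^ k * δ) ^ (-l) * (2 ^ (k + 1) * δ) ^ (n + 1 + a)
      = 2 ^ (n + 1 + a) * δ ^ (-b) * r ^ k := fun k => by
    have e : 2 ^ (k + 1) * δ = 2 ^ k * δ * 2 := by ring
    have hX : 0 < 2 ^ k * δ := by positivity
    rw [e, Real.mul_rpow hX.le (by norm_num), ← mul_assoc, ← Real.rpow_add hX,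
      show -l + (n + 1 + a) = -b by rw [hl]; ring, Real.mul_rpow (by positivity) hδ0.le, hr,
      ← Real.rpow_natCast, ← Real.rpow_natCast, ← Real.rpow_mul (by norm_num),
      ← Real.rpow_mul (by norm_num), mul_comm (k : ℝ)]
    ring
  calc ∫⁻ u in unitBall n, ENNReal.ofReal ((1 - ‖u‖ ^ 2) ^ a * gap u w ^ (-l))
      ≤ ∫⁻ u, ∑' k : ℕ, ENNReal.ofReal ((2 ^ k * δ) ^ (-l)) *
        (S k).indicator (fun u => ENNReal.ofReal ((1 - ‖u‖ ^ 2) ^ a)) u :=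
        (setLIntegral_mono' hball hpt).trans (setLIntegral_le_lintegral _ _)
    _ = ∑' k : ℕ, ENNReal.ofReal ((2 ^ k * δ) ^ (-l)) *
          ∫⁻ u in S k, ENNReal.ofReal ((1 - ‖u‖ ^ 2) ^ a) := by
        rw [lintegral_tsum fun k => ((hmw.indicator (hSm k)).const_mul _).aemeasurable]
        congr 1; ext k
        rw [lintegral_const_mul _ (hmw.indicator (hSm k)), lintegral_indicator (hSm k)]
    _ ≤ ∑' k : ℕ, ENNReal.ofReal ((2 ^ k * δ) ^ (-l)) *
          (C * ENNReal.ofReal ((2 ^ (k + 1) * δ) ^ (n + 1 + a))) := by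
        gcongr with k
        exact hC w hw _ (by positivity)
    _ = ∑' k : ℕ, C * ENNReal.ofReal (2 ^ (n + 1 + a) * δ ^ (-b)) * ENNReal.ofReal r ^ k := by
        congr 1; ext k
        rw [mul_left_comm, ← ENNReal.ofReal_mul (by positivity), hterm k,
          ENNReal.ofReal_mul (by positivity), ENNReal.ofReal_pow hr0.le, mul_assoc]
    _ = C * ENNReal.ofReal (2 ^ (n + 1 + a) * δ ^ (-b) * (1 - r)⁻¹) := by
        rw [ENNReal.tsum_mul_left, ENNReal.tsum_geometric, mul_assoc]
        congr 1
        rw [ENNReal.ofReal_mul (by positivity) (q := (1 - r)⁻¹), ENNReal.ofReal_inv_of_pos h1r,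
          ENNReal.ofReal_sub _ hr0.le, ENNReal.ofReal_one]
    _ ≤ C * ENNReal.ofReal (K * (1 - ‖w‖ ^ 2) ^ (-b)) := by
        gcongr C * ENNReal.ofReal ?_
        have h5 : δ ^ (-b) ≤ 2 ^ b * (1 - ‖w‖ ^ 2) ^ (-b) := by
          calc δ ^ (-b) ≤ ((1 - ‖w‖ ^ 2) / 2) ^ (-b) := by
                refine Real.rpow_le_rpow_of_nonpos ?_ ?_ (by linarith)
                · linarith [one_sub_sq_pos hw]
                · nlinarith [norm_nonneg w]
            _ = _ := by
              rw [Real.div_rpow (one_sub_sq_pos hw).le (by norm_num),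
                Real.rpow_neg (x := 2) (by norm_num) b, div_inv_eq_mul, mul_comm]
        rw [hK]
        calc 2 ^ (n + 1 + a) * δ ^ (-b) * (1 - r)⁻¹
            ≤ 2 ^ (n + 1 + a) * (2 ^ b * (1 - ‖w‖ ^ 2) ^ (-b)) * (1 - r)⁻¹ := by gcongr
          _ = _ := by ring
    _ = _ := by
        rw [ENNReal.ofReal_mul (by positivity)]
        push_cast
        simp only [ENNReal.ofReal]
        ring

/-- The lower Forelli–Rudin estimate, without weight. -/
theorem rpow_le_lintegral_gap (hn : 1 ≤ n) {b : ℝ} (hb : 0 < b) :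
    ∃ C : ℝ≥0, ∀ w : Cn n, ‖w‖ < 1 → ENNReal.ofReal ((1 - ‖w‖ ^ 2) ^ (-b)) ≤
      C * ∫⁻ u in unitBall n, ENNReal.ofReal (gap u w ^ (-(n + 1 + b))) := by
  obtain ⟨c, hc0, hc⟩ := le_volume_gap_lt hn
  set l : ℝ := n + 1 + b with hl
  have hl0 : 0 < l := by positivity
  refine ⟨(3 ^ l : ℝ).toNNReal * c⁻¹, fun w hw => ?_⟩
  set δ : ℝ := 1 - ‖w‖ with hδ
  have hδ0 : 0 < δ := by linarith
  -- The single region where the gap is below 3δ already carries the required size.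
  have h1 : ENNReal.ofReal ((3 * δ) ^ (-l)) * (c * ENNReal.ofReal (δ ^ (n + 1))) ≤
      ∫⁻ u in unitBall n, ENNReal.ofReal (gap u w ^ (-l)) := by
    calc _ ≤ ENNReal.ofReal ((3 * δ) ^ (-l)) * volume {u : Cn n | ‖u‖ < 1 ∧ gap u w < 3 * δ} := by
          gcongr; exact hc w hw
      _ = ∫⁻ _ in {u : Cn n | ‖u‖ < 1 ∧ gap u w < 3 * δ}, ENNReal.ofReal ((3 * δ) ^ (-l)) :=
          (setLIntegral_const _ _).symm
      _ ≤ ∫⁻ u in {u : Cn n | ‖u‖ < 1 ∧ gap u w < 3 * δ}, ENNReal.ofReal (gap u w ^ (-l)) := by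
          refine setLIntegral_mono' (measurableSet_gap_lt w _) fun u hu => ?_
          exact ENNReal.ofReal_le_ofReal
            (Real.rpow_le_rpow_of_nonpos (gap_pos hu.1 hw.le) hu.2.le (by linarith))
      _ ≤ _ := lintegral_mono_set fun u hu => mem_unitBall.2 hu.1
  have h2 : ENNReal.ofReal (δ ^ (-b)) = ENNReal.ofReal (3 ^ l) * (c : ℝ≥0∞)⁻¹ *
      (ENNReal.ofReal ((3 * δ) ^ (-l)) * (c * ENNReal.ofReal (δ ^ (n + 1)))) := by
    have hcc : (c : ℝ≥0∞)⁻¹ * c = 1 :=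
      ENNReal.inv_mul_cancel (by exact_mod_cast hc0.ne') ENNReal.coe_ne_top
    calc ENNReal.ofReal (δ ^ (-b))
        = ENNReal.ofReal (3 ^ l * ((3 * δ) ^ (-l) * δ ^ (n + 1))) := by
          congr 1
          rw [Real.mul_rpow (by norm_num) hδ0.le, ← mul_assoc, ← mul_assoc,
            ← Real.rpow_add (by norm_num), add_neg_cancel, Real.rpow_zero, one_mul,
            ← Real.rpow_natCast, ← Real.rpow_add hδ0]
          congr 1; rw [hl]; push_cast; ring
      _ = ENNReal.ofReal (3 ^ l) * (ENNReal.ofReal ((3 * δ) ^ (-l)) * ENNReal.ofReal (δ ^ (n + 1)))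
          * ((c : ℝ≥0∞)⁻¹ * c) := by
          rw [hcc, mul_one, ← ENNReal.ofReal_mul (by positivity), ← ENNReal.ofReal_mul (by positivity)]
      _ = _ := by ring
  calc ENNReal.ofReal ((1 - ‖w‖ ^ 2) ^ (-b)) ≤ ENNReal.ofReal (δ ^ (-b)) := by
        refine ENNReal.ofReal_le_ofReal (Real.rpow_le_rpow_of_nonpos hδ0 ?_ (by linarith))
        nlinarith [norm_nonneg w]
    _ ≤ _ := by
        rw [h2]
        push_cast
        rw [ENNReal.coe_inv hc0.ne']
        exact mul_le_mul_right h1 _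

end

end BergmanBall

/-! ### Weighted kernels, Carleson measures and Schur's test. -/

namespace BergmanBall

noncomputable section

variable {n : ℕ} {α : ℝ} {p : ℝ≥0∞} {C : ℝ≥0} {μ : Measure (Cn n)}

theorem measurableSet_unitBall : MeasurableSet (unitBall n) := Metric.isOpen_ball.measurableSet

theorem volume_unitBall_ne_zero : volume (unitBall n) ≠ 0 :=
  (Metric.measure_ball_pos _ _ one_pos).ne'

theorem volume_unitBall_ne_top : volume (unitBall n) ≠ ∞ := measure_ball_lt_top.ne

/-- The total normalization constant of `v_α`. -/
def vConst (n : ℕ) (α : ℝ) : ℝ≥0∞ := (volume (unitBall n))⁻¹ * ENNReal.ofReal (cAlpha n α)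

theorem vConst_ne_top : vConst n α ≠ ∞ :=
  ENNReal.mul_ne_top (ENNReal.inv_ne_top.2 volume_unitBall_ne_zero) ENNReal.ofReal_ne_top

theorem cAlpha_pos (hα : -1 < α) : 0 < cAlpha n α := by
  have : (0 : ℝ) ≤ n := n.cast_nonneg
  have h1 := Real.Gamma_pos_of_pos (show 0 < (n : ℝ) + α + 1 by linarith)
  have h2 := Real.Gamma_pos_of_pos (show 0 < α + 1 by linarith)
  unfold cAlpha
  positivity

theorem lintegral_vAlpha (hα : -1 < α) {f : Cn n → ℝ≥0∞} (hf : Measurable f) :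
    ∫⁻ z, f z ∂vAlpha n α
      = vConst n α * ∫⁻ z in unitBall n, ENNReal.ofReal ((1 - ‖z‖ ^ 2) ^ α) * f z := by
  have h0 : Measurable fun z : Cn n => (1 - ‖z‖ ^ 2) ^ α := Measurable.pow_const (by fun_prop) α
  rw [vAlpha, lintegral_withDensity_eq_lintegral_mul _ (h0.const_mul _).ennreal_ofReal hf,
    normVolume, lintegral_smul_measure, vConst, mul_assoc, smul_eq_mul]
  congr 1
  have h1 : Measurable fun z : Cn n => ENNReal.ofReal ((1 - ‖z‖ ^ 2) ^ α) * f z :=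
    h0.ennreal_ofReal.mul hf
  rw [← lintegral_const_mul _ h1]
  congr 1; ext z
  rw [Pi.mul_apply, ENNReal.ofReal_mul (cAlpha_pos hα).le, mul_assoc]

theorem vAlpha_compl_unitBall : vAlpha n α (unitBall n)ᶜ = 0 := by
  refine withDensity_absolutelyContinuous _ _ ?_
  rw [normVolume, Measure.smul_apply, Measure.restrict_apply measurableSet_unitBall.compl,
    Set.compl_inter_self, measure_empty, smul_zero]

theorem ae_norm_lt_one (h : μ (unitBall n)ᶜ = 0) : ∀ᵐ z ∂μ, ‖z‖ < 1 := by
  refine measure_mono_null (fun z hz => ?_) h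
  exact fun h => hz (mem_unitBall.1 h)

theorem volume_restrict_absolutelyContinuous (hα : -1 < α) :
    volume.restrict (unitBall n) ≪ vAlpha n α := by
  have h0 : Measurable fun z : Cn n => (1 - ‖z‖ ^ 2) ^ α := Measurable.pow_const (by fun_prop) α
  have h1 : normVolume n ≪ vAlpha n α := by
    refine withDensity_absolutelyContinuous' (h0.const_mul _).ennreal_ofReal.aemeasurable ?_
    refine (Measure.smul_absolutelyContinuous (c := (volume (unitBall n))⁻¹)).ae_le ?_
    filter_upwards [ae_restrict_mem measurableSet_unitBall] with z hz
    have := one_sub_sq_pos (mem_unitBall.1 hz)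
    have := cAlpha_pos (n := n) hα
    simpa using by positivity
  refine Measure.AbsolutelyContinuous.trans ?_ h1
  intro s hs
  rw [normVolume, Measure.smul_apply, smul_eq_mul, mul_eq_zero] at hs
  exact hs.resolve_left (ENNReal.inv_ne_zero.2 volume_unitBall_ne_top)

theorem isFiniteMeasure_vAlpha (hn : 1 ≤ n) (hα : -1 < α) : IsFiniteMeasure (vAlpha n α) := by
  obtain ⟨C, hC⟩ := lintegral_gap_lt_rpow_le hn hα
  refine ⟨?_⟩
  rw [← lintegral_one, lintegral_vAlpha hα measurable_const]
  refine ENNReal.mul_lt_top vConst_ne_top.lt_top ?_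
  refine lt_of_le_of_lt ?_ ((hC 0 (by simp) 2 (by norm_num)).trans_lt
    (ENNReal.mul_lt_top ENNReal.coe_lt_top ENNReal.ofReal_lt_top))
  simp only [mul_one]
  refine lintegral_mono_set fun u hu => ⟨mem_unitBall.1 hu, ?_⟩
  simp [gap]

/-- The modulus of the Bergman kernel, times a power of `cosh² β`. -/
def wKernel (n : ℕ) (α η : ℝ) (z w : Cn n) : ℝ := gap z w ^ (-(n + 1 + α)) * coshSq z w ^ η

theorem wKernel_comm (η : ℝ) (z w : Cn n) : wKernel n α η z w = wKernel n α η w z := by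
  rw [wKernel, wKernel, gap_comm, coshSq_comm]

theorem measurable_coshSq {X : Type*} [MeasurableSpace X] {f g : X → Cn n} (hf : Measurable f)
    (hg : Measurable g) : Measurable fun x => coshSq (f x) (g x) :=
  ((measurable_gap hf hg).pow_const 2).div
    ((measurable_const.sub (hf.norm.pow_const 2)).mul (measurable_const.sub (hg.norm.pow_const 2)))

theorem measurable_wKernel (η : ℝ) {X : Type*} [MeasurableSpace X] {f g : X → Cn n}
    (hf : Measurable f) (hg : Measurable g) : Measurable fun x => wKernel n α η (f x) (g x) :=
  ((measurable_gap hf hg).pow_const _).mul ((measurable_coshSq hf hg).pow_const _)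

theorem wKernel_mul_rpow (η t : ℝ) {z w : Cn n} (hz : ‖z‖ < 1) (hw : ‖w‖ < 1) :
    wKernel n α η z w * (1 - ‖w‖ ^ 2) ^ (-t) =
      (1 - ‖z‖ ^ 2) ^ (-η) *
        (gap z w ^ (-(n + 1 + α - 2 * η)) * (1 - ‖w‖ ^ 2) ^ (-(η + t))) := by
  have hg := gap_pos hz hw.le
  have pz := one_sub_sq_pos hz
  have pw := one_sub_sq_pos hw
  rw [wKernel, coshSq, Real.div_rpow (by positivity) (by positivity), Real.mul_rpow pz.le pw.le,
    ← Real.rpow_natCast, ← Real.rpow_mul hg.le,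
    show -((n : ℝ) + 1 + α - 2 * η) = -(n + 1 + α) + (2 : ℕ) * η by push_cast; ring,
    Real.rpow_add hg, show -(η + t) = -η + -t by ring, Real.rpow_add pw, Real.rpow_neg pz.le, Real.rpow_neg pw.le η]
  field_simp

/-- The weight coshSq^η lowers the gap exponent by 2η and the power of 1-|w|² by η. Forelli–Rudin
then applies with a = α - η - t and b = t - η; the two hypotheses on t say a > -1 and b > 0. -/
theorem lintegral_wKernel_vAlpha_le (hn : 1 ≤ n) (hα : -1 < α) {η t : ℝ} (ht : η < t)
    (hηt : η + t < α + 1) : ∃ A : ℝ≥0, ∀ z : Cn n, ‖z‖ < 1 →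
      ∫⁻ w, ENNReal.ofReal (wKernel n α η z w * (1 - ‖w‖ ^ 2) ^ (-t)) ∂vAlpha n α
        ≤ A * ENNReal.ofReal ((1 - ‖z‖ ^ 2) ^ (-t)) := by
  obtain ⟨A, hA⟩ := lintegral_rpow_gap_le hn (a := α - η - t) (b := t - η) (by linarith)
    (by linarith)
  refine ⟨(vConst n α).toNNReal * A, fun z hz => ?_⟩
  have pz := one_sub_sq_pos hz
  have hm : Measurable fun w : Cn n => (1 - ‖w‖ ^ 2) ^ (-t) := Measurable.pow_const (by fun_prop) _
  have hm1 : Measurable fun w : Cn n =>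
      ENNReal.ofReal (wKernel n α η z w * (1 - ‖w‖ ^ 2) ^ (-t)) :=
    ((measurable_wKernel η measurable_const measurable_id).mul hm).ennreal_ofReal
  rw [lintegral_vAlpha hα hm1]
  have hm2 : Measurable fun w : Cn n => ENNReal.ofReal ((1 - ‖w‖ ^ 2) ^ (α - η - t) *
      gap w z ^ (-(n + 1 + (α - η - t) + (t - η)))) := by
    refine (Measurable.mul (Measurable.pow_const (by fun_prop) _) ?_).ennreal_ofReal
    exact (measurable_gap measurable_id measurable_const).pow_const _
  calc vConst n α * ∫⁻ w in unitBall n, ENNReal.ofReal ((1 - ‖w‖ ^ 2) ^ α) *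
        ENNReal.ofReal (wKernel n α η z w * (1 - ‖w‖ ^ 2) ^ (-t))
      = vConst n α * ∫⁻ w in unitBall n, ENNReal.ofReal ((1 - ‖z‖ ^ 2) ^ (-η)) *
          ENNReal.ofReal ((1 - ‖w‖ ^ 2) ^ (α - η - t) *
            gap w z ^ (-(n + 1 + (α - η - t) + (t - η)))) := by
        congr 1
        refine setLIntegral_congr_fun measurableSet_unitBall fun w hw => ?_
        have pw := one_sub_sq_pos (mem_unitBall.1 hw)
        rw [← ENNReal.ofReal_mul (by positivity), ← ENNReal.ofReal_mul (by positivity),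
          wKernel_mul_rpow η t hz (mem_unitBall.1 hw), gap_comm,
          show α - η - t = α + -(η + t) by ring, Real.rpow_add pw,
          show (n : ℝ) + 1 + (α + -(η + t)) + (t - η) = n + 1 + α - 2 * η by ring]
        congr 1; ring
    _ = vConst n α * (ENNReal.ofReal ((1 - ‖z‖ ^ 2) ^ (-η)) * ∫⁻ w in unitBall n,
          ENNReal.ofReal ((1 - ‖w‖ ^ 2) ^ (α - η - t) *
            gap w z ^ (-(n + 1 + (α - η - t) + (t - η))))) := by
        rw [lintegral_const_mul _ hm2]
    _ ≤ vConst n α * (ENNReal.ofReal ((1 - ‖z‖ ^ 2) ^ (-η)) *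
          (A * ENNReal.ofReal ((1 - ‖z‖ ^ 2) ^ (-(t - η))))) := by
        gcongr
        exact hA z hz
    _ = vConst n α * A * ENNReal.ofReal ((1 - ‖z‖ ^ 2) ^ (-η) * (1 - ‖z‖ ^ 2) ^ (-(t - η))) := by
        rw [ENNReal.ofReal_mul (by positivity)]; ring
    _ = _ := by
        rw [← Real.rpow_add pz, show -η + -(t - η) = -t by ring]
        push_cast
        rw [ENNReal.coe_toNNReal vConst_ne_top]

theorem IsCarlesonWith.lintegral_le (hμ : IsCarlesonWith n α p C μ) (hp1 : 1 < p) (hp : p < ∞)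
    {f : Cn n → ℂ} (hf : DifferentiableOn ℂ f (unitBall n)) (hfp : MemLp f p (vAlpha n α)) :
    ∫⁻ w, ‖f w‖ₑ ^ p.toReal ∂μ ≤ C ^ p.toReal * ∫⁻ w, ‖f w‖ₑ ^ p.toReal ∂vAlpha n α := by
  have h := hμ.embedding f hf hfp
  have hp0 : p ≠ 0 := (zero_lt_one.trans hp1).ne'
  have hP : 0 < p.toReal := ENNReal.toReal_pos hp0 hp.ne
  rw [eLpNorm_eq_lintegral_rpow_enorm_toReal hp0 hp.ne,
    eLpNorm_eq_lintegral_rpow_enorm_toReal hp0 hp.ne] at h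
  have h2 := ENNReal.rpow_le_rpow h hP.le
  rwa [ENNReal.mul_rpow_of_nonneg _ _ hP.le, ← ENNReal.rpow_mul, ← ENNReal.rpow_mul,
    one_div_mul_cancel hP.ne', ENNReal.rpow_one, ENNReal.rpow_one] at h2

theorem isCarlesonWith_vAlpha (hn : 1 ≤ n) (hα : -1 < α) :
    IsCarlesonWith n α p 1 (vAlpha n α) :=
  ⟨isFiniteMeasure_vAlpha hn hα, vAlpha_compl_unitBall, fun f _ _ => by simp⟩

theorem IsCarlesonWith.restrict (hμ : IsCarlesonWith n α p C μ) (G : Set (Cn n)) :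
    IsCarlesonWith n α p C (μ.restrict G) :=
  ⟨by have := hμ.finite; infer_instance,
    le_antisymm ((Measure.restrict_le_self _).trans hμ.supported.le) zero_le,
    fun f hf hfp => (eLpNorm_mono_measure f Measure.restrict_le_self).trans (hμ.embedding f hf hfp)⟩

theorem re_one_sub_inner_pos {z w : Cn n} (hz : ‖z‖ ≤ 1) (hw : ‖w‖ < 1) :
    0 < (1 - inner ℂ z w : ℂ).re := by
  have h : (inner ℂ z w : ℂ).re ≤ ‖z‖ * ‖w‖ :=
    (Complex.re_le_norm _).trans (norm_inner_le_norm _ _)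
  rw [Complex.sub_re, Complex.one_re]
  nlinarith [norm_nonneg z, norm_nonneg w]

theorem differentiableOn_one_sub_inner_cpow {z : Cn n} (hz : ‖z‖ ≤ 1) (c : ℂ) :
    DifferentiableOn ℂ (fun w => (1 - inner ℂ z w : ℂ) ^ c) (unitBall n) := by
  intro w hw
  refine DifferentiableAt.differentiableWithinAt ?_
  refine DifferentiableAt.cpow_const ?_ (Or.inl (re_one_sub_inner_pos hz (mem_unitBall.1 hw)))
  exact (differentiableAt_const _).sub (innerSL ℂ z).differentiableAt

theorem measurable_one_sub_inner_cpow (z : Cn n) (c : ℂ) :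
    Measurable (fun w => (1 - inner ℂ z w : ℂ) ^ c) :=
  (measurable_const.sub (measurable_const.inner measurable_id)).pow_const c

/-- Adding both endpoint values avoids a case split on the sign of the exponent wherever a kernel
power is bounded. -/
theorem rpow_le_of_mem_Icc {x a b c : ℝ} (ha : 0 < a) (h1 : a ≤ x) (h2 : x ≤ b) :
    x ^ c ≤ a ^ c + b ^ c := by
  have hx : 0 < x := ha.trans_le h1
  rcases le_total 0 c with h | h
  · linarith [Real.rpow_le_rpow hx.le h2 h, Real.rpow_nonneg ha.le c]
  · linarith [Real.rpow_le_rpow_of_nonpos ha h1 h, Real.rpow_nonneg (hx.le.trans h2) c]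

/-- For z and u inside the ball these products are bounded, so they are admissible test functions in
the Carleson inequality. Their p-th power moduli are arbitrary real powers of the two gaps. -/
theorem memLp_one_sub_inner_cpow_mul (hn : 1 ≤ n) (hα : -1 < α) {z u : Cn n} (hz : ‖z‖ < 1)
    (hu : ‖u‖ < 1) (c d : ℝ) :
    MemLp (fun w => (1 - inner ℂ z w : ℂ) ^ (c : ℂ) * (1 - inner ℂ u w : ℂ) ^ (d : ℂ)) p
      (vAlpha n α) := by
  have := isFiniteMeasure_vAlpha hn hα
  refine MemLp.of_bound ((measurable_one_sub_inner_cpow z _).mul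
    (measurable_one_sub_inner_cpow u _)).aestronglyMeasurable
    (((1 - ‖z‖) ^ c + 2 ^ c) * ((1 - ‖u‖) ^ d + 2 ^ d)) ?_
  filter_upwards [ae_norm_lt_one (vAlpha_compl_unitBall (n := n) (α := α))] with w hw
  rw [norm_mul, Complex.norm_cpow_real, Complex.norm_cpow_real]
  have h : ∀ {x : Cn n} (e : ℝ), ‖x‖ < 1 → ‖(1 - inner ℂ x w : ℂ)‖ ^ e ≤ (1 - ‖x‖) ^ e + 2 ^ e := by
    intro x e hx
    refine rpow_le_of_mem_Icc (by linarith) ?_ (gap_le_two hw.le hx.le)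
    exact (one_sub_norm_le_gap hw.le).trans (gap_comm x w).le
  have h1z : 0 < 1 - ‖z‖ := by linarith
  exact mul_le_mul (h c hz) (h d hu) (by positivity) (by positivity)

theorem enorm_cpow_mul_rpow {P : ℝ} (hP : 0 < P) (x y : ℂ) (c d : ℝ) :
    ‖x ^ ((c / P : ℝ) : ℂ) * y ^ ((d / P : ℝ) : ℂ)‖ₑ ^ P = ENNReal.ofReal (‖x‖ ^ c * ‖y‖ ^ d) := by
  rw [← ofReal_norm, ENNReal.ofReal_rpow_of_nonneg (norm_nonneg _) hP.le, norm_mul,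
    Complex.norm_cpow_real, Complex.norm_cpow_real, Real.mul_rpow (by positivity) (by positivity),
    ← Real.rpow_mul (norm_nonneg _), ← Real.rpow_mul (norm_nonneg _), div_mul_cancel₀ _ hP.ne',
    div_mul_cancel₀ _ hP.ne']

/-- Integrals of products of powers of `1-|w|²` and of the modulus of a kernel against a Carleson
measure are controlled by the same integrals against `v_α`. -/
theorem IsCarlesonWith.lintegral_gap_rpow_le (hn : 1 ≤ n) (hα : -1 < α) (hp1 : 1 < p) (hp : p < ∞)
    {t : ℝ} (ht : 0 < t) : ∃ A : ℝ≥0, ∀ {C : ℝ≥0} {μ : Measure (Cn n)}, IsCarlesonWith n α p C μ →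
      ∀ (l : ℝ) (z : Cn n), ‖z‖ < 1 →
      ∫⁻ w, ENNReal.ofReal (gap z w ^ l * (1 - ‖w‖ ^ 2) ^ (-t)) ∂μ ≤ A * C ^ p.toReal *
        ∫⁻ w, ENNReal.ofReal (gap z w ^ l * (1 - ‖w‖ ^ 2) ^ (-t)) ∂vAlpha n α := by
  obtain ⟨A₁, hA₁⟩ := rpow_le_lintegral_gap hn ht
  obtain ⟨A₂, hA₂⟩ := lintegral_rpow_gap_le hn (a := 0) (by norm_num) ht
  simp only [Real.rpow_zero, one_mul, add_zero] at hA₂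
  refine ⟨A₁ * A₂, fun {C μ} hμ l z hz => ?_⟩
  have hP : 0 < p.toReal := ENNReal.toReal_pos (zero_lt_one.trans hp1).ne' hp.ne
  have := hμ.finite
  have := isFiniteMeasure_vAlpha hn hα
  set m : ℝ := -(n + 1 + t) with hm
  have hmeas : Measurable fun x : Cn n × Cn n =>
      ENNReal.ofReal (gap z x.1 ^ l) * ENNReal.ofReal (gap x.2 x.1 ^ m) :=
    ((measurable_gap measurable_const measurable_fst).pow_const _).ennreal_ofReal.mul
      ((measurable_gap measurable_snd measurable_fst).pow_const _).ennreal_ofReal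
  have hmu : ∀ w : Cn n, Measurable fun u : Cn n => ENNReal.ofReal (gap u w ^ m) := fun w =>
    ((measurable_gap measurable_id measurable_const).pow_const _).ennreal_ofReal
  have hfub : ∀ (ν : Measure (Cn n)) [IsFiniteMeasure ν],
      ∫⁻ w, ENNReal.ofReal (gap z w ^ l) * (∫⁻ u in unitBall n, ENNReal.ofReal (gap u w ^ m)) ∂ν
      = ∫⁻ u in unitBall n, ∫⁻ w, ENNReal.ofReal (gap z w ^ l) * ENNReal.ofReal (gap u w ^ m) ∂ν := by
    intro ν _
    rw [← lintegral_lintegral_swap hmeas.aemeasurable]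
    congr 1; ext w
    rw [lintegral_const_mul _ (hmu w)]
  have hsplit : ∀ w : Cn n, ENNReal.ofReal (gap z w ^ l * (1 - ‖w‖ ^ 2) ^ (-t))
      = ENNReal.ofReal (gap z w ^ l) * ENNReal.ofReal ((1 - ‖w‖ ^ 2) ^ (-t)) := fun w =>
    ENNReal.ofReal_mul (Real.rpow_nonneg (gap_nonneg _ _) _)
  simp only [hsplit]
  -- The factor (1-|w|²)^(-t) is not the modulus of a holomorphic function. The lower Forelli–Rudin
  -- estimate replaces it by an average over u of |1 - u w̄|^(-(n+1+t)); for each fixed u the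
  -- integrand is |holomorphic|^p and the Carleson inequality applies. The upper estimate undoes the
  -- averaging.
  calc ∫⁻ w, ENNReal.ofReal (gap z w ^ l) * ENNReal.ofReal ((1 - ‖w‖ ^ 2) ^ (-t)) ∂μ
      ≤ ∫⁻ w, A₁ * (ENNReal.ofReal (gap z w ^ l) *
          (∫⁻ u in unitBall n, ENNReal.ofReal (gap u w ^ m))) ∂μ := by
        refine lintegral_mono_ae ?_
        filter_upwards [ae_norm_lt_one hμ.supported] with w hw
        rw [mul_left_comm]
        gcongr
        exact hA₁ w hw
    _ = A₁ * ∫⁻ u in unitBall n, ∫⁻ w,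
          ENNReal.ofReal (gap z w ^ l) * ENNReal.ofReal (gap u w ^ m) ∂μ := by
        rw [lintegral_const_mul' _ _ ENNReal.coe_ne_top, hfub]
    _ ≤ A₁ * ∫⁻ u in unitBall n, C ^ p.toReal * ∫⁻ w,
          ENNReal.ofReal (gap z w ^ l) * ENNReal.ofReal (gap u w ^ m) ∂vAlpha n α := by
        gcongr A₁ * ?_
        refine setLIntegral_mono' measurableSet_unitBall fun u hu => ?_
        have hu1 := mem_unitBall.1 hu
        have h := hμ.lintegral_le hp1 hp
          ((differentiableOn_one_sub_inner_cpow hz.le ((l / p.toReal : ℝ) : ℂ)).mul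
          (differentiableOn_one_sub_inner_cpow hu1.le ((m / p.toReal : ℝ) : ℂ)))
          (memLp_one_sub_inner_cpow_mul hn hα hz hu1 _ _)
        have e : ∀ w : Cn n, ‖(1 - inner ℂ z w : ℂ) ^ ((l / p.toReal : ℝ) : ℂ) *
            (1 - inner ℂ u w : ℂ) ^ ((m / p.toReal : ℝ) : ℂ)‖ₑ ^ p.toReal
            = ENNReal.ofReal (gap z w ^ l) * ENNReal.ofReal (gap u w ^ m) := fun w => by
          rw [enorm_cpow_mul_rpow hP, ← ENNReal.ofReal_mul (Real.rpow_nonneg (gap_nonneg _ _) _),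
            gap_comm z w, gap_comm u w, gap, gap]
        simpa only [Pi.mul_apply, e] using h
    _ = A₁ * (C ^ p.toReal * ∫⁻ w, ENNReal.ofReal (gap z w ^ l) *
          (∫⁻ u in unitBall n, ENNReal.ofReal (gap u w ^ m)) ∂vAlpha n α) := by
        rw [lintegral_const_mul' _ _ (ENNReal.rpow_ne_top_of_nonneg hP.le ENNReal.coe_ne_top), hfub]
    _ ≤ A₁ * (C ^ p.toReal * ∫⁻ w, A₂ * (ENNReal.ofReal (gap z w ^ l) *
          ENNReal.ofReal ((1 - ‖w‖ ^ 2) ^ (-t))) ∂vAlpha n α) := by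
        gcongr A₁ * (C ^ p.toReal * ?_)
        refine lintegral_mono_ae ?_
        filter_upwards [ae_norm_lt_one (vAlpha_compl_unitBall (n := n) (α := α))] with w hw
        rw [mul_left_comm (A₂ : ℝ≥0∞)]
        gcongr
        exact hA₂ w hw
    _ = _ := by
        rw [lintegral_const_mul' _ _ ENNReal.coe_ne_top]
        push_cast
        ring

/-- Schur's test. -/
theorem lintegral_schur_le {X Y : Type*} [MeasurableSpace X] [MeasurableSpace Y] {μ : Measure X}
    {ν : Measure Y} [SFinite μ] [SFinite ν] {P Q : ℝ} (hPQ : P.HolderConjugate Q)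
    {k : Y → X → ℝ≥0∞} (hk : Measurable (Function.uncurry k)) {h : X → ℝ≥0∞} {g : Y → ℝ≥0∞}
    (hh : Measurable h) (hg : Measurable g) (h0 : ∀ᵐ x ∂μ, h x ≠ 0) (htop : ∀ᵐ x ∂μ, h x ≠ ∞)
    {A B : ℝ≥0∞} (hA : ∀ᵐ y ∂ν, ∫⁻ x, k y x * h x ^ Q ∂μ ≤ A * g y ^ Q)
    (hB : ∀ᵐ x ∂μ, ∫⁻ y, k y x * g y ^ P ∂ν ≤ B * h x ^ P) {f : X → ℝ≥0∞} (hf : Measurable f) :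
    ∫⁻ y, (∫⁻ x, k y x * f x ∂μ) ^ P ∂ν ≤ A ^ (P / Q) * B * ∫⁻ x, f x ^ P ∂μ := by
  have hP := hPQ.pos
  have hQ := hPQ.symm.pos
  have hky : ∀ y, Measurable (k y) := fun y => hk.comp measurable_prodMk_left
  have hPQ1 : 1 / Q + 1 / P = 1 := by
    have := hPQ.inv_add_inv_eq_one
    rw [one_div, one_div, add_comm, this]
  have step1 : ∀ᵐ y ∂ν, (∫⁻ x, k y x * f x ∂μ) ^ P ≤
      A ^ (P / Q) * ∫⁻ x, g y ^ P * (k y x * (f x ^ P * (h x ^ P)⁻¹)) ∂μ := by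
    filter_upwards [hA] with y hy
    -- The kernel is split as k^(1/Q) k^(1/P) and the test function h is inserted and removed, ready
    -- for Hölder.
    have e1 : ∫⁻ x, k y x * f x ∂μ
        = ∫⁻ x, ((fun x => k y x ^ (1 / Q) * h x) * fun x => k y x ^ (1 / P) * (f x * (h x)⁻¹)) x ∂μ := by
      refine lintegral_congr_ae ?_
      filter_upwards [h0, htop] with x hx0 hxt
      rw [Pi.mul_apply]
      calc k y x * f x = k y x ^ (1 / Q + 1 / P) * f x * (h x * (h x)⁻¹) := by
            rw [hPQ1, ENNReal.rpow_one, ENNReal.mul_inv_cancel hx0 hxt, mul_one]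
        _ = _ := by
            rw [ENNReal.rpow_add_of_nonneg _ _ (by positivity) (by positivity)]; ring
    have e2 : ∀ x, (k y x ^ (1 / Q) * h x) ^ Q = k y x * h x ^ Q := fun x => by
      rw [ENNReal.mul_rpow_of_nonneg _ _ hQ.le, ← ENNReal.rpow_mul, one_div_mul_cancel hQ.ne',
        ENNReal.rpow_one]
    have e3 : ∀ x, (k y x ^ (1 / P) * (f x * (h x)⁻¹)) ^ P = k y x * (f x ^ P * (h x ^ P)⁻¹) :=
      fun x => by
      rw [ENNReal.mul_rpow_of_nonneg _ _ hP.le, ENNReal.mul_rpow_of_nonneg _ _ hP.le,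
        ← ENNReal.rpow_mul, one_div_mul_cancel hP.ne', ENNReal.rpow_one, ENNReal.inv_rpow]
    have m1 : Measurable fun x => k y x ^ (1 / Q) * h x := ((hky y).pow_const (1 / Q)).mul hh
    have m2 : Measurable fun x => k y x ^ (1 / P) * (f x * (h x)⁻¹) :=
      ((hky y).pow_const (1 / P)).mul (hf.mul hh.inv)
    have h2 := ENNReal.lintegral_mul_le_Lp_mul_Lq μ hPQ.symm m1.aemeasurable m2.aemeasurable
    rw [← e1] at h2
    simp only [e2, e3] at h2
    have h3 := ENNReal.rpow_le_rpow h2 hP.le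
    rw [ENNReal.mul_rpow_of_nonneg _ _ hP.le, ← ENNReal.rpow_mul, ← ENNReal.rpow_mul,
      one_div_mul_cancel hP.ne', ENNReal.rpow_one, one_div_mul_eq_div] at h3
    refine h3.trans ?_
    have hm : Measurable fun x => k y x * (f x ^ P * (h x ^ P)⁻¹) :=
      (hky y).mul ((hf.pow_const P).mul (hh.pow_const P).inv)
    rw [lintegral_const_mul _ hm, ← mul_assoc]
    gcongr
    calc (∫⁻ x, k y x * h x ^ Q ∂μ) ^ (P / Q) ≤ (A * g y ^ Q) ^ (P / Q) := by gcongr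
      _ = A ^ (P / Q) * g y ^ P := by
        rw [ENNReal.mul_rpow_of_nonneg _ _ (by positivity), ← ENNReal.rpow_mul,
          mul_div_cancel₀ _ hQ.ne']
  have hmm : Measurable (Function.uncurry fun y x => g y ^ P * (k y x * (f x ^ P * (h x ^ P)⁻¹))) :=
    ((hg.comp measurable_fst).pow_const P).mul (hk.mul
      (((hf.comp measurable_snd).pow_const P).mul ((hh.comp measurable_snd).pow_const P).inv))
  calc ∫⁻ y, (∫⁻ x, k y x * f x ∂μ) ^ P ∂ν
      ≤ ∫⁻ y, A ^ (P / Q) * ∫⁻ x, g y ^ P * (k y x * (f x ^ P * (h x ^ P)⁻¹)) ∂μ ∂ν :=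
        lintegral_mono_ae step1
    _ = A ^ (P / Q) * ∫⁻ x, ∫⁻ y, g y ^ P * (k y x * (f x ^ P * (h x ^ P)⁻¹)) ∂ν ∂μ := by
        have hmr : Measurable fun y => ∫⁻ x, g y ^ P * (k y x * (f x ^ P * (h x ^ P)⁻¹)) ∂μ :=
          hmm.lintegral_prod_right'
        rw [lintegral_const_mul _ hmr, lintegral_lintegral_swap hmm.aemeasurable]
    _ ≤ A ^ (P / Q) * ∫⁻ x, B * f x ^ P ∂μ := by
        gcongr A ^ (P / Q) * ?_
        refine lintegral_mono_ae ?_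
        filter_upwards [hB, h0, htop] with x hx hx0 hxt
        have hkx : Measurable fun y => k y x := hk.comp measurable_prodMk_right
        calc ∫⁻ y, g y ^ P * (k y x * (f x ^ P * (h x ^ P)⁻¹)) ∂ν
            = ∫⁻ y, (k y x * g y ^ P) * (f x ^ P * (h x ^ P)⁻¹) ∂ν := by
              congr 1; ext y; ring
          _ = (∫⁻ y, k y x * g y ^ P ∂ν) * (f x ^ P * (h x ^ P)⁻¹) :=
              lintegral_mul_const _ (hkx.mul (hg.pow_const P))
          _ ≤ (B * h x ^ P) * (f x ^ P * (h x ^ P)⁻¹) := by gcongr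
          _ = B * f x ^ P * (h x ^ P * (h x ^ P)⁻¹) := by ring
          _ = B * f x ^ P := by
              rw [ENNReal.mul_inv_cancel, mul_one]
              · simp [hx0, hxt]
              · simp [hx0, hxt]
    _ = _ := by rw [lintegral_const_mul _ (hf.pow_const P), mul_assoc]

/-- For a small `η > 0`, the integral operators with kernel `|K| cosh^{2η} β` are bounded from
`L^p(μ)` to `L^p_α`, uniformly in the Carleson measures `μ` with a given constant. -/
theorem exists_lintegral_wKernel_le (hn : 1 ≤ n) (hα : -1 < α) (hp1 : 1 < p) (hp : p < ∞) :
    ∃ η : ℝ, 0 < η ∧ ∀ C : ℝ≥0, ∃ A : ℝ≥0, ∀ μ : Measure (Cn n), IsCarlesonWith n α p C μ →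
      ∀ f : Cn n → ℝ≥0∞, Measurable f →
      ∫⁻ z, (∫⁻ w, ENNReal.ofReal (wKernel n α η z w) * f w ∂μ) ^ p.toReal ∂vAlpha n α
        ≤ A * ∫⁻ w, f w ^ p.toReal ∂μ := by
  set P := p.toReal with hP
  have hP1 : 1 < P := by
    rw [hP, ← ENNReal.toReal_one]
    exact (ENNReal.toReal_lt_toReal ENNReal.one_ne_top hp.ne).2 hp1
  set Q := Real.conjExponent P with hQ
  have hPQ : P.HolderConjugate Q := Real.HolderConjugate.conjExponent hP1
  have hQ1 : 1 < Q := hPQ.symm.lt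
  -- The Schur test function is (1-|w|²)^(-s). With s(P+Q) = (α+1)/2 and η = s/2, both t = sP and t
  -- = sQ satisfy η < t and η + t < α + 1.
  set s : ℝ := (α + 1) / (2 * (P + Q)) with hs
  have hs0 : 0 < s := div_pos (by linarith) (by linarith)
  have hsPQ : s * (2 * (P + Q)) = α + 1 := div_mul_cancel₀ _ (by linarith)
  set η : ℝ := s / 2 with hη
  have hη0 : 0 < η := by positivity
  obtain ⟨A₁, hA₁⟩ := lintegral_wKernel_vAlpha_le hn hα (η := η) (t := s * Q)
    (by nlinarith) (by nlinarith)
  obtain ⟨A₂, hA₂⟩ := lintegral_wKernel_vAlpha_le hn hα (η := η) (t := s * P)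
    (by nlinarith) (by nlinarith)
  obtain ⟨A₃, hA₃⟩ := IsCarlesonWith.lintegral_gap_rpow_le hn hα hp1 hp (t := η + s * Q)
    (by nlinarith)
  -- η is fixed before C. One exponent must serve both v_α, which has constant 1 and governs the
  -- Toeplitz operators, and μ, which has constant C.
  refine ⟨η, hη0, fun C => ⟨(A₃ * C ^ P * A₁) ^ (P / Q) * A₂, fun μ hμ f hf => ?_⟩⟩
  have := hμ.finite
  have := isFiniteMeasure_vAlpha hn hα
  have hwP : ∀ (R : ℝ) {w : Cn n}, 0 < R → ‖w‖ < 1 →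
      ENNReal.ofReal ((1 - ‖w‖ ^ 2) ^ (-s)) ^ R = ENNReal.ofReal ((1 - ‖w‖ ^ 2) ^ (-(s * R))) := by
    intro R w hR hw
    have pw := one_sub_sq_pos hw
    rw [ENNReal.ofReal_rpow_of_nonneg (by positivity) hR.le, ← Real.rpow_mul pw.le, neg_mul]
  have hhm : Measurable fun w : Cn n => ENNReal.ofReal ((1 - ‖w‖ ^ 2) ^ (-s)) :=
    (Measurable.pow_const (by fun_prop) _).ennreal_ofReal
  have hkm : Measurable (Function.uncurry fun z w : Cn n => ENNReal.ofReal (wKernel n α η z w)) :=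
    (measurable_wKernel η measurable_fst measurable_snd).ennreal_ofReal
  have hk0 : ∀ {z w : Cn n}, ‖z‖ < 1 → ‖w‖ < 1 → 0 ≤ wKernel n α η z w := fun hz hw =>
    mul_nonneg (Real.rpow_nonneg (gap_nonneg _ _) _) (Real.rpow_nonneg (coshSq_pos hz hw).le _)
  have hball := ae_norm_lt_one (vAlpha_compl_unitBall (n := n) (α := α))
  have hmul : ∀ (R : ℝ) {z w : Cn n}, 0 < R → ‖z‖ < 1 → ‖w‖ < 1 →
      ENNReal.ofReal (wKernel n α η z w) * ENNReal.ofReal ((1 - ‖w‖ ^ 2) ^ (-s)) ^ R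
        = ENNReal.ofReal (wKernel n α η z w * (1 - ‖w‖ ^ 2) ^ (-(s * R))) := fun R {z w} hR hz hw => by
    rw [hwP R hR hw, ENNReal.ofReal_mul (hk0 hz hw)]
  have key := lintegral_schur_le (μ := μ) (ν := vAlpha n α) hPQ hkm hhm hhm
    (A := A₃ * C ^ P * A₁) (B := A₂) ?_ ?_ ?_ ?_ hf
  · refine key.trans (le_of_eq ?_)
    have hPQ0 : 0 ≤ P / Q := by positivity
    push_cast
    rw [ENNReal.coe_rpow_of_nonneg _ hPQ0]
    push_cast
    rw [ENNReal.coe_rpow_of_nonneg _ (by linarith : 0 ≤ P)]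
  · filter_upwards [ae_norm_lt_one hμ.supported] with w hw
    have pw := one_sub_sq_pos hw
    simpa using Real.rpow_pos_of_pos pw (-s)
  · exact Filter.Eventually.of_forall fun _ => ENNReal.ofReal_ne_top
  · filter_upwards [hball] with z hz
    have pz := one_sub_sq_pos hz
    have htr : ∀ ν : Measure (Cn n), ν (unitBall n)ᶜ = 0 →
        ∫⁻ w, ENNReal.ofReal (wKernel n α η z w * (1 - ‖w‖ ^ 2) ^ (-(s * Q))) ∂ν
        = ENNReal.ofReal ((1 - ‖z‖ ^ 2) ^ (-η)) * ∫⁻ w, ENNReal.ofReal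
          (gap z w ^ (-(n + 1 + α - 2 * η)) * (1 - ‖w‖ ^ 2) ^ (-(η + s * Q))) ∂ν := by
      intro ν hν
      rw [← lintegral_const_mul' _ _ ENNReal.ofReal_ne_top]
      refine lintegral_congr_ae ?_
      filter_upwards [ae_norm_lt_one hν] with w hw
      rw [wKernel_mul_rpow η (s * Q) hz hw, ENNReal.ofReal_mul (by positivity)]
    calc ∫⁻ w, ENNReal.ofReal (wKernel n α η z w) * ENNReal.ofReal ((1 - ‖w‖ ^ 2) ^ (-s)) ^ Q ∂μ
        = ∫⁻ w, ENNReal.ofReal (wKernel n α η z w * (1 - ‖w‖ ^ 2) ^ (-(s * Q))) ∂μ := by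
          refine lintegral_congr_ae ?_
          filter_upwards [ae_norm_lt_one hμ.supported] with w hw
          exact hmul Q (by linarith) hz hw
      _ ≤ A₃ * C ^ P *
          ∫⁻ w, ENNReal.ofReal (wKernel n α η z w * (1 - ‖w‖ ^ 2) ^ (-(s * Q))) ∂vAlpha n α := by
          rw [htr μ hμ.supported, htr _ vAlpha_compl_unitBall, mul_left_comm]
          gcongr
          exact hA₃ hμ _ z hz
      _ ≤ A₃ * C ^ P * (A₁ * ENNReal.ofReal ((1 - ‖z‖ ^ 2) ^ (-(s * Q)))) := by
          gcongr
          exact hA₁ z hz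
      _ = _ := by rw [hwP Q (by linarith) hz, ← mul_assoc]
  · filter_upwards [ae_norm_lt_one hμ.supported] with w hw
    rw [hwP P (by linarith) hw]
    refine le_trans (le_of_eq ?_) (hA₂ w hw)
    refine lintegral_congr_ae ?_
    filter_upwards [hball] with z hz
    rw [wKernel_comm]
    exact hmul P (by linarith) hw hz

end

end BergmanBall

/-! ### The operators T_μ. -/

namespace BergmanBall

noncomputable section

variable {n : ℕ} {α : ℝ} {p : ℝ≥0∞} {C : ℝ≥0} {μ : Measure (Cn n)}

section Representatives

variable [Fact (1 ≤ p)]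

theorem exists_holomorphic_rep (f : Bergman n α p) :
    ∃ g : Cn n → ℂ, DifferentiableOn ℂ g (unitBall n) ∧ incl n α p f =ᵐ[vAlpha n α] g :=
  Subtype.property (p := fun x => x ∈ bergmanSubmodule n α p) f

theorem enorm_incl (f : Bergman n α p) : ‖incl n α p f‖ₑ = ‖f‖ₑ := rfl

theorem incl_injective : Function.Injective (incl n α p) := Subtype.val_injective

theorem norm_incl_comp_le (T : BergmanOp n α p) : ‖(incl n α p).comp T‖ ≤ ‖T‖ :=
  ContinuousLinearMap.opNorm_le_bound _ (norm_nonneg _) fun f => T.le_opNorm f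

end Representatives

/-- Holomorphic representatives are continuous and v_α charges every nonempty open subset of the
ball. Equality everywhere on the ball is needed because μ may be singular. -/
theorem eqOn_of_ae_eq (hα : -1 < α) {g₁ g₂ : Cn n → ℂ} (h₁ : DifferentiableOn ℂ g₁ (unitBall n))
    (h₂ : DifferentiableOn ℂ g₂ (unitBall n)) (h : g₁ =ᵐ[vAlpha n α] g₂) :
    Set.EqOn g₁ g₂ (unitBall n) :=
  Measure.eqOn_open_of_ae_eq (μ := volume)
    ((volume_restrict_absolutelyContinuous hα).ae_le h) Metric.isOpen_ball
    h₁.continuousOn h₂.continuousOn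

theorem aestronglyMeasurable_of_differentiableOn {g : Cn n → ℂ}
    (hg : DifferentiableOn ℂ g (unitBall n)) (hμ : μ (unitBall n)ᶜ = 0) :
    AEStronglyMeasurable g μ := by
  have h := hg.continuousOn.aestronglyMeasurable (μ := μ) measurableSet_unitBall
  have hmem : ∀ᵐ z ∂μ, z ∈ unitBall n := mem_ae_iff.2 hμ
  rwa [Measure.restrict_eq_self_of_ae_mem hmem] at h

theorem enorm_rpow_eq_lintegral [Fact (1 ≤ p)] (hp : p < ∞) (f : LpAlpha n α p) :
    ‖f‖ₑ ^ p.toReal = ∫⁻ z, ‖f z‖ₑ ^ p.toReal ∂vAlpha n α := by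
  have hp0 : p ≠ 0 := (zero_lt_one.trans_le Fact.out).ne'
  have hP : 0 < p.toReal := ENNReal.toReal_pos hp0 hp.ne
  rw [Lp.enorm_def, eLpNorm_eq_lintegral_rpow_enorm_toReal hp0 hp.ne, ← ENNReal.rpow_mul,
    one_div_mul_cancel hP.ne', ENNReal.rpow_one]

theorem norm_le_of_enorm_rpow_le {E F : Type*} [SeminormedAddCommGroup E]
    [SeminormedAddCommGroup F]
    {P : ℝ} (hP : 0 < P) {K : ℝ≥0} {x : E} {y : F} (h : ‖x‖ₑ ^ P ≤ K * ‖y‖ₑ ^ P) :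
    ‖x‖ ≤ (K ^ (1 / P) : ℝ≥0) * ‖y‖ := by
  have h1 := ENNReal.rpow_le_rpow h (one_div_nonneg.2 hP.le)
  rw [ENNReal.mul_rpow_of_nonneg _ _ (by positivity), ← ENNReal.rpow_mul, ← ENNReal.rpow_mul,
    mul_one_div_cancel hP.ne', ENNReal.rpow_one, ENNReal.rpow_one,
    ← ENNReal.coe_rpow_of_nonneg _ (by positivity), ← enorm_norm x, ← enorm_norm y] at h1
  have h2 := ENNReal.toReal_mono (by finiteness) h1
  simpa using h2

theorem norm_kernelInt_integrand (f : Cn n → ℂ) (z w : Cn n) :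
    ‖f w / (1 - inner ℂ w z) ^ ((n + 1 + α : ℝ) : ℂ)‖
      = gap z w ^ (-(n + 1 + α)) * ‖f w‖ := by
  rw [norm_div, Complex.norm_cpow_real, Real.rpow_neg (gap_nonneg _ _), gap, div_eq_inv_mul]

theorem aestronglyMeasurable_kernelInt_integrand {f : Cn n → ℂ} (hf : AEStronglyMeasurable f μ)
    (z : Cn n) : AEStronglyMeasurable
      (fun w => f w / (1 - inner ℂ w z) ^ ((n + 1 + α : ℝ) : ℂ)) μ := by
  have : Measurable fun w : Cn n => ((1 - inner ℂ w z : ℂ) ^ ((n + 1 + α : ℝ) : ℂ))⁻¹ :=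
    ((measurable_const.sub (measurable_id.inner measurable_const)).pow_const _).inv
  simp only [div_eq_mul_inv]
  exact hf.mul this.aestronglyMeasurable

theorem integrable_kernelInt_integrand {f : Cn n → ℂ} (hf : Integrable f μ)
    (hμ : μ (unitBall n)ᶜ = 0) {z : Cn n} (hz : ‖z‖ < 1) :
    Integrable (fun w => f w / (1 - inner ℂ w z) ^ ((n + 1 + α : ℝ) : ℂ)) μ := by
  refine (hf.norm.const_mul ((1 - ‖z‖) ^ (-(n + 1 + α)) + 2 ^ (-(n + 1 + α)))).mono'
    (aestronglyMeasurable_kernelInt_integrand hf.1 z) ?_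
  filter_upwards [ae_norm_lt_one hμ] with w hw
  rw [norm_kernelInt_integrand]
  gcongr
  exact rpow_le_of_mem_Icc (by linarith) (one_sub_norm_le_gap hw.le) (gap_le_two hz.le hw.le)

theorem differentiableOn_kernelInt {f : Cn n → ℂ} (hf : Integrable f μ)
    (hμ : μ (unitBall n)ᶜ = 0) : DifferentiableOn ℂ (kernelInt n α μ f) (unitBall n) := by
  intro z₀ hz₀
  have hz₀' := mem_unitBall.1 hz₀
  set c : ℝ := n + 1 + α with hc
  -- On |z| < r the gap to any w in the ball is at least 1 - r, which gives a dominating function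
  -- for differentiation under the integral.
  set r : ℝ := (1 + ‖z₀‖) / 2 with hr
  have hr1 : r < 1 := by linarith
  have hz₀r : ‖z₀‖ < r := by linarith
  let F' : Cn n → Cn n → (Cn n →L[ℂ] ℂ) := fun z w =>
    (f w * (((-c : ℝ) : ℂ) * (1 - inner ℂ w z : ℂ) ^ ((-c - 1 : ℝ) : ℂ))) • (-(innerSL ℂ w))
  refine (HasFDerivAt.differentiableAt (f' := ∫ w, F' z₀ w ∂μ) ?_).differentiableWithinAt
  unfold kernelInt
  refine hasFDerivAt_integral_of_dominated_of_fderiv_le (s := {z : Cn n | ‖z‖ < r})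
    (bound := fun w => ‖f w‖ * (|-c| * ((1 - r) ^ (-c - 1) + 2 ^ (-c - 1)))) (F' := F')
    ((isOpen_lt continuous_norm continuous_const).mem_nhds hz₀r)
    (Filter.Eventually.of_forall fun z => aestronglyMeasurable_kernelInt_integrand hf.1 z)
    (integrable_kernelInt_integrand hf hμ hz₀') ?_ ?_ (hf.norm.mul_const _) ?_
  · refine AEStronglyMeasurable.smul (hf.1.mul ?_) ?_
    · have : Measurable fun w : Cn n =>
          (((-c : ℝ) : ℂ) * (1 - inner ℂ w z₀ : ℂ) ^ ((-c - 1 : ℝ) : ℂ)) :=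
        ((measurable_const.sub (measurable_id.inner measurable_const)).pow_const _).const_mul _
      exact this.aestronglyMeasurable
    · exact ((innerSL ℂ : Cn n →L⋆[ℂ] Cn n →L[ℂ] ℂ).continuous.neg).aestronglyMeasurable
  · filter_upwards [ae_norm_lt_one hμ] with w hw z hz
    have hz' : ‖z‖ < r := hz
    rw [norm_smul, norm_neg, innerSL_apply_norm, norm_mul, norm_mul, Complex.norm_real,
      Complex.norm_cpow_real, Real.norm_eq_abs]
    have h1 : ‖(1 - inner ℂ w z : ℂ)‖ ^ (-c - 1) ≤ (1 - r) ^ (-c - 1) + 2 ^ (-c - 1) := by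
      refine rpow_le_of_mem_Icc (by linarith) ?_ (gap_le_two (z := z) (w := w) (by linarith) hw.le)
      exact le_trans (by linarith) (one_sub_norm_le_gap (z := z) hw.le)
    calc _ ≤ ‖f w‖ * (|-c| * ‖(1 - inner ℂ w z : ℂ)‖ ^ (-c - 1)) * 1 := by gcongr
      _ ≤ _ := by rw [mul_one]; gcongr
  · filter_upwards [ae_norm_lt_one hμ] with w hw z hz
    have hz' : ‖z‖ < r := hz
    have hre := re_one_sub_inner_pos (z := w) (w := z) hw.le (by linarith)
    have h1 : HasFDerivAt (fun z : Cn n => (1 - inner ℂ w z : ℂ)) (-(innerSL ℂ w)) z := by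
      have := (hasFDerivAt_const (1 : ℂ) z).sub (innerSL ℂ w).hasFDerivAt
      rw [zero_sub] at this
      exact this
    have h2 := (hasDerivAt_id (1 - inner ℂ w z : ℂ)).cpow_const (c := ((-c : ℝ) : ℂ)) (Or.inl hre)
    have h3 := (h2.comp_hasFDerivAt z h1).const_mul (f w)
    have e1 : (fun z : Cn n => f w / (1 - inner ℂ w z) ^ ((n + 1 + α : ℝ) : ℂ))
        = fun z => f w * ((fun x : ℂ => id x ^ ((-c : ℝ) : ℂ)) ∘ fun z => 1 - inner ℂ w z) z := by
      ext z
      simp only [Function.comp_apply, id_eq, Complex.ofReal_neg, Complex.cpow_neg, div_eq_mul_inv,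
        ← hc]
    rw [e1]
    refine h3.congr_fderiv ?_
    simp only [F', id_eq, mul_one, smul_smul]
    push_cast
    rfl

theorem one_le_four_mul_coshSq {z w : Cn n} (hz : ‖z‖ < 1) (hw : ‖w‖ < 1) :
    1 ≤ 4 * coshSq z w := by
  have pz := one_sub_sq_pos hz
  have pw := one_sub_sq_pos hw
  have h1 := one_sub_sq_le_gap hz.le hw.le
  have h2 := one_sub_sq_le_gap hw.le hz.le
  rw [gap_comm] at h2
  rw [coshSq, mul_div_assoc', one_le_div (by positivity)]
  nlinarith

theorem rpow_gap_le_wKernel {η : ℝ} (hη : 0 ≤ η) {z w : Cn n} (hz : ‖z‖ < 1) (hw : ‖w‖ < 1) :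
    gap z w ^ (-(n + 1 + α)) ≤ 4 ^ η * wKernel n α η z w := by
  have h := Real.one_le_rpow (one_le_four_mul_coshSq hz hw) hη
  rw [Real.mul_rpow (by norm_num) (coshSq_pos hz hw).le] at h
  rw [wKernel, mul_left_comm]
  exact le_mul_of_one_le_right (Real.rpow_nonneg (gap_nonneg _ _) _) h

theorem enorm_kernelInt_le (f : Cn n → ℂ) (z : Cn n) :
    ‖kernelInt n α μ f z‖ₑ ≤ ∫⁻ w, ENNReal.ofReal (gap z w ^ (-(n + 1 + α))) * ‖f w‖ₑ ∂μ := by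
  refine (enorm_integral_le_lintegral_enorm _).trans (le_of_eq ?_)
  congr 1; ext w
  rw [← ofReal_norm, norm_kernelInt_integrand,
    ENNReal.ofReal_mul (Real.rpow_nonneg (gap_nonneg _ _) _), ofReal_norm]

theorem enorm_kernelInt_le_wKernel {η : ℝ} (hη : 0 ≤ η) (hμ : μ (unitBall n)ᶜ = 0) (f : Cn n → ℂ)
    {z : Cn n} (hz : ‖z‖ < 1) : ‖kernelInt n α μ f z‖ₑ ≤
      ENNReal.ofReal (4 ^ η) * ∫⁻ w, ENNReal.ofReal (wKernel n α η z w) * ‖f w‖ₑ ∂μ := by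
  refine (enorm_kernelInt_le f z).trans ?_
  rw [← lintegral_const_mul' _ _ ENNReal.ofReal_ne_top]
  refine lintegral_mono_ae ?_
  filter_upwards [ae_norm_lt_one hμ] with w hw
  rw [← mul_assoc, ← ENNReal.ofReal_mul (by positivity)]
  gcongr
  exact rpow_gap_le_wKernel hη hz hw

/-- The integral operators with kernel `|K| cosh^{2η} β` are bounded from `L^p(μ)` to `L^p_α`
with a constant `A`, for all Carleson measures `μ` with constant `C`. -/
def KernelBound (n : ℕ) (α : ℝ) (p : ℝ≥0∞) (η : ℝ) (C A : ℝ≥0) : Prop :=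
  ∀ μ : Measure (Cn n), IsCarlesonWith n α p C μ → ∀ f : Cn n → ℝ≥0∞, Measurable f →
    ∫⁻ z, (∫⁻ w, ENNReal.ofReal (wKernel n α η z w) * f w ∂μ) ^ p.toReal ∂vAlpha n α
      ≤ A * ∫⁻ w, f w ^ p.toReal ∂μ

theorem KernelBound.aemeasurable {η : ℝ} {A : ℝ≥0} (h : KernelBound n α p η C A)
    (hμ : IsCarlesonWith n α p C μ) {f : Cn n → ℝ≥0∞} (hf : AEMeasurable f μ) :
    ∫⁻ z, (∫⁻ w, ENNReal.ofReal (wKernel n α η z w) * f w ∂μ) ^ p.toReal ∂vAlpha n α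
      ≤ A * ∫⁻ w, f w ^ p.toReal ∂μ := by
  have h1 := h μ hμ (hf.mk f) hf.measurable_mk
  have e1 : ∫⁻ w, hf.mk f w ^ p.toReal ∂μ = ∫⁻ w, f w ^ p.toReal ∂μ := by
    refine lintegral_congr_ae ?_
    filter_upwards [hf.ae_eq_mk] with w hw
    rw [hw]
  have e2 : ∀ z, ∫⁻ w, ENNReal.ofReal (wKernel n α η z w) * hf.mk f w ∂μ
      = ∫⁻ w, ENNReal.ofReal (wKernel n α η z w) * f w ∂μ := fun z => by
    refine lintegral_congr_ae ?_
    filter_upwards [hf.ae_eq_mk] with w hw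
    rw [hw]
  simpa only [e1, e2] using h1

theorem IsCarlesonWith.memLp (hμ : IsCarlesonWith n α p C μ) {g : Cn n → ℂ}
    (hg : DifferentiableOn ℂ g (unitBall n)) (hgp : MemLp g p (vAlpha n α)) : MemLp g p μ :=
  ⟨aestronglyMeasurable_of_differentiableOn hg hμ.supported,
    (hμ.embedding g hg hgp).trans_lt (ENNReal.mul_lt_top ENNReal.coe_lt_top hgp.2)⟩

theorem lintegral_enorm_kernelInt_le {η : ℝ} {A : ℝ≥0} (hη : 0 ≤ η)
    (hA : KernelBound n α p η C A) (hμ : IsCarlesonWith n α p C μ) {g : Cn n → ℂ}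
    (hg : AEStronglyMeasurable g μ) :
    ∫⁻ z, ‖kernelInt n α μ g z‖ₑ ^ p.toReal ∂vAlpha n α ≤
      ENNReal.ofReal (4 ^ η) ^ p.toReal * A * ∫⁻ w, ‖g w‖ₑ ^ p.toReal ∂μ := by
  have hP : 0 ≤ p.toReal := ENNReal.toReal_nonneg
  calc _ ≤ ∫⁻ z, ENNReal.ofReal (4 ^ η) ^ p.toReal *
        (∫⁻ w, ENNReal.ofReal (wKernel n α η z w) * ‖g w‖ₑ ∂μ) ^ p.toReal ∂vAlpha n α := by
        refine lintegral_mono_ae ?_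
        filter_upwards [ae_norm_lt_one (vAlpha_compl_unitBall (n := n) (α := α))] with z hz
        rw [← ENNReal.mul_rpow_of_nonneg _ _ hP]
        gcongr
        exact enorm_kernelInt_le_wKernel hη hμ.supported g hz
    _ = ENNReal.ofReal (4 ^ η) ^ p.toReal * ∫⁻ z,
        (∫⁻ w, ENNReal.ofReal (wKernel n α η z w) * ‖g w‖ₑ ∂μ) ^ p.toReal ∂vAlpha n α :=
        lintegral_const_mul' _ _ (ENNReal.rpow_ne_top_of_nonneg hP ENNReal.ofReal_ne_top)
    _ ≤ _ := by
        rw [mul_assoc]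
        gcongr
        exact hA.aemeasurable hμ hg.enorm

/-- For a Carleson measure `μ` the operator `T_μ` is bounded on `A^p_α`; its norm is controlled
by the norm of `L^p(μ)`. -/
theorem exists_isToeplitzMeasure [Fact (1 ≤ p)] (hα : -1 < α) (hp1 : 1 < p) (hp : p < ∞)
    {η : ℝ} {A : ℝ≥0} (hη : 0 ≤ η) (hA : KernelBound n α p η C A)
    (hμ : IsCarlesonWith n α p C μ) :
    ∃ T : BergmanOp n α p, IsToeplitzMeasure n α p μ T ∧
      ∀ (f : Bergman n α p) (g : Cn n → ℂ), DifferentiableOn ℂ g (unitBall n) →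
        incl n α p f =ᵐ[vAlpha n α] g → ‖T f‖ₑ ^ p.toReal ≤
          ENNReal.ofReal (4 ^ η) ^ p.toReal * A * ∫⁻ w, ‖g w‖ₑ ^ p.toReal ∂μ := by
  have hp0 : p ≠ 0 := (zero_lt_one.trans hp1).ne'
  have hP : 0 < p.toReal := ENNReal.toReal_pos hp0 hp.ne
  have := hμ.finite
  choose rep hrep hrepae using fun f : Bergman n α p => exists_holomorphic_rep f
  have hmem : ∀ (f : Bergman n α p) (g : Cn n → ℂ), incl n α p f =ᵐ[vAlpha n α] g →
      MemLp g p (vAlpha n α) := fun f g h => (memLp_congr_ae h).1 (Lp.memLp (incl n α p f))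
  have hrepμ : ∀ f, MemLp (rep f) p μ := fun f => hμ.memLp (hrep f) (hmem f _ (hrepae f))
  have hint : ∀ f, Integrable (rep f) μ := fun f => (hrepμ f).integrable hp1.le
  have hdiff : ∀ f, DifferentiableOn ℂ (kernelInt n α μ (rep f)) (unitBall n) := fun f =>
    differentiableOn_kernelInt (hint f) hμ.supported
  have hbd : ∀ f, ∫⁻ z, ‖kernelInt n α μ (rep f) z‖ₑ ^ p.toReal ∂vAlpha n α ≤
      ENNReal.ofReal (4 ^ η) ^ p.toReal * A * ∫⁻ w, ‖rep f w‖ₑ ^ p.toReal ∂μ := fun f =>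
    lintegral_enorm_kernelInt_le hη hA hμ (hrepμ f).1
  have hc : ENNReal.ofReal (4 ^ η) ^ p.toReal ≠ ∞ :=
    ENNReal.rpow_ne_top_of_nonneg hP.le ENNReal.ofReal_ne_top
  have hLp : ∀ f, MemLp (kernelInt n α μ (rep f)) p (vAlpha n α) := fun f => by
    refine ⟨aestronglyMeasurable_of_differentiableOn (hdiff f) vAlpha_compl_unitBall, ?_⟩
    rw [eLpNorm_lt_top_iff_lintegral_rpow_enorm_lt_top hp0 hp.ne]
    refine (hbd f).trans_lt (ENNReal.mul_lt_top (ENNReal.mul_lt_top hc.lt_top ENNReal.coe_lt_top) ?_)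
    exact (eLpNorm_lt_top_iff_lintegral_rpow_enorm_lt_top hp0 hp.ne).1 (hrepμ f).2
  let T₀ : Bergman n α p → Bergman n α p := fun f =>
    (⟨(hLp f).toLp, kernelInt n α μ (rep f), hdiff f, (hLp f).coeFn_toLp⟩ : bergmanSubmodule n α p)
  have hT₀ : ∀ f, incl n α p (T₀ f) =ᵐ[vAlpha n α] kernelInt n α μ (rep f) := fun f =>
    (hLp f).coeFn_toLp
  have hcongr : ∀ {g₁ g₂ : Cn n → ℂ}, Set.EqOn g₁ g₂ (unitBall n) →
      kernelInt n α μ g₁ = kernelInt n α μ g₂ := fun {g₁ g₂} h => by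
    ext z
    refine integral_congr_ae ?_
    filter_upwards [ae_norm_lt_one hμ.supported] with w hw
    rw [h (mem_unitBall.2 hw)]
  -- Independence of the chosen representative is what yields linearity: the representative of a sum
  -- need not be the sum of the chosen ones.
  have hTrep : ∀ (f : Bergman n α p) (g : Cn n → ℂ), DifferentiableOn ℂ g (unitBall n) →
      incl n α p f =ᵐ[vAlpha n α] g → incl n α p (T₀ f) =ᵐ[vAlpha n α] kernelInt n α μ g := by
    intro f g hg hfg
    rw [← hcongr (eqOn_of_ae_eq hα (hrep f) hg ((hrepae f).symm.trans hfg))]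
    exact hT₀ f
  have hball := ae_norm_lt_one (vAlpha_compl_unitBall (n := n) (α := α))
  let T₁ : Bergman n α p →ₗ[ℂ] Bergman n α p :=
    { toFun := T₀
      map_add' := fun f g => by
        apply incl_injective
        rw [map_add]
        apply Lp.ext
        have h1 := hTrep (f + g) (rep f + rep g) ((hrep f).add (hrep g)) (by
          rw [map_add]
          exact (Lp.coeFn_add _ _).trans ((hrepae f).add (hrepae g)))
        filter_upwards [h1, hT₀ f, hT₀ g, Lp.coeFn_add (incl n α p (T₀ f)) (incl n α p (T₀ g)),
          hball] with z e1 e2 e3 e4 hz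
        rw [e1, e4, Pi.add_apply, e2, e3, kernelInt, kernelInt, kernelInt,
          ← integral_add (integrable_kernelInt_integrand (hint f) hμ.supported hz)
            (integrable_kernelInt_integrand (hint g) hμ.supported hz)]
        congr 1; ext w
        rw [Pi.add_apply, add_div]
      map_smul' := fun c f => by
        apply incl_injective
        rw [RingHom.id_apply, map_smul]
        apply Lp.ext
        have h1 := hTrep (c • f) (c • rep f) ((hrep f).const_smul c) (by
          rw [map_smul]
          exact (Lp.coeFn_smul _ _).trans ((hrepae f).const_smul c))
        filter_upwards [h1, hT₀ f, Lp.coeFn_smul c (incl n α p (T₀ f))] with z e1 e2 e3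
        rw [e1, e3, Pi.smul_apply, e2, kernelInt, kernelInt, ← integral_smul]
        congr 1; ext w
        rw [Pi.smul_apply, smul_eq_mul, smul_eq_mul, mul_div_assoc] }
  -- The right side keeps the integral against μ instead of ‖f‖^p. Applied to restrictions of μ to
  -- the sets G_j, these integrals can be summed over j.
  have hbound : ∀ (f : Bergman n α p) (g : Cn n → ℂ), DifferentiableOn ℂ g (unitBall n) →
      incl n α p f =ᵐ[vAlpha n α] g → ‖T₀ f‖ₑ ^ p.toReal ≤
        ENNReal.ofReal (4 ^ η) ^ p.toReal * A * ∫⁻ w, ‖g w‖ₑ ^ p.toReal ∂μ := by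
    intro f g hg hfg
    rw [← enorm_incl, enorm_rpow_eq_lintegral hp]
    refine le_trans (le_of_eq (lintegral_congr_ae ?_))
      (lintegral_enorm_kernelInt_le hη hA hμ (hμ.memLp hg (hmem f g hfg)).1)
    filter_upwards [hTrep f g hg hfg] with z hz
    rw [hz]
  refine ⟨T₁.mkContinuous
    (((ENNReal.ofReal (4 ^ η) ^ p.toReal).toNNReal * A * C ^ p.toReal) ^ (1 / p.toReal) : ℝ≥0)
    fun f => norm_le_of_enorm_rpow_le hP ?_, fun f g hg hfg => hTrep f g hg hfg,
    fun f g hg hfg => hbound f g hg hfg⟩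
  refine (hbound f (rep f) (hrep f) (hrepae f)).trans ?_
  push_cast
  rw [ENNReal.coe_toNNReal hc, mul_assoc _ ((C ^ p.toReal : ℝ≥0) : ℝ≥0∞),
    ENNReal.coe_rpow_of_nonneg _ hP.le]
  gcongr
  refine (hμ.lintegral_le hp1 hp (hrep f) (hmem f _ (hrepae f))).trans (le_of_eq ?_)
  rw [← enorm_incl f, enorm_rpow_eq_lintegral hp]
  congr 1
  refine lintegral_congr_ae ?_
  filter_upwards [hrepae f] with w hw
  rw [hw]

end

end BergmanBall

/-! ### Operators dominated by localized positive kernels. -/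

namespace BergmanBall

noncomputable section

open ProbabilityTheory

variable {n : ℕ} {α : ℝ} {p : ℝ≥0∞} {η : ℝ}

/-- The weight `cosh^{2η} β`. -/
def coshWeight (η : ℝ) (z w : Cn n) : ℝ≥0∞ := ENNReal.ofReal (coshSq z w ^ η)

theorem measurable_coshWeight {X : Type*} [MeasurableSpace X] {f g : X → Cn n} (hf : Measurable f)
    (hg : Measurable g) : Measurable fun x => coshWeight η (f x) (g x) :=
  ((measurable_coshSq hf hg).pow_const η).ennreal_ofReal

theorem coshWeight_mul_le (hη : 0 ≤ η) {z u w : Cn n} (hz : ‖z‖ < 1) (hu : ‖u‖ < 1) (hw : ‖w‖ < 1) :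
    coshWeight η z w ≤ ENNReal.ofReal (256 ^ η) * (coshWeight η z u * coshWeight η u w) := by
  have h1 := coshSq_pos hz hu
  have h2 := coshSq_pos hu hw
  rw [coshWeight, coshWeight, coshWeight, ← ENNReal.ofReal_mul (by positivity),
    ← ENNReal.ofReal_mul (by positivity), ← Real.mul_rpow h1.le h2.le,
    ← Real.mul_rpow (by norm_num) (by positivity)]
  exact ENNReal.ofReal_le_ofReal
    (Real.rpow_le_rpow (coshSq_pos hz hw).le (coshSq_mul hz hu hw) hη)

theorem ofReal_wKernel_eq {z w : Cn n} : ENNReal.ofReal (wKernel n α η z w)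
    = ENNReal.ofReal (gap z w ^ (-(n + 1 + α))) * coshWeight η z w := by
  rw [wKernel, ENNReal.ofReal_mul (Real.rpow_nonneg (gap_nonneg _ _) _), coshWeight]

/-- The kernel `κ` does not charge `v_α`-null sets and, weighted by `cosh^{2η} β`, is bounded on
`L^p_α`. -/
structure IsLocalKernel (n : ℕ) (α : ℝ) (p : ℝ≥0∞) (η : ℝ) (A : ℝ≥0)
    (κ : Kernel (Cn n) (Cn n)) : Prop where
  sfinite : IsSFiniteKernel κ
  null : ∀ N : Set (Cn n), vAlpha n α N = 0 → ∀ᵐ z ∂vAlpha n α, κ z N = 0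
  bound : ∀ h : Cn n → ℝ≥0∞, Measurable h →
    ∫⁻ z, (∫⁻ w, coshWeight η z w * h w ∂κ z) ^ p.toReal ∂vAlpha n α
      ≤ A * ∫⁻ w, h w ^ p.toReal ∂vAlpha n α

/-- The operator `S` is dominated by a positive kernel that remains bounded on `L^p_α` when it is
multiplied by a power of `cosh² β`. -/
def IsDominated [Fact (1 ≤ p)] (η : ℝ) (S : BergmanOp n α p) : Prop :=
  ∃ (κ : Kernel (Cn n) (Cn n)) (A : ℝ≥0), IsLocalKernel n α p η A κ ∧
    ∀ g : Bergman n α p, ∀ᵐ z ∂vAlpha n α, ‖incl n α p (S g) z‖ₑ ≤ ∫⁻ w, ‖incl n α p g w‖ₑ ∂κ z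

theorem IsLocalKernel.ae_ae {A : ℝ≥0} {κ : Kernel (Cn n) (Cn n)} (hκ : IsLocalKernel n α p η A κ)
    {q : Cn n → Prop} (hq : ∀ᵐ w ∂vAlpha n α, q w) : ∀ᵐ z ∂vAlpha n α, ∀ᵐ w ∂κ z, q w :=
  hκ.null _ hq

theorem IsLocalKernel.add {A B : ℝ≥0} {κ κ' : Kernel (Cn n) (Cn n)} (hp1 : 1 < p) (hp : p < ∞)
    (hκ : IsLocalKernel n α p η A κ) (hκ' : IsLocalKernel n α p η B κ') :
    IsLocalKernel n α p η (2 ^ (p.toReal - 1) * (A + B)) (κ + κ') := by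
  have := hκ.sfinite
  have := hκ'.sfinite
  have hP : 1 ≤ p.toReal := by
    rw [← ENNReal.toReal_one]
    exact ENNReal.toReal_mono hp.ne hp1.le
  refine ⟨inferInstance, fun N hN => ?_, fun h hh => ?_⟩
  · filter_upwards [hκ.null N hN, hκ'.null N hN] with z h1 h2
    rw [FunLike.coe_add, Pi.add_apply, Measure.add_apply, h1, h2, add_zero]
  · have hm : Measurable (Function.uncurry fun z w : Cn n => coshWeight η z w * h w) :=
      (measurable_coshWeight measurable_fst measurable_snd).mul (hh.comp measurable_snd)
    have hm1 : Measurable fun z => ∫⁻ w, coshWeight η z w * h w ∂κ z :=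
      hm.lintegral_kernel_prod_right
    calc ∫⁻ z, (∫⁻ w, coshWeight η z w * h w ∂(κ + κ') z) ^ p.toReal ∂vAlpha n α
        ≤ ∫⁻ z, 2 ^ (p.toReal - 1) * ((∫⁻ w, coshWeight η z w * h w ∂κ z) ^ p.toReal
            + (∫⁻ w, coshWeight η z w * h w ∂κ' z) ^ p.toReal) ∂vAlpha n α := by
          refine lintegral_mono fun z => ?_
          rw [FunLike.coe_add, Pi.add_apply, lintegral_add_measure]
          exact ENNReal.rpow_add_le_mul_rpow_add_rpow _ _ hP
      _ = 2 ^ (p.toReal - 1) * (∫⁻ z, (∫⁻ w, coshWeight η z w * h w ∂κ z) ^ p.toReal ∂vAlpha n α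
            + ∫⁻ z, (∫⁻ w, coshWeight η z w * h w ∂κ' z) ^ p.toReal ∂vAlpha n α) := by
          rw [lintegral_const_mul' _ _ (by finiteness), lintegral_add_left (hm1.pow_const _)]
      _ ≤ 2 ^ (p.toReal - 1) * (A * ∫⁻ w, h w ^ p.toReal ∂vAlpha n α
            + B * ∫⁻ w, h w ^ p.toReal ∂vAlpha n α) := by
          gcongr
          · exact hκ.bound h hh
          · exact hκ'.bound h hh
      _ = _ := by
          push_cast
          rw [ENNReal.coe_rpow_of_nonneg _ (by linarith)]
          push_cast
          ring

/-- By submultiplicativity the weight between z and w is shared between the two factors at each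
intermediate point u, so the two weighted bounds apply one after the other. The null-set condition
ensures that the intermediate points lie in the ball almost surely. -/
theorem IsLocalKernel.comp {A B : ℝ≥0} {κ κ' : Kernel (Cn n) (Cn n)} (hη : 0 ≤ η)
    (hκ : IsLocalKernel n α p η A κ) (hκ' : IsLocalKernel n α p η B κ') :
    IsLocalKernel n α p η ((256 ^ η : ℝ).toNNReal ^ p.toReal * A * B) (κ'.comp κ) := by
  have := hκ.sfinite
  have := hκ'.sfinite
  have hP : 0 ≤ p.toReal := ENNReal.toReal_nonneg
  have hball := ae_norm_lt_one (vAlpha_compl_unitBall (n := n) (α := α))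
  refine ⟨inferInstance, fun N hN => ?_, fun h hh => ?_⟩
  · obtain ⟨N', hNN', hN'm, hN'⟩ := exists_measurable_superset_of_null hN
    have h := hκ.ae_ae (q := fun u => κ' u N' = 0) (hκ'.null N' hN')
    refine h.mono fun z hz => ?_
    have e : (κ'.comp κ) z N' = ∫⁻ u, κ' u N' ∂κ z := Kernel.comp_apply' κ' κ z hN'm
    have e0 : ∫⁻ u, κ' u N' ∂κ z = 0 := by
      rw [lintegral_congr_ae (g := fun _ => 0) hz, lintegral_zero]
    exact measure_mono_null hNN' (e.trans e0)
  · have hm : Measurable (Function.uncurry fun z w : Cn n => coshWeight η z w * h w) :=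
      (measurable_coshWeight measurable_fst measurable_snd).mul (hh.comp measurable_snd)
    have hm1 : Measurable fun z => ∫⁻ w, coshWeight η z w * h w ∂κ' z :=
      hm.lintegral_kernel_prod_right
    have hmz : ∀ z, Measurable fun w : Cn n => coshWeight η z w * h w := fun z =>
      (measurable_coshWeight measurable_const measurable_id).mul hh
    calc ∫⁻ z, (∫⁻ w, coshWeight η z w * h w ∂(κ'.comp κ) z) ^ p.toReal ∂vAlpha n α
        ≤ ∫⁻ z, (ENNReal.ofReal (256 ^ η) * ∫⁻ u, coshWeight η z u *
            (∫⁻ w, coshWeight η u w * h w ∂κ' u) ∂κ z) ^ p.toReal ∂vAlpha n α := by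
          refine lintegral_mono_ae ?_
          have hb1 : ∀ᵐ z ∂vAlpha n α, ∀ᵐ u ∂κ z, ‖u‖ < 1 := hκ.ae_ae hball
          have hb2 : ∀ᵐ z ∂vAlpha n α, ∀ᵐ u ∂κ z, ∀ᵐ w ∂κ' u, ‖w‖ < 1 :=
            hκ.ae_ae (hκ'.ae_ae hball)
          filter_upwards [hball, hb1, hb2] with z hz h1 h2
          refine ENNReal.rpow_le_rpow ?_ hP
          rw [Kernel.lintegral_comp _ _ _ (hmz z), ← lintegral_const_mul' _ _ ENNReal.ofReal_ne_top]
          refine lintegral_mono_ae ?_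
          filter_upwards [h1, h2] with u hu h3
          rw [← lintegral_const_mul _ (hmz u), ← lintegral_const_mul _ ((hmz u).const_mul _)]
          refine lintegral_mono_ae ?_
          filter_upwards [h3] with w hw
          calc coshWeight η z w * h w
              ≤ ENNReal.ofReal (256 ^ η) * (coshWeight η z u * coshWeight η u w) * h w := by
                gcongr
                exact coshWeight_mul_le hη hz hu hw
            _ = _ := by ring
      _ = ENNReal.ofReal (256 ^ η) ^ p.toReal * ∫⁻ z, (∫⁻ u, coshWeight η z u *
            (∫⁻ w, coshWeight η u w * h w ∂κ' u) ∂κ z) ^ p.toReal ∂vAlpha n α := by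
          rw [← lintegral_const_mul' _ _ (ENNReal.rpow_ne_top_of_nonneg hP ENNReal.ofReal_ne_top)]
          simp_rw [ENNReal.mul_rpow_of_nonneg _ _ hP]
      _ ≤ ENNReal.ofReal (256 ^ η) ^ p.toReal * (A * (B * ∫⁻ w, h w ^ p.toReal ∂vAlpha n α)) := by
          gcongr
          exact (hκ.bound _ hm1).trans (by gcongr; exact hκ'.bound h hh)
      _ = _ := by
          push_cast
          rw [ENNReal.coe_rpow_of_nonneg _ hP, ENNReal.ofReal]
          ring

/-- The kernel is c times the Dirac mass at z, where the weight is coshSq(z,z)^η = 1. Scalars belong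
to the generated algebra and have no density, which is why domination is formulated with
measure-valued kernels. -/
theorem isLocalKernel_scalar (c : ℝ≥0) :
    IsLocalKernel n α p η (c ^ p.toReal)
      (Kernel.withDensity (Kernel.id : Kernel (Cn n) (Cn n)) fun _ _ => (c : ℝ≥0∞)) := by
  have hP : 0 ≤ p.toReal := ENNReal.toReal_nonneg
  have hmc : Measurable (Function.uncurry fun _ _ : Cn n => (c : ℝ≥0∞)) := measurable_const
  refine ⟨Kernel.IsSFiniteKernel.withDensity _ fun _ _ => ENNReal.coe_ne_top,
    fun N hN => ?_, fun h hh => ?_⟩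
  · obtain ⟨N', hNN', hN'm, hN'⟩ := exists_measurable_superset_of_null hN
    filter_upwards [measure_eq_zero_iff_ae_notMem.1 hN'] with z hz
    refine measure_mono_null hNN' ?_
    rw [Kernel.withDensity_apply' _ hmc, setLIntegral_const, Kernel.id_apply,
      Measure.dirac_apply' _ hN'm, Set.indicator_of_notMem hz, mul_zero]
  · have hball := ae_norm_lt_one (vAlpha_compl_unitBall (n := n) (α := α))
    have hmz : ∀ z, Measurable fun w : Cn n => coshWeight η z w * h w := fun z =>
      (measurable_coshWeight measurable_const measurable_id).mul hh
    refine le_of_eq ?_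
    rw [ENNReal.coe_rpow_of_nonneg _ hP, ← lintegral_const_mul' _ _ (by finiteness)]
    refine lintegral_congr_ae ?_
    filter_upwards [hball] with z hz
    rw [Kernel.lintegral_withDensity _ hmc _ (hmz z), Kernel.lintegral_id, coshWeight, coshSq_self hz,
      Real.one_rpow, ENNReal.ofReal_one, one_mul, ENNReal.mul_rpow_of_nonneg _ _ hP]

theorem isLocalKernel_bergman [IsFiniteMeasure (vAlpha n α)] (hn : 1 ≤ n) (hα : -1 < α) {A : ℝ≥0}
    (hA : KernelBound n α p η 1 A) (c : ℝ≥0) :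
    IsLocalKernel n α p η (c ^ p.toReal * A)
      (Kernel.withDensity (Kernel.const (Cn n) (vAlpha n α))
        fun z w => c * ENNReal.ofReal (gap z w ^ (-(n + 1 + α)))) := by
  have hP : 0 ≤ p.toReal := ENNReal.toReal_nonneg
  have hmc : Measurable (Function.uncurry fun z w : Cn n =>
      (c : ℝ≥0∞) * ENNReal.ofReal (gap z w ^ (-(n + 1 + α)))) :=
    ((measurable_gap measurable_fst measurable_snd).pow_const _).ennreal_ofReal.const_mul _
  refine ⟨Kernel.IsSFiniteKernel.withDensity _ fun _ _ => ENNReal.mul_ne_top ENNReal.coe_ne_top ENNReal.ofReal_ne_top,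
    fun N hN => ?_, fun h hh => ?_⟩
  · refine Filter.Eventually.of_forall fun z => ?_
    rw [Kernel.withDensity_apply _ hmc, Kernel.const_apply]
    exact withDensity_absolutelyContinuous _ _ hN
  · have hmz : ∀ z, Measurable fun w : Cn n => coshWeight η z w * h w := fun z =>
      (measurable_coshWeight measurable_const measurable_id).mul hh
    have e : ∀ z, ∫⁻ w, coshWeight η z w * h w ∂(Kernel.withDensity
        (Kernel.const (Cn n) (vAlpha n α))
        fun z w => c * ENNReal.ofReal (gap z w ^ (-(n + 1 + α)))) z
        = c * ∫⁻ w, ENNReal.ofReal (wKernel n α η z w) * h w ∂vAlpha n α := fun z => by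
      rw [Kernel.lintegral_withDensity _ hmc _ (hmz z), Kernel.const_apply,
        ← lintegral_const_mul' _ _ ENNReal.coe_ne_top]
      congr 1; ext w
      rw [ofReal_wKernel_eq]
      ring
    simp_rw [e, ENNReal.mul_rpow_of_nonneg _ _ hP]
    rw [lintegral_const_mul' _ _ (by finiteness)]
    push_cast
    rw [ENNReal.coe_rpow_of_nonneg _ hP, mul_assoc]
    gcongr
    exact hA _ (isCarlesonWith_vAlpha hn hα) h hh

theorem measurable_enorm_coeFn (f : LpAlpha n α p) : Measurable fun z => ‖f z‖ₑ :=
  (Lp.stronglyMeasurable f).measurable.enorm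

section Operators

variable [Fact (1 ≤ p)]

theorem mulOp_coeFn (a : LpAlpha n α ∞) (f : LpAlpha n α p) :
    mulOp n α p a f =ᵐ[vAlpha n α] fun z => a z * f z :=
  ContinuousLinearMap.coeFn_holder (ContinuousLinearMap.mul ℂ ℂ) a f

theorem IsDominated.add {S T : BergmanOp n α p} (hp1 : 1 < p) (hp : p < ∞)
    (hS : IsDominated η S) (hT : IsDominated η T) : IsDominated η (S + T) := by
  obtain ⟨κ, A, hκ, hSκ⟩ := hS
  obtain ⟨κ', B, hκ', hTκ⟩ := hT
  refine ⟨κ + κ', _, hκ.add hp1 hp hκ', fun g => ?_⟩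
  rw [add_apply, map_add]
  filter_upwards [hSκ g, hTκ g, Lp.coeFn_add (incl n α p (S g)) (incl n α p (T g))] with z h1 h2 h3
  rw [h3, Pi.add_apply, FunLike.coe_add, Pi.add_apply, lintegral_add_measure]
  exact (enorm_add_le _ _).trans (add_le_add h1 h2)

theorem IsDominated.mul {S T : BergmanOp n α p} (hη : 0 ≤ η)
    (hS : IsDominated η S) (hT : IsDominated η T) : IsDominated η (S * T) := by
  obtain ⟨κ, A, hκ, hSκ⟩ := hS
  obtain ⟨κ', B, hκ', hTκ⟩ := hT
  refine ⟨κ'.comp κ, _, hκ.comp hη hκ', fun g => ?_⟩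
  filter_upwards [hSκ (T g), hκ.ae_ae (hTκ g)] with z h1 h2
  rw [Kernel.lintegral_comp _ _ _ (measurable_enorm_coeFn _)]
  exact h1.trans (lintegral_mono_ae h2)

theorem isDominated_algebraMap (c : ℂ) :
    IsDominated η (algebraMap ℂ (BergmanOp n α p) c) := by
  refine ⟨_, _, isLocalKernel_scalar ‖c‖₊, fun g => ?_⟩
  have e : incl n α p (algebraMap ℂ (BergmanOp n α p) c g) = c • incl n α p g := by
    rw [Algebra.algebraMap_eq_smul_one, smul_apply,
      one_apply_eq_self, map_smul]
  rw [e]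
  filter_upwards [Lp.coeFn_smul c (incl n α p g)] with z hz
  rw [Kernel.lintegral_withDensity _ (by exact measurable_const) _ (measurable_enorm_coeFn _),
    Kernel.lintegral_id, hz, Pi.smul_apply, enorm_smul]
  rfl

/-- The symbol is bounded by its essential supremum, so |T_a g| is at most ‖a‖ times the integral of
|K| |g|. The weighted bound is the Carleson case μ = v_α with constant 1. -/
theorem IsToeplitz.isDominated (hn : 1 ≤ n) (hα : -1 < α) {A : ℝ≥0}
    (hA : KernelBound n α p η 1 A) {a : LpAlpha n α ∞} {T : BergmanOp n α p}
    (hT : IsToeplitz n α p a T) : IsDominated η T := by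
  have := isFiniteMeasure_vAlpha (α := α) hn hα
  refine ⟨_, _, isLocalKernel_bergman hn hα hA ‖a‖₊, fun g => ?_⟩
  have hmc : Measurable (Function.uncurry fun z w : Cn n =>
      (‖a‖₊ : ℝ≥0∞) * ENNReal.ofReal (gap z w ^ (-(n + 1 + α)))) :=
    ((measurable_gap measurable_fst measurable_snd).pow_const _).ennreal_ofReal.const_mul _
  have ha : ∀ᵐ w ∂vAlpha n α, ‖a w‖ₑ ≤ ‖a‖₊ := by
    have h := ae_le_eLpNormEssSup (f := a) (μ := vAlpha n α)
    rw [← eLpNorm_exponent_top, ← Lp.enorm_def] at h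
    exact h
  filter_upwards [hT g] with z hz
  rw [hz, Kernel.lintegral_withDensity _ hmc _ (measurable_enorm_coeFn _), Kernel.const_apply]
  refine (enorm_kernelInt_le _ z).trans (lintegral_mono_ae ?_)
  filter_upwards [ha, mulOp_coeFn a (incl n α p g)] with w h1 h2
  rw [h2, enorm_mul]
  calc ENNReal.ofReal (gap z w ^ (-(n + 1 + α))) * (‖a w‖ₑ * ‖incl n α p g w‖ₑ)
      ≤ ENNReal.ofReal (gap z w ^ (-(n + 1 + α))) * (‖a‖₊ * ‖incl n α p g w‖ₑ) := by gcongr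
    _ = _ := by ring

theorem isDominated_of_mem_adjoin (hn : 1 ≤ n) (hα : -1 < α) (hp1 : 1 < p) (hp : p < ∞)
    (hη : 0 ≤ η) {A : ℝ≥0} (hA : KernelBound n α p η 1 A) {S : BergmanOp n α p}
    (hS : S ∈ Algebra.adjoin ℂ {T : BergmanOp n α p | ∃ a : LpAlpha n α ∞, IsToeplitz n α p a T}) :
    IsDominated η S := by
  induction hS using Algebra.adjoin_induction with
  | mem T hT =>
    obtain ⟨a, ha⟩ := hT
    exact ha.isDominated hn hα hA
  | algebraMap c => exact isDominated_algebraMap c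
  | add S T _ _ hS hT => exact hS.add hp1 hp hT
  | mul S T _ _ hS hT => exact hS.mul hη hT

end Operators

end

end BergmanBall

/-! ### Off-diagonal smallness and gluing along a partition. -/

namespace BergmanBall

noncomputable section

open ProbabilityTheory

variable {n : ℕ} {α : ℝ} {p : ℝ≥0∞} {η : ℝ} {C : ℝ≥0} {μ : Measure (Cn n)}

theorem kernelInt_sub_restrict {g : Cn n → ℂ} (hg : Integrable g μ) (hμ : μ (unitBall n)ᶜ = 0)
    {G : Set (Cn n)} (hG : MeasurableSet G) {z : Cn n} (hz : ‖z‖ < 1) :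
    kernelInt n α μ g z - kernelInt n α (μ.restrict G) g z
      = kernelInt n α (μ.restrict Gᶜ) g z := by
  rw [kernelInt, kernelInt, kernelInt,
    ← integral_add_compl hG (integrable_kernelInt_integrand hg hμ hz), add_sub_cancel_left]

/-- `coshSq_mul` read backwards: a large distance from z to w must show up in one of the two legs
through u. This is the source of the gain (256/M)^η. -/
theorem one_le_ofReal_mul_coshWeight (hη : 0 ≤ η) {z u w : Cn n} (hz : ‖z‖ < 1) (hu : ‖u‖ < 1)
    (hw : ‖w‖ < 1) {M : ℝ} (hM : 0 < M) (h : M ≤ coshSq z w) :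
    1 ≤ ENNReal.ofReal ((256 / M) ^ η) * (coshWeight η z u * coshWeight η u w) := by
  have h1 := coshSq_pos hz hu
  have h2 := coshSq_pos hu hw
  rw [coshWeight, coshWeight, ← ENNReal.ofReal_mul (by positivity),
    ← ENNReal.ofReal_mul (by positivity), ← Real.mul_rpow h1.le h2.le,
    ← Real.mul_rpow (by positivity) (by positivity), ENNReal.one_le_ofReal]
  refine Real.one_le_rpow ?_ hη
  rw [div_mul_eq_mul_div, one_le_div hM]
  exact h.trans (coshSq_mul hz hu hw)

/-- Off the diagonal, the kernel of `T_μ` is small against the weighted kernel. -/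
theorem enorm_kernelInt_restrict_compl_le (hη : 0 ≤ η) (hμ : μ (unitBall n)ᶜ = 0) {G : Set (Cn n)}
    (hG : MeasurableSet G) (g : Cn n → ℂ) {z u : Cn n} (hz : ‖z‖ < 1) (hu : ‖u‖ < 1) {M : ℝ}
    (hM : 0 < M) (h : ∀ w ∈ unitBall n, w ∉ G → M ≤ coshSq z w) :
    ‖kernelInt n α (μ.restrict Gᶜ) g u‖ₑ ≤ ENNReal.ofReal ((256 / M) ^ η) *
      (coshWeight η z u * ∫⁻ w, ENNReal.ofReal (wKernel n α η u w) * ‖g w‖ₑ ∂μ) := by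
  refine (enorm_kernelInt_le g u).trans ?_
  have hne : ENNReal.ofReal ((256 / M) ^ η) * coshWeight η z u ≠ ∞ :=
    ENNReal.mul_ne_top ENNReal.ofReal_ne_top ENNReal.ofReal_ne_top
  rw [← mul_assoc, ← lintegral_const_mul' _ _ hne]
  refine le_trans ?_ (setLIntegral_le_lintegral Gᶜ _)
  refine lintegral_mono_ae ?_
  have hball : ∀ᵐ w ∂μ.restrict Gᶜ, ‖w‖ < 1 := ae_restrict_of_ae (ae_norm_lt_one hμ)
  filter_upwards [ae_restrict_mem hG.compl, hball] with w hwG hw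
  have h1 := one_le_ofReal_mul_coshWeight hη hz hu hw hM (h w (mem_unitBall.2 hw) hwG)
  rw [ofReal_wKernel_eq]
  calc ENNReal.ofReal (gap u w ^ (-(n + 1 + α))) * ‖g w‖ₑ
      = 1 * (ENNReal.ofReal (gap u w ^ (-(n + 1 + α))) * ‖g w‖ₑ) := (one_mul _).symm
    _ ≤ ENNReal.ofReal ((256 / M) ^ η) * (coshWeight η z u * coshWeight η u w) *
        (ENNReal.ofReal (gap u w ^ (-(n + 1 + α))) * ‖g w‖ₑ) := by gcongr
    _ = _ := by ring

theorem measurable_lintegral_wKernel [SFinite μ] {h : Cn n → ℝ≥0∞} (hh : Measurable h) :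
    Measurable fun u => ∫⁻ w, ENNReal.ofReal (wKernel n α η u w) * h w ∂μ := by
  have hm : Measurable (Function.uncurry fun u w : Cn n =>
      ENNReal.ofReal (wKernel n α η u w) * h w) :=
    (measurable_wKernel _ measurable_fst measurable_snd).ennreal_ofReal.mul (hh.comp measurable_snd)
  exact hm.lintegral_prod_right'

/-- The sum of the integrals over a family of sets that cover each point of the ball at most `N`
times. -/
theorem tsum_setLIntegral_le {N : ℕ} {G : ℕ → Set (Cn n)} (hG : ∀ j, MeasurableSet (G j))
    (hN : ∀ z ∈ unitBall n, {j | z ∈ G j}.encard ≤ N) (hμ : μ (unitBall n)ᶜ = 0)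
    {h : Cn n → ℝ≥0∞} (hh : Measurable h) :
    ∑' j, ∫⁻ w in G j, h w ∂μ ≤ N * ∫⁻ w, h w ∂μ := by
  simp_rw [← lintegral_indicator (hG _)]
  rw [← lintegral_tsum fun j => (hh.indicator (hG j)).aemeasurable, ← lintegral_const_mul _ hh]
  refine lintegral_mono_ae ?_
  filter_upwards [ae_norm_lt_one hμ] with w hw
  have e : ∀ j, (G j).indicator h w = {j | w ∈ G j}.indicator (fun _ => (1 : ℝ≥0∞)) j * h w := by
    intro j
    by_cases hj : w ∈ G j
    · rw [Set.indicator_of_mem hj, Set.indicator_of_mem (by exact hj), one_mul]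
    · rw [Set.indicator_of_notMem hj, Set.indicator_of_notMem (by exact hj), zero_mul]
  simp_rw [e]
  rw [ENNReal.tsum_mul_right, ← tsum_subtype, ENNReal.tsum_set_one]
  gcongr
  have h1 := hN w (mem_unitBall.2 hw)
  exact_mod_cast ENat.toENNReal_le.2 h1

section Operators

variable [Fact (1 ≤ p)]

/-- Extending the holomorphic representative by zero off the ball makes it globally measurable, as
the integral estimates require. -/
theorem exists_measurable_rep (f : Bergman n α p) :
    ∃ g : Cn n → ℂ, DifferentiableOn ℂ g (unitBall n) ∧ Measurable g ∧
      incl n α p f =ᵐ[vAlpha n α] g := by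
  classical
  obtain ⟨g, hg, hfg⟩ := exists_holomorphic_rep f
  have heq : Set.EqOn ((unitBall n).indicator g) g (unitBall n) := fun z hz =>
    Set.indicator_of_mem hz g
  refine ⟨(unitBall n).indicator g, hg.congr heq, ?_, ?_⟩
  · rw [← Set.piecewise_eq_indicator]
    exact hg.continuousOn.measurable_piecewise continuousOn_const measurableSet_unitBall
  · filter_upwards [hfg, ae_norm_lt_one (vAlpha_compl_unitBall (n := n) (α := α))] with z h1 hz
    rw [h1, heq (mem_unitBall.2 hz)]

theorem memLp_of_ae_eq {f : Bergman n α p} {g : Cn n → ℂ} (h : incl n α p f =ᵐ[vAlpha n α] g) :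
    MemLp g p (vAlpha n α) := (memLp_congr_ae h).1 (Lp.memLp (incl n α p f))

theorem lintegral_rep_le (hp1 : 1 < p) (hp : p < ∞) (hμ : IsCarlesonWith n α p C μ)
    {f : Bergman n α p} {g : Cn n → ℂ} (hg : DifferentiableOn ℂ g (unitBall n))
    (h : incl n α p f =ᵐ[vAlpha n α] g) :
    ∫⁻ w, ‖g w‖ₑ ^ p.toReal ∂μ ≤ C ^ p.toReal * ‖f‖ₑ ^ p.toReal := by
  refine (hμ.lintegral_le hp1 hp hg (memLp_of_ae_eq h)).trans (le_of_eq ?_)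
  rw [← enorm_incl, enorm_rpow_eq_lintegral hp]
  congr 1
  refine lintegral_congr_ae ?_
  filter_upwards [h] with z hz
  rw [hz]

/-- If `F` is far from the complement of `G`, then `S T_μ f` is close to `S T_{μ 1_G} f` on `F`. -/
theorem enorm_sub_le_of_far (hη : 0 ≤ η) (hp1 : 1 < p) {A : ℝ≥0} {κ : Kernel (Cn n) (Cn n)}
    (hκ : IsLocalKernel n α p η A κ) {S : BergmanOp n α p}
    (hS : ∀ g : Bergman n α p, ∀ᵐ z ∂vAlpha n α,
      ‖incl n α p (S g) z‖ₑ ≤ ∫⁻ w, ‖incl n α p g w‖ₑ ∂κ z)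
    (hμ : IsCarlesonWith n α p C μ) {T T' : BergmanOp n α p} {F G : Set (Cn n)}
    (hG : MeasurableSet G) (hT : IsToeplitzMeasure n α p μ T)
    (hT' : IsToeplitzMeasure n α p (μ.restrict G) T') {M : ℝ} (hM : 0 < M)
    (hFG : ∀ z ∈ F, ∀ w ∈ unitBall n, w ∉ G → M ≤ coshSq z w) {f : Bergman n α p} {g : Cn n → ℂ}
    (hg : DifferentiableOn ℂ g (unitBall n)) (hfg : incl n α p f =ᵐ[vAlpha n α] g) :
    ∀ᵐ z ∂vAlpha n α, z ∈ F →
      ‖incl n α p (S (T f)) z - incl n α p (S (T' f)) z‖ₑ ≤ ENNReal.ofReal ((256 / M) ^ η) *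
        ∫⁻ u, coshWeight η z u *
          ∫⁻ w, ENNReal.ofReal (wKernel n α η u w) * ‖g w‖ₑ ∂μ ∂κ z := by
  have hball := ae_norm_lt_one (vAlpha_compl_unitBall (n := n) (α := α))
  have := hμ.finite
  have hgi : Integrable g μ := (hμ.memLp hg (memLp_of_ae_eq hfg)).integrable hp1.le
  -- T f - T' f is the kernel integral of g over the complement of G. This holds only v_α-almost
  -- everywhere; the null-set condition transfers it to κ z-almost every u.
  have h1 : ∀ᵐ u ∂vAlpha n α,
      ‖u‖ < 1 ∧ incl n α p (T f - T' f) u = kernelInt n α (μ.restrict Gᶜ) g u := by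
    rw [map_sub]
    filter_upwards [hball, hT f g hg hfg, hT' f g hg hfg,
      Lp.coeFn_sub (incl n α p (T f)) (incl n α p (T' f))] with u hu e1 e2 e3
    refine ⟨hu, ?_⟩
    rw [e3, Pi.sub_apply, e1, e2, kernelInt_sub_restrict hgi hμ.supported hG hu]
  have h2 : ∀ᵐ z ∂vAlpha n α, ∀ᵐ u ∂κ z,
      ‖u‖ < 1 ∧ incl n α p (T f - T' f) u = kernelInt n α (μ.restrict Gᶜ) g u := hκ.ae_ae h1
  have h3 := hS (T f - T' f)
  rw [map_sub, map_sub] at h3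
  filter_upwards [hball, h2, h3, Lp.coeFn_sub (incl n α p (S (T f))) (incl n α p (S (T' f)))]
    with z hz h2 h3 h4 hzF
  rw [h4, Pi.sub_apply] at h3
  refine h3.trans ?_
  rw [← lintegral_const_mul' _ _ ENNReal.ofReal_ne_top]
  refine lintegral_mono_ae ?_
  filter_upwards [h2] with u hu
  rw [hu.2]
  exact enorm_kernelInt_restrict_compl_le hη hμ.supported hG g hz hu.1 hM (hFG z hzF)

/-- Three bounds are chained: the weighted kernel κ on L^p_α, the weighted Bergman kernel from
L^p(μ) to L^p_α, and the Carleson embedding. -/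
theorem lintegral_localKernel_le (hp1 : 1 < p) (hp : p < ∞) {A B : ℝ≥0}
    {κ : Kernel (Cn n) (Cn n)} (hκ : IsLocalKernel n α p η A κ) (hB : KernelBound n α p η C B)
    (hμ : IsCarlesonWith n α p C μ) (c : ℝ) {f : Bergman n α p} {g : Cn n → ℂ}
    (hg : DifferentiableOn ℂ g (unitBall n)) (hgm : Measurable g)
    (hfg : incl n α p f =ᵐ[vAlpha n α] g) :
    ∫⁻ z, (ENNReal.ofReal c * ∫⁻ u, coshWeight η z u *
        ∫⁻ w, ENNReal.ofReal (wKernel n α η u w) * ‖g w‖ₑ ∂μ ∂κ z) ^ p.toReal ∂vAlpha n α ≤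
      ENNReal.ofReal c ^ p.toReal * (A * (B * C ^ p.toReal)) * ‖f‖ₑ ^ p.toReal := by
  have hP : 0 ≤ p.toReal := ENNReal.toReal_nonneg
  have := hμ.finite
  simp_rw [ENNReal.mul_rpow_of_nonneg _ _ hP]
  rw [lintegral_const_mul' _ _ (ENNReal.rpow_ne_top_of_nonneg hP ENNReal.ofReal_ne_top)]
  have h1 := hκ.bound (fun u => ∫⁻ w, ENNReal.ofReal (wKernel n α η u w) * ‖g w‖ₑ ∂μ)
    (measurable_lintegral_wKernel hgm.enorm)
  have h2 := hB μ hμ (fun w => ‖g w‖ₑ) hgm.enorm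
  have h3 := lintegral_rep_le hp1 hp hμ hg hfg
  have h4 := h1.trans (mul_le_mul_right (h2.trans (mul_le_mul_right h3 B)) A)
  refine (mul_le_mul_right h4 _).trans (le_of_eq ?_)
  ring

theorem mulOp_indicatorLinf_coeFn {F : Set (Cn n)} (hF : MeasurableSet F) (x : LpAlpha n α p) :
    mulOp n α p (indicatorLinf n α F hF) x =ᵐ[vAlpha n α] F.indicator x := by
  have h : indicatorLinf n α F hF =ᵐ[vAlpha n α] F.indicator fun _ => (1 : ℂ) :=
    MemLp.coeFn_toLp _
  filter_upwards [mulOp_coeFn (indicatorLinf n α F hF) x, h] with z h1 h2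
  rw [h1, h2]
  by_cases hz : z ∈ F
  · rw [Set.indicator_of_mem hz, Set.indicator_of_mem hz, one_mul]
  · rw [Set.indicator_of_notMem hz, Set.indicator_of_notMem hz, zero_mul]

/-- At each point at most one summand is nonzero, so the p-th powers add without cross terms. -/
theorem enorm_sum_mulOp_rpow_le (hp : p < ∞) {F : ℕ → Set (Cn n)}
    (hF : ∀ j, MeasurableSet (F j)) (hdisj : ∀ j k, j ≠ k → F j ∩ F k = ∅)
    (x : ℕ → LpAlpha n α p) (t : Finset ℕ) :
    ‖∑ j ∈ t, mulOp n α p (indicatorLinf n α (F j) (hF j)) (x j)‖ₑ ^ p.toReal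
      ≤ ∑ j ∈ t, ‖x j‖ₑ ^ p.toReal := by
  have hp0 : p ≠ 0 := (zero_lt_one.trans_le Fact.out).ne'
  have hP : 0 < p.toReal := ENNReal.toReal_pos hp0 hp.ne
  simp_rw [enorm_rpow_eq_lintegral hp]
  rw [← lintegral_finsetSum _ fun j _ => (measurable_enorm_coeFn (x j)).pow_const _]
  refine lintegral_mono_ae ?_
  have h1 : ∀ᵐ z ∂vAlpha n α, ∀ j, mulOp n α p (indicatorLinf n α (F j) (hF j)) (x j) z
      = (F j).indicator (x j) z := ae_all_iff.2 fun j => mulOp_indicatorLinf_coeFn (hF j) (x j)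
  filter_upwards [h1, Lp.coeFn_finsetSum t
    fun j => mulOp n α p (indicatorLinf n α (F j) (hF j)) (x j)] with z h1 h2
  rw [h2]
  simp only [Finset.sum_apply, h1]
  by_cases h : ∃ k ∈ t, z ∈ F k
  · obtain ⟨k, hk, hzk⟩ := h
    rw [Finset.sum_eq_single_of_mem k hk, Set.indicator_of_mem hzk]
    · exact Finset.single_le_sum (f := fun j => ‖x j z‖ₑ ^ p.toReal) (fun _ _ => zero_le) hk
    · intro j _ hj
      refine Set.indicator_of_notMem (fun hzj => ?_) _
      have : z ∈ F j ∩ F k := ⟨hzj, hzk⟩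
      rwa [hdisj j k hj] at this
  · rw [Finset.sum_eq_zero fun j hj => Set.indicator_of_notMem (fun hz => h ⟨j, hj, hz⟩) _,
      enorm_zero, ENNReal.zero_rpow_of_pos hP]
    exact zero_le

/-- Gluing `L^p` functions along a disjoint family of sets. -/
theorem exists_hasSum_mulOp (hp : p < ∞) {F : ℕ → Set (Cn n)}
    (hF : ∀ j, MeasurableSet (F j)) (hdisj : ∀ j k, j ≠ k → F j ∩ F k = ∅)
    {x : ℕ → LpAlpha n α p} (hx : ∑' j, ‖x j‖ₑ ^ p.toReal ≠ ∞) :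
    ∃ U : LpAlpha n α p,
      HasSum (fun j => mulOp n α p (indicatorLinf n α (F j) (hF j)) (x j)) U ∧
      (∀ᵐ z ∂vAlpha n α, ∀ j, z ∈ F j → U z = x j z) ∧
      ‖U‖ₑ ^ p.toReal ≤ ∑' j, ‖x j‖ₑ ^ p.toReal := by
  have hp0 : p ≠ 0 := (zero_lt_one.trans_le Fact.out).ne'
  have hP : 0 < p.toReal := ENNReal.toReal_pos hp0 hp.ne
  set y : ℕ → LpAlpha n α p := fun j => mulOp n α p (indicatorLinf n α (F j) (hF j)) (x j) with hy
  have hfin : ∀ t : Finset ℕ, ‖∑ j ∈ t, y j‖ₑ ^ p.toReal ≤ ∑ j ∈ t, ‖x j‖ₑ ^ p.toReal :=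
    enorm_sum_mulOp_rpow_le hp hF hdisj x
  have hreal : ∀ v : LpAlpha n α p, ‖v‖ ^ p.toReal = (‖v‖ₑ ^ p.toReal).toReal := fun v => by
    rw [← ENNReal.toReal_rpow, toReal_enorm]
  have hsum : Summable y := by
    have h1 : Summable fun j => ‖x j‖ ^ p.toReal := by
      simp_rw [hreal]
      exact ENNReal.summable_toReal hx
    -- Cauchy criterion: tails of the p-th powers below ε^p force tails of the glued sums below ε.
    -- The norms of the individual terms need not be summable.
    rw [summable_iff_vanishing_norm] at h1 ⊢
    intro ε hε
    obtain ⟨s, hs⟩ := h1 (ε ^ p.toReal) (Real.rpow_pos_of_pos hε _)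
    refine ⟨s, fun t ht => ?_⟩
    refine (Real.rpow_lt_rpow_iff (norm_nonneg _) hε.le hP).1 (lt_of_le_of_lt ?_ (hs t ht))
    refine le_trans ?_ (le_abs_self _)
    have hne : ∀ j ∈ t, ‖x j‖ₑ ^ p.toReal ≠ ∞ := fun j _ =>
      ENNReal.rpow_ne_top_of_nonneg hP.le enorm_ne_top
    simp_rw [hreal]
    rw [← ENNReal.toReal_sum hne]
    exact ENNReal.toReal_mono (ENNReal.sum_ne_top.2 hne) (hfin t)
  obtain ⟨U, hU⟩ := hsum
  refine ⟨U, hU, ae_all_iff.2 fun k => ?_, ?_⟩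
  -- Multiplication by the indicator of F_k is continuous and annihilates every term but the k-th,
  -- which identifies the sum on F_k.
  · have h1 : HasSum (fun j => mulOp n α p (indicatorLinf n α (F k) (hF k)) (y j))
        (mulOp n α p (indicatorLinf n α (F k) (hF k)) U) := hU.mapL _
    have h2 : ∀ j, mulOp n α p (indicatorLinf n α (F k) (hF k)) (y j)
        =ᵐ[vAlpha n α] (F k ∩ F j).indicator (x j) := fun j => by
      filter_upwards [mulOp_indicatorLinf_coeFn (hF k) (y j),
        mulOp_indicatorLinf_coeFn (hF j) (x j)] with z e1 e2
      rw [e1, ← Set.indicator_indicator]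
      by_cases hz : z ∈ F k
      · rw [Set.indicator_of_mem hz, Set.indicator_of_mem hz, e2]
      · rw [Set.indicator_of_notMem hz, Set.indicator_of_notMem hz]
    have h3 : ∀ j, j ≠ k → mulOp n α p (indicatorLinf n α (F k) (hF k)) (y j) = 0 := by
      intro j hj
      rw [Lp.eq_zero_iff_ae_eq_zero]
      filter_upwards [h2 j] with z hz
      rw [hz, hdisj k j hj.symm, Set.indicator_empty, Pi.zero_apply]
    have h4 := h1.unique (hasSum_single k h3)
    filter_upwards [h2 k, mulOp_indicatorLinf_coeFn (hF k) U] with z e1 e2 hz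
    rw [h4, e1, Set.inter_self, Set.indicator_of_mem hz, Set.indicator_of_mem hz] at e2
    exact e2.symm
  · have h1 : Filter.Tendsto (fun t : Finset ℕ => ‖∑ j ∈ t, y j‖ₑ ^ p.toReal) Filter.atTop
        (nhds (‖U‖ₑ ^ p.toReal)) :=
      ((ENNReal.continuous_rpow_const.comp continuous_enorm).tendsto U).comp hU
    exact le_of_tendsto' h1 fun t => (hfin t).trans (ENNReal.sum_le_tsum t)

/-- Gluing bounded operators along a disjoint family of sets. -/
theorem exists_glue (hp : p < ∞) {F : ℕ → Set (Cn n)}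
    (hF : ∀ j, MeasurableSet (F j)) (hdisj : ∀ j k, j ≠ k → F j ∩ F k = ∅)
    (X : ℕ → Bergman n α p →L[ℂ] LpAlpha n α p) {K : ℝ≥0}
    (hX : ∀ f, ∑' j, ‖X j f‖ₑ ^ p.toReal ≤ K * ‖f‖ₑ ^ p.toReal) :
    ∃ R : Bergman n α p →L[ℂ] LpAlpha n α p,
      (∀ f, HasSum (fun j => mulOp n α p (indicatorLinf n α (F j) (hF j)) (X j f)) (R f)) ∧
      (∀ f, ∀ᵐ z ∂vAlpha n α, ∀ j, z ∈ F j → R f z = X j f z) ∧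
      ‖R‖ ≤ (K ^ (1 / p.toReal) : ℝ≥0) := by
  have hp0 : p ≠ 0 := (zero_lt_one.trans_le Fact.out).ne'
  have hP : 0 < p.toReal := ENNReal.toReal_pos hp0 hp.ne
  have hne : ∀ f, ∑' j, ‖X j f‖ₑ ^ p.toReal ≠ ∞ := fun f => ne_top_of_le_ne_top
    (ENNReal.mul_ne_top ENNReal.coe_ne_top (ENNReal.rpow_ne_top_of_nonneg hP.le enorm_ne_top)) (hX f)
  choose U hU hUae hUle using fun f => exists_hasSum_mulOp hp hF hdisj (hne f)
  have hbd : ∀ f, ‖U f‖ ≤ (K ^ (1 / p.toReal) : ℝ≥0) * ‖f‖ := fun f =>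
    norm_le_of_enorm_rpow_le hP ((hUle f).trans (hX f))
  let R₁ : Bergman n α p →ₗ[ℂ] LpAlpha n α p :=
    { toFun := U
      map_add' := fun f g => by
        refine (hU (f + g)).unique ?_
        simpa only [map_add] using (hU f).add (hU g)
      map_smul' := fun c f => by
        refine (hU (c • f)).unique ?_
        simpa only [map_smul, RingHom.id_apply] using (hU f).const_smul c }
  exact ⟨R₁.mkContinuous _ hbd, hU, hUae, R₁.mkContinuous_norm_le (NNReal.coe_nonneg _) hbd⟩

end Operators

end

end BergmanBall

/-! ### The localization estimate. -/

namespace BergmanBall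

noncomputable section

open ProbabilityTheory

variable {n : ℕ} {α : ℝ} {p : ℝ≥0∞} [Fact (1 ≤ p)] {η : ℝ} {C : ℝ≥0} {μ : Measure (Cn n)}

theorem nnreal_mul_rpow_one_div {P : ℝ} (hP : 0 < P) (a b : ℝ≥0) :
    (a ^ P * b) ^ (1 / P) = a * b ^ (1 / P) := by
  rw [NNReal.mul_rpow, ← NNReal.rpow_mul, mul_one_div_cancel hP.ne', NNReal.rpow_one]

/-- The bounds for the separate T_{μ1_{G_j}} f add up because the G_j overlap at most N times. The
factor ‖S‖ in the result makes the glued operator small when S is small. -/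
theorem tsum_enorm_comp_rpow_le (hp1 : 1 < p) (hp : p < ∞) (hμ : IsCarlesonWith n α p C μ)
    {N : ℕ} {G : ℕ → Set (Cn n)} (hG : ∀ j, MeasurableSet (G j))
    (hN : ∀ z ∈ unitBall n, {j | z ∈ G j}.encard ≤ N) {TG : ℕ → BergmanOp n α p} {K : ℝ≥0}
    (hTG : ∀ (j : ℕ) (f : Bergman n α p) (g : Cn n → ℂ), DifferentiableOn ℂ g (unitBall n) →
      incl n α p f =ᵐ[vAlpha n α] g →
      ‖TG j f‖ₑ ^ p.toReal ≤ K * ∫⁻ w in G j, ‖g w‖ₑ ^ p.toReal ∂μ)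
    (S : BergmanOp n α p) (f : Bergman n α p) :
    ∑' j, ‖(incl n α p).comp (S.comp (TG j)) f‖ₑ ^ p.toReal ≤
      (‖S‖₊ ^ p.toReal * (K * (N * C ^ p.toReal)) : ℝ≥0) * ‖f‖ₑ ^ p.toReal := by
  have hP : 0 ≤ p.toReal := ENNReal.toReal_nonneg
  obtain ⟨g, hg, hgm, hfg⟩ := exists_measurable_rep f
  calc ∑' j, ‖(incl n α p).comp (S.comp (TG j)) f‖ₑ ^ p.toReal
      ≤ ∑' j, (‖S‖₊ : ℝ≥0∞) ^ p.toReal * (K * ∫⁻ w in G j, ‖g w‖ₑ ^ p.toReal ∂μ) := by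
        refine ENNReal.tsum_le_tsum fun j => ?_
        refine le_trans ?_ (mul_le_mul_right (hTG j f g hg hfg) _)
        rw [← ENNReal.mul_rpow_of_nonneg _ _ hP]
        gcongr
        exact S.le_opENorm (TG j f)
    _ ≤ (‖S‖₊ : ℝ≥0∞) ^ p.toReal * (K * (N * (C ^ p.toReal * ‖f‖ₑ ^ p.toReal))) := by
        rw [ENNReal.tsum_mul_left, ENNReal.tsum_mul_left]
        gcongr
        refine (tsum_setLIntegral_le hG hN hμ.supported (hgm.enorm.pow_const _)).trans ?_
        gcongr
        exact lintegral_rep_le hp1 hp hμ hg hfg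
    _ = _ := by
        push_cast
        rw [ENNReal.coe_rpow_of_nonneg _ hP, ENNReal.coe_rpow_of_nonneg _ hP]
        ring

/-- The localization estimate for operators dominated by a local kernel. -/
theorem norm_sub_glue_le (hη : 0 ≤ η) (hp1 : 1 < p) (hp : p < ∞) {A B : ℝ≥0}
    {κ : Kernel (Cn n) (Cn n)} (hκ : IsLocalKernel n α p η A κ) {S : BergmanOp n α p}
    (hS : ∀ g : Bergman n α p, ∀ᵐ z ∂vAlpha n α,
      ‖incl n α p (S g) z‖ₑ ≤ ∫⁻ w, ‖incl n α p g w‖ₑ ∂κ z)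
    (hB : KernelBound n α p η C B) (hμ : IsCarlesonWith n α p C μ) {T : BergmanOp n α p}
    {TG : ℕ → BergmanOp n α p} {F G : ℕ → Set (Cn n)} (hG : ∀ j, MeasurableSet (G j))
    (hcov : ⋃ j, F j = unitBall n) (hT : IsToeplitzMeasure n α p μ T)
    (hTG : ∀ j, IsToeplitzMeasure n α p (μ.restrict (G j)) (TG j)) {M : ℝ} (hM : 0 < M)
    (hFG : ∀ j, ∀ z ∈ F j, ∀ w ∈ unitBall n, w ∉ G j → M ≤ coshSq z w)
    {R : Bergman n α p →L[ℂ] LpAlpha n α p}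
    (hR : ∀ f, ∀ᵐ z ∂vAlpha n α, ∀ j, z ∈ F j →
      R f z = (incl n α p).comp (S.comp (TG j)) f z) :
    ‖(incl n α p).comp (S.comp T) - R‖ ≤
      (256 / M) ^ η * ((A * (B * C ^ p.toReal)) ^ (1 / p.toReal) : ℝ≥0) := by
  have hp0 : p ≠ 0 := (zero_lt_one.trans hp1).ne'
  have hP : 0 < p.toReal := ENNReal.toReal_pos hp0 hp.ne
  have hc : 0 ≤ (256 / M) ^ η := by positivity
  refine ContinuousLinearMap.opNorm_le_bound _ (by positivity) fun f => ?_
  obtain ⟨g, hg, hgm, hfg⟩ := exists_measurable_rep f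
  have h1 := norm_le_of_enorm_rpow_le (x := ((incl n α p).comp (S.comp T) - R) f) (y := f)
    (K := ((256 / M) ^ η).toNNReal ^ p.toReal * (A * (B * C ^ p.toReal))) hP ?_
  · rwa [nnreal_mul_rpow_one_div hP, NNReal.coe_mul, Real.coe_toNNReal _ hc] at h1
  push_cast
  rw [ENNReal.coe_rpow_of_nonneg _ hP.le, ENNReal.coe_rpow_of_nonneg _ hP.le]
  refine le_trans ?_ (lintegral_localKernel_le hp1 hp hκ hB hμ ((256 / M) ^ η) hg hgm hfg)
  rw [enorm_rpow_eq_lintegral hp]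
  refine lintegral_mono_ae ?_
  have h2 : ∀ᵐ z ∂vAlpha n α, ∀ j, z ∈ F j →
      ‖incl n α p (S (T f)) z - incl n α p (S (TG j f)) z‖ₑ ≤ ENNReal.ofReal ((256 / M) ^ η) *
        ∫⁻ u, coshWeight η z u *
          ∫⁻ w, ENNReal.ofReal (wKernel n α η u w) * ‖g w‖ₑ ∂μ ∂κ z :=
    ae_all_iff.2 fun j => enorm_sub_le_of_far hη hp1 hκ hS hμ (hG j) hT (hTG j) hM (hFG j) hg hfg
  filter_upwards [h2, hR f, ae_norm_lt_one (vAlpha_compl_unitBall (n := n) (α := α)),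
    Lp.coeFn_sub (incl n α p (S (T f))) (R f)] with z h2 h3 hz h4
  -- The pointwise bound does not mention j, so the pieces combine without any loss from the number
  -- of sets.
  obtain ⟨j, hj⟩ := Set.mem_iUnion.1 (hcov.symm ▸ mem_unitBall.2 hz : z ∈ ⋃ j, F j)
  refine ENNReal.rpow_le_rpow ?_ hP.le
  have h5 : (((incl n α p).comp (S.comp T) - R) f : LpAlpha n α p) z
      = incl n α p (S (T f)) z - incl n α p (S (TG j f)) z := by
    refine h4.trans ?_
    rw [Pi.sub_apply, h3 j hj]
    rfl
  exact (congrArg enorm h5).trans_le (h2 j hj)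

theorem exists_div_rpow_mul_lt (hη : 0 < η) (δ : ℝ) {ε : ℝ} (hε : 0 < ε) :
    ∃ M : ℝ, 1 < M ∧ (256 / M) ^ η * δ < ε := by
  have h1 : Filter.Tendsto (fun M : ℝ => (256 / M) ^ η * δ) Filter.atTop (nhds (0 ^ η * δ)) :=
    ((Filter.Tendsto.const_div_atTop Filter.tendsto_id 256).rpow_const
      (Or.inr hη.le)).mul_const δ
  rw [Real.zero_rpow hη.ne', zero_mul] at h1
  exact ((Filter.eventually_gt_atTop 1).and (h1.eventually_lt_const hε)).exists

end

end BergmanBall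

/-! ### Choice of constants and conclusion. -/

open BergmanBall in
theorem theorem3p1 (n : ℕ) (hn : 1 ≤ n) :
    ∃ N : ℕ, ∀ (α : ℝ) (p : ℝ≥0∞) [Fact (1 ≤ p)], -1 < α → 1 < p → p < ∞ →
      ∀ S ∈ BergmanBall.toeplitzAlgebra n α p, ∀ ε : ℝ, 0 < ε → ∀ C : ℝ≥0,
      ∃ d : ℝ, ∀ μ : Measure (BergmanBall.Cn n), BergmanBall.IsCarlesonWith n α p C μ →
      ∃ T : BergmanBall.BergmanOp n α p, BergmanBall.IsToeplitzMeasure n α p μ T ∧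
      ∃ (F G : ℕ → Set (BergmanBall.Cn n)) (hF : ∀ j, MeasurableSet (F j)),
        (∀ j, MeasurableSet (G j)) ∧
        (∀ j, F j ⊆ G j) ∧
        (∀ j, G j ⊆ BergmanBall.unitBall n) ∧
        (⋃ j, F j) = BergmanBall.unitBall n ∧
        (∀ j k, j ≠ k → F j ∩ F k = ∅) ∧
        (∀ z ∈ BergmanBall.unitBall n, {j | z ∈ G j}.encard ≤ N) ∧
        (∀ j, ∀ z ∈ G j, ∀ w ∈ G j, BergmanBall.hypDist z w ≤ d) ∧
        ∃ (TG : ℕ → BergmanBall.BergmanOp n α p)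
          (R : BergmanBall.Bergman n α p →L[ℂ] BergmanBall.LpAlpha n α p),
          (∀ j, BergmanBall.IsToeplitzMeasure n α p (μ.restrict (G j)) (TG j)) ∧
          (∀ f, HasSum
            (fun j => BergmanBall.mulOp n α p (BergmanBall.indicatorLinf n α (F j) (hF j))
              (BergmanBall.incl n α p (S (TG j f)))) (R f)) ∧
          ‖(BergmanBall.incl n α p).comp (S.comp T) - R‖ < ε := by
  obtain ⟨N, hcover⟩ := exists_cover hn
  refine ⟨N, fun α p _ hα hp1 hp S hS ε hε C => ?_⟩
  have hP : 0 < p.toReal := ENNReal.toReal_pos (zero_lt_one.trans hp1).ne' hp.ne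
  obtain ⟨η, hη, hker⟩ := exists_lintegral_wKernel_le hn hα hp1 hp
  obtain ⟨B₁, hB₁⟩ := hker 1
  obtain ⟨B, hB⟩ := hker C
  obtain ⟨K, hKc⟩ : ∃ K : ℝ≥0, (K : ℝ≥0∞) = ENNReal.ofReal (4 ^ η) ^ p.toReal * B :=
    ⟨(4 ^ η : ℝ).toNNReal ^ p.toReal * B, by
      rw [ENNReal.coe_mul, ENNReal.coe_rpow_of_nonneg _ hP.le, ENNReal.ofReal]⟩
  -- τ bounds the norm of T_μ, and ρ is the factor by which ‖S₀‖ is multiplied in the bound for the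
  -- operator glued from S₀ T_{μ1_{G_j}}. Neither depends on M, μ or the covering.
  set τ : ℝ≥0 := (K * C ^ p.toReal) ^ (1 / p.toReal)
  set ρ : ℝ≥0 := (K * (N * C ^ p.toReal)) ^ (1 / p.toReal)
  -- The tolerance makes ‖S - S'‖ (τ + ρ) at most ε/2; the summand 1 keeps the denominator positive.
  obtain ⟨S', hS', hSS'⟩ := Metric.mem_closure_iff.1 hS (ε / (2 * (τ + ρ + 1))) (by positivity)
  rw [dist_eq_norm, lt_div_iff₀ (by positivity)] at hSS'
  obtain ⟨κ, A, hκ, hS'κ⟩ := isDominated_of_mem_adjoin hn hα hp1 hp hη.le hB₁ hS'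
  -- M depends on the kernel bound A of S', so it comes after the approximation. The covering is
  -- then fixed before μ, which makes d uniform in μ.
  obtain ⟨M, hM1, hM⟩ := exists_div_rpow_mul_lt hη
    ((A * (B * C ^ p.toReal)) ^ (1 / p.toReal) : ℝ≥0) (half_pos hε)
  obtain ⟨D, F, G, hF, hG, hFG, hGball, hcov, hdisj, hmult, hdiam, hfar⟩ := hcover M hM1
  refine ⟨1 / 2 * Real.log (4 * D), fun μ hμ => ?_⟩
  obtain ⟨T, hT, hTle⟩ := exists_isToeplitzMeasure hα hp1 hp hη.le hB hμ
  choose TG hTG hTGle using fun j =>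
    exists_isToeplitzMeasure hα hp1 hp hη.le hB (hμ.restrict (G j))
  rw [← hKc] at hTle
  simp only [← hKc] at hTGle
  have hTτ : ‖T‖ ≤ τ := ContinuousLinearMap.opNorm_le_bound _ τ.coe_nonneg fun f => by
    obtain ⟨g, hg, -, hfg⟩ := exists_measurable_rep f
    refine norm_le_of_enorm_rpow_le hP ((hTle f g hg hfg).trans ?_)
    rw [ENNReal.coe_mul, ENNReal.coe_rpow_of_nonneg _ hP.le, mul_assoc]
    exact mul_le_mul_right (lintegral_rep_le hp1 hp hμ hg hfg) _
  have hsum := fun S₀ : BergmanOp n α p =>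
    exists_glue hp hF hdisj _ (tsum_enorm_comp_rpow_le hp1 hp hμ hG hmult hTGle S₀)
  -- The glued operator is split as R₁ + R₂, coming from S' and S - S'. R₁ is compared with S' T_μ
  -- on each F_j, while R₂ is estimated by its norm alone.
  obtain ⟨R₁, hR₁, hR₁ae, -⟩ := hsum S'
  obtain ⟨R₂, hR₂, -, hR₂le⟩ := hsum (S - S')
  rw [nnreal_mul_rpow_one_div hP, NNReal.coe_mul, coe_nnnorm] at hR₂le
  refine ⟨T, hT, F, G, hF, hG, hFG, hGball, hcov, hdisj, hmult, fun j z hz w hw => ?_,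
    TG, R₁ + R₂, hTG, fun f => ?_, ?_⟩
  · have hz1 := mem_unitBall.1 (hGball j hz)
    have hw1 := mem_unitBall.1 (hGball j hw)
    refine (hypDist_le hz1 hw1).trans ?_
    have hpos := coshSq_pos hz1 hw1
    gcongr
    exact hdiam j z hz w hw
  · have h := (hR₁ f).add (hR₂ f)
    simp only [← map_add] at h
    change HasSum _ (R₁ f + R₂ f)
    convert h using 2 with j
    congr 1
    simp
  · have h1 := norm_sub_glue_le hη.le hp1 hp hκ hS'κ hB hμ hG hcov hT hTG
      (zero_lt_one.trans hM1) hfar hR₁ae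
    have h2 : ‖(incl n α p).comp ((S - S').comp T)‖ ≤ ‖S - S'‖ * τ :=
      (norm_incl_comp_le _).trans ((ContinuousLinearMap.opNorm_comp_le _ _).trans (by gcongr))
    have e : (incl n α p).comp (S.comp T) - (R₁ + R₂)
        = ((incl n α p).comp (S'.comp T) - R₁)
          + ((incl n α p).comp ((S - S').comp T) - R₂) := by
      rw [ContinuousLinearMap.sub_comp, ContinuousLinearMap.comp_sub]
      abel
    rw [e]
    have h3 := norm_add_le ((incl n α p).comp (S'.comp T) - R₁)
      ((incl n α p).comp ((S - S').comp T) - R₂)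
    have h4 := norm_sub_le ((incl n α p).comp ((S - S').comp T)) R₂
    have h5 := norm_nonneg (S - S')
    change ‖R₂‖ ≤ ‖S - S'‖ * ρ at hR₂le
    nlinarith
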